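/- **Theorem (Convergence rate of SRMBA, expectation setting).** Let $f(x,y)=\mathbb E_\xi[F(x,y;\xi)]$ and $g(x,y)=\mathbb E_\zeta[G(x,y;\zeta)]$ on $\mathbb R^{d_x}\times\mathbb R^{d_y}$, where each $F(\cdot;\xi)$ is differentiable and each $G(\cdot;\zeta)$ is twice differentiable. Write $\nabla_1,\nabla_2$ for the gradients in $x$ and $y$, $y^*(x)=\arg\min_y g(x,y)$ and $H(x)=f(x,y^*(x))$. Assume, with constants $L^f,L^g_1,L^g_2\ge 0$ and $\mu,C^f>0$ (vectors carry Euclidean norms, Hessians the spectral norm): 1. (Smoothness of $f$) $f$ is differentiable, $\nabla f$ is $L^f$-Lipschitz in $(x,y)$, and $\|\nabla_2 f(x,y^*(x))\|\le C^f$ for all $x$. 2. (Smoothness and strong convexity of $g$) $g$ is twice differentiable, $\nabla g$ and $\nabla^2 g$ are $L^g_1$- and $L^g_2$-Lipschitz in $(x,y)$, and $g(x,\cdot)$ is $\mu$-strongly convex for every $x$. 3. (Bounded variance) For all $(x,y)$, $\mathbb E\|\nabla F(x,y;\xi)-\nabla f(x,y)\|^2\le\sigma_f^2$, $\mathbb E\|\nabla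 G(x,y;\zeta)-\nabla g(x,y)\|^2\le\sigma_{g,1}^2$ and $\mathbb E\|\nabla^2 G(x,y;\zeta)-\nabla^2 g(x,y)\|^2\le\sigma_{g,2}^2$. 4. (Mean-squared smoothness) For all $u,u'\in\mathbb R^{d_x}\times\mathbb R^{d_y}$, $\mathbb E\|\nabla F(u;\xi)-\nabla F(u';\xi)\|^2\le (L^f)^2\|u-u'\|^2$, $\mathbb E\|\nabla G(u;\zeta)-\nabla G(u';\zeta)\|^2\le (L^g_1)^2\|u-u'\|^2$ and $\mathbb E\|\nabla^2 G(u;\zeta)-\nabla^2 G(u';\zeta)\|^2\le (L^g_2)^2\|u-u'\|^2$. 5. $H$ is bounded below. *SRMBA.* Put $R=C^f/\mu$ and take arbitrary deterministic $(x_{-1},y_{-1},z_{-1})$, $(x_0,y_0,z_0)$ and $v^x_{-1},v^y_{-1},v^z_{-1}$. At iteration $k=0,1,2,\dots$ draw samples $\xi_k,\zeta_k$ distributed as $\xi$ and $\zeta$, the pairs $(\xi_k,\zeta_k)$ being independent over $k$. For $j\in\{k-1,k\}$ let $$D^x_j=\nabla_1F(x_j,y_j;\xi_k)-\nabla^2_{12}G(x_j,y_j;\zeta_k)z_j,\quad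 D^y_j=\nabla_2G(x_j,y_j;\zeta_k),\quad D^z_j=\nabla^2_{22}G(x_j,y_j;\zeta_k)z_j-\nabla_2F(x_j,y_j;\xi_k),$$ (the same sample at both points), set $v^\bullet_k=\rho^\bullet_kD^\bullet_k+(1-\rho^\bullet_k)(v^\bullet_{k-1}+D^\bullet_k-D^\bullet_{k-1})$ for $\bullet\in\{x,y,z\}$, and update $$x_{k+1}=x_k-\alpha_kv^x_k,\qquad y_{k+1}=y_k-\beta_kv^y_k,\qquad z_{k+1}=\mathrm{Proj}_{\{\|z\|\le R\}}(z_k-\gamma_kv^z_k).$$ *Conclusion.* There are positive constants $\eta,c_\beta,c_\gamma,c_x,c_y,c_z$, depending only on $L^f,L^g_1,L^g_2,\mu,C^f$, such that with $$\alpha_k=(\eta+k)^{-1/3},\quad\beta_k=c_\beta\alpha_k,\quad\gamma_k=c_\gamma\alpha_k,\quad\rho^x_k=c_x\alpha_k^2,\quad\rho^y_k=c_y\alpha_k^2,\quad\rho^z_k=c_z\alpha_k^2$$ the following holds. $H$ is differentiable, every $\mathbb E\|\nabla H(x_k)\|^2$ is finite, and there is a constant $C>0$, independent of $K$ and $\varepsilon$,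 with $$\frac1K\sum_{k=0}^{K-1}\mathbb E\|\nabla H(x_k)\|^2\le C\,\frac{\log K}{K^{2/3}}\quad(K\ge2),\qquad \frac1K\sum_{k=0}^{K-1}\mathbb E\|\nabla H(x_k)\|^2\le C\,\frac{\log(K-1)}{K^{2/3}}\quad(K\ge3).$$ Consequently, for every $\varepsilon\in(0,1/2]$ there is a number $K\ge 1$ of iterations that makes at most $C\,\varepsilon^{-3/2}(\log\varepsilon^{-1})^{3/2}$ calls in total to stochastic gradients and Hessian- or Jacobian-vector products, for which $\frac1K\sum_{k<K}\mathbb E\|\nabla H(x_k)\|^2\le\varepsilon$; in particular some iterate $x_k$ with $k<K$ satisfies $\mathbb E\|\nabla H(x_k)\|^2\le\varepsilon$. -/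

import Mathlib

open MeasureTheory ProbabilityTheory
open scoped Gradient

noncomputable section

/-- `E × F` with the norm `‖(x, y)‖² = ‖x‖² + ‖y‖²`; for `E = ℝ^{dx}`, `F = ℝ^{dy}` this is
`ℝ^{dx} × ℝ^{dy}` with its Euclidean norm. -/
abbrev Joint (E F : Type*) := WithLp 2 (E × F)

section Directions

variable {E F : Type*} [NormedAddCommGroup E] [InnerProductSpace ℝ E] [CompleteSpace E]
  [NormedAddCommGroup F] [InnerProductSpace ℝ F] [CompleteSpace F]

/-- The point `(x, y)`. -/
def pt (x : E) (y : F) : Joint E F := WithLp.toLp 2 (x, y)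

/-- The Hessian `∇²φ(u)`, as a linear map; its norm is the spectral norm. -/
def hess (φ : Joint E F → ℝ) (u : Joint E F) : Joint E F →L[ℝ] Joint E F :=
  fderiv ℝ (∇ φ) u

/-- `∇₁φ(x, y)`, the partial gradient in `x`. -/
def grad₁ (φ : Joint E F → ℝ) (x : E) (y : F) : E :=
  (∇ φ (pt x y)).fst

/-- `∇₂φ(x, y)`, the partial gradient in `y`. -/
def grad₂ (φ : Joint E F → ℝ) (x : E) (y : F) : F :=
  (∇ φ (pt x y)).snd

/-- `∇²₁₂φ(x, y) z`, a vector of `E`. -/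
def hess₁₂ (φ : Joint E F → ℝ) (x : E) (y : F) (z : F) : E :=
  (hess φ (pt x y) (pt 0 z)).fst

/-- `∇²₂₂φ(x, y) z`, a vector of `F`. -/
def hess₂₂ (φ : Joint E F → ℝ) (x : E) (y : F) (z : F) : F :=
  (hess φ (pt x y) (pt 0 z)).snd

/-- `D_x(x, y, z) = ∇₁φ(x, y) - ∇²₁₂ψ(x, y) z`. -/
def dirX (φ ψ : Joint E F → ℝ) (x : E) (y z : F) : E :=
  grad₁ φ x y - hess₁₂ ψ x y z

/-- `D_y(x, y, z) = ∇₂ψ(x, y)`. -/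
def dirY (ψ : Joint E F → ℝ) (x : E) (y : F) : F :=
  grad₂ ψ x y

/-- `D_z(x, y, z) = ∇²₂₂ψ(x, y) z - ∇₂φ(x, y)`. -/
def dirZ (φ ψ : Joint E F → ℝ) (x : E) (y z : F) : F :=
  hess₂₂ ψ x y z - grad₂ φ x y

/-- The Euclidean projection onto the closed ball of radius `R` centred at `0`. -/
def projBall (R : ℝ) (w : F) : F :=
  if ‖w‖ ≤ R then w else (R / ‖w‖) • w

end Directions

/-- The data of a stochastic bilevel problem in expectation form: the stochastic functions
`F(x, y; ξ)` (`upper`) and `G(x, y; ζ)` (`lower`) and the distributions of `ξ` and `ζ`. -/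
structure StochasticBilevel (E F Ξ Z : Type*) [MeasurableSpace Ξ] [MeasurableSpace Z] where
  upper : Joint E F → Ξ → ℝ
  lower : Joint E F → Z → ℝ
  lawξ : Measure Ξ
  lawζ : Measure Z

namespace StochasticBilevel

variable {E F : Type*} [NormedAddCommGroup E] [InnerProductSpace ℝ E] [CompleteSpace E]
  [NormedAddCommGroup F] [InnerProductSpace ℝ F] [CompleteSpace F]
  {Ξ Z : Type*} [MeasurableSpace Ξ] [MeasurableSpace Z]

/-- The upper-level objective `f(x, y) = E[F(x, y; ξ)]`. -/
def f (p : StochasticBilevel E F Ξ Z) (u : Joint E F) : ℝ := ∫ ξ, p.upper u ξ ∂p.lawξ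

/-- The lower-level objective `g(x, y) = E[G(x, y; ζ)]`. -/
def g (p : StochasticBilevel E F Ξ Z) (u : Joint E F) : ℝ := ∫ ζ, p.lower u ζ ∂p.lawζ

/-- `y*(x)`, a minimizer of `g(x, ·)` (the unique one, under strong convexity). -/
def yStar (p : StochasticBilevel E F Ξ Z) (x : E) : F :=
  Classical.epsilon fun y => ∀ y', p.g (pt x y) ≤ p.g (pt x y')

/-- `H(x) = f(x, y*(x))`. -/
def H (p : StochasticBilevel E F Ξ Z) (x : E) : ℝ := p.f (pt x (p.yStar x))

/-- What the expectation form takes for granted: `ξ` and `ζ` have probability distributions,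
`F` and `G` are measurable and integrable in the sample, every `F(·; ξ)` is differentiable and
every `G(·; ζ)` is twice differentiable. -/
structure WellPosed (p : StochasticBilevel E F Ξ Z) : Prop where
  probξ : IsProbabilityMeasure p.lawξ
  probζ : IsProbabilityMeasure p.lawζ
  measF : ∀ u, Measurable (p.upper u)
  measG : ∀ u, Measurable (p.lower u)
  intF : ∀ u, Integrable (p.upper u) p.lawξ
  intG : ∀ u, Integrable (p.lower u) p.lawζ
  diffF : ∀ ξ, Differentiable ℝ fun u => p.upper u ξ
  diffG : ∀ ζ, Differentiable ℝ fun u => p.lower u ζ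
  diffGradG : ∀ ζ, Differentiable ℝ (∇ fun u => p.lower u ζ)

/-- Smoothness of `f`, and boundedness of `∇₂f` along the lower-level solutions. -/
structure UpperSmooth (p : StochasticBilevel E F Ξ Z) (Lf Cf : ℝ) : Prop where
  diff : Differentiable ℝ p.f
  lipGrad : ∀ u v, ‖∇ p.f u - ∇ p.f v‖ ≤ Lf * ‖u - v‖
  bddGrad₂ : ∀ x, ‖grad₂ p.f x (p.yStar x)‖ ≤ Cf

/-- Smoothness of `g` up to second order, and `μ`-strong convexity of `g(x, ·)`. -/
structure LowerSmooth (p : StochasticBilevel E F Ξ Z) (Lg₁ Lg₂ μ : ℝ) : Prop where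
  diff : Differentiable ℝ p.g
  diffGrad : Differentiable ℝ (∇ p.g)
  lipGrad : ∀ u v, ‖∇ p.g u - ∇ p.g v‖ ≤ Lg₁ * ‖u - v‖
  lipHess : ∀ u v, ‖hess p.g u - hess p.g v‖ ≤ Lg₂ * ‖u - v‖
  strongConvex : ∀ x, StrongConvexOn Set.univ μ fun y => p.g (pt x y)

/-- Bounded variance. The second moments are Lebesgue integrals with values in `[0, ∞]`. -/
structure BoundedVariance (p : StochasticBilevel E F Ξ Z) (σf σg₁ σg₂ : ℝ) : Prop where
  gradF : ∀ u, ∫⁻ ξ, ‖∇ (fun w => p.upper w ξ) u - ∇ p.f u‖ₑ ^ 2 ∂p.lawξ ≤ ENNReal.ofReal (σf ^ 2)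
  gradG : ∀ u, ∫⁻ ζ, ‖∇ (fun w => p.lower w ζ) u - ∇ p.g u‖ₑ ^ 2 ∂p.lawζ ≤ ENNReal.ofReal (σg₁ ^ 2)
  hessG : ∀ u, ∫⁻ ζ, ‖hess (fun w => p.lower w ζ) u - hess p.g u‖ₑ ^ 2 ∂p.lawζ
    ≤ ENNReal.ofReal (σg₂ ^ 2)

/-- Mean-squared smoothness: `∇F`, `∇G` and `∇²G` are Lipschitz in `(x, y)` in mean square. -/
structure MeanSquaredSmooth (p : StochasticBilevel E F Ξ Z) (Lf Lg₁ Lg₂ : ℝ) : Prop where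
  gradF : ∀ u v, ∫⁻ ξ, ‖∇ (fun w => p.upper w ξ) u - ∇ (fun w => p.upper w ξ) v‖ₑ ^ 2 ∂p.lawξ
    ≤ ENNReal.ofReal ((Lf * ‖u - v‖) ^ 2)
  gradG : ∀ u v, ∫⁻ ζ, ‖∇ (fun w => p.lower w ζ) u - ∇ (fun w => p.lower w ζ) v‖ₑ ^ 2 ∂p.lawζ
    ≤ ENNReal.ofReal ((Lg₁ * ‖u - v‖) ^ 2)
  hessG : ∀ u v, ∫⁻ ζ, ‖hess (fun w => p.lower w ζ) u - hess (fun w => p.lower w ζ) v‖ₑ ^ 2 ∂p.lawζ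
    ≤ ENNReal.ofReal ((Lg₂ * ‖u - v‖) ^ 2)

/-- The samples drawn by the algorithm: `ξ k` and `ζ k` have the prescribed distributions, and
the pairs `(ξ k, ζ k)` of different iterations are independent. -/
structure Sampling (p : StochasticBilevel E F Ξ Z) {Ω : Type*} [MeasurableSpace Ω]
    (P : Measure Ω) (ξ : ℕ → Ω → Ξ) (ζ : ℕ → Ω → Z) : Prop where
  measξ : ∀ k, Measurable (ξ k)
  measζ : ∀ k, Measurable (ζ k)
  lawξ : ∀ k, P.map (ξ k) = p.lawξ
  lawζ : ∀ k, P.map (ζ k) = p.lawζ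
  indep : iIndepFun (fun k ω => (ξ k ω, ζ k ω)) P

/-- `E‖∇H(X)‖²`. -/
def expSqGrad (p : StochasticBilevel E F Ξ Z) {Ω : Type*} [MeasurableSpace Ω] (P : Measure Ω)
    (X : Ω → E) : ℝ := ∫ ω, ‖∇ p.H (X ω)‖ ^ 2 ∂P

/-- `(1/K) ∑_{k < K} E‖∇H(X_k)‖²`. -/
def avgSqGrad (p : StochasticBilevel E F Ξ Z) {Ω : Type*} [MeasurableSpace Ω] (P : Measure Ω)
    (X : ℕ → Ω → E) (K : ℕ) : ℝ :=
  (1 / (K : ℝ)) * ∑ k ∈ Finset.range K, p.expSqGrad P (X k)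

end StochasticBilevel

/-- The memory of the algorithm at the start of iteration `k`: the points with indices `k - 1`
and `k`, the directions with index `k - 1`, and the number of calls made so far to stochastic
gradients and to Hessian- or Jacobian-vector products. -/
structure State (E F : Type*) where
  xPrev : E
  yPrev : F
  zPrev : F
  x : E
  y : F
  z : F
  vx : E
  vy : F
  vz : F
  calls : ℕ

/-- Step sizes and momentum parameters. -/
structure Schedule where
  α : ℕ → ℝ
  β : ℕ → ℝ
  γ : ℕ → ℝ
  ρx : ℕ → ℝ
  ρy : ℕ → ℝ
  ρz : ℕ → ℝ

/-- The recursive-momentum estimator `ρ D_k + (1 - ρ) (v_{k-1} + D_k - D_{k-1})`. -/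
def momentum {V : Type*} [AddCommGroup V] [Module ℝ V] (ρ : ℝ) (D D' v : V) : V :=
  ρ • D + (1 - ρ) • (v + D - D')

section Algorithm

variable {E F : Type*} [NormedAddCommGroup E] [InnerProductSpace ℝ E] [CompleteSpace E]
  [NormedAddCommGroup F] [InnerProductSpace ℝ F] [CompleteSpace F]

/-- One iteration, with `φ = F(·; ξ_k)` and `ψ = G(·; ζ_k)`; the same sample is used at the
current and at the previous point. Each evaluation of `D_x`, `D_y`, `D_z` makes `2`, `1`, `2`
oracle calls, and each is evaluated at two points. -/
def srmbaStep (R : ℝ) (c : Schedule) (k : ℕ) (φ ψ : Joint E F → ℝ)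
    (s : State E F) : State E F :=
  let vx := momentum (c.ρx k) (dirX φ ψ s.x s.y s.z) (dirX φ ψ s.xPrev s.yPrev s.zPrev) s.vx
  let vy := momentum (c.ρy k) (dirY ψ s.x s.y) (dirY ψ s.xPrev s.yPrev) s.vy
  let vz := momentum (c.ρz k) (dirZ φ ψ s.x s.y s.z) (dirZ φ ψ s.xPrev s.yPrev s.zPrev) s.vz
  { xPrev := s.x
    yPrev := s.y
    zPrev := s.z
    x := s.x - c.α k • vx
    y := s.y - c.β k • vy
    z := projBall R (s.z - c.γ k • vz)
    vx := vx
    vy := vy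
    vz := vz
    calls := s.calls + 2 * (2 + 1 + 2) }

/-- The state after `k` iterations on the sample path `ω`, started at `s₀`. -/
def srmba {Ξ Z Ω : Type*} [MeasurableSpace Ξ] [MeasurableSpace Z]
    (p : StochasticBilevel E F Ξ Z) (R : ℝ) (c : Schedule) (ξ : ℕ → Ω → Ξ) (ζ : ℕ → Ω → Z)
    (s₀ : State E F) : ℕ → Ω → State E F
  | 0, _ => s₀
  | k + 1, ω => srmbaStep R c k (fun u => p.upper u (ξ k ω)) (fun u => p.lower u (ζ k ω))
      (srmba p R c ξ ζ s₀ k ω)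

end Algorithm

/-- `α_k = (η + k)^{-1/3}`, `β_k = c_β α_k`, `γ_k = c_γ α_k`, `ρ_k = c α_k²`. -/
def stormSchedule (η cβ cγ cx cy cz : ℝ) : Schedule where
  α k := 1 / (η + k) ^ (1 / 3 : ℝ)
  β k := cβ * (1 / (η + k) ^ (1 / 3 : ℝ))
  γ k := cγ * (1 / (η + k) ^ (1 / 3 : ℝ))
  ρx k := cx * (1 / (η + k) ^ (1 / 3 : ℝ)) ^ 2
  ρy k := cy * (1 / (η + k) ^ (1 / 3 : ℝ)) ^ 2
  ρz k := cz * (1 / (η + k) ^ (1 / 3 : ℝ)) ^ 2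

end

/-! The gradient of H is `dirX p.f p.g x (p.yStar x) (p.zStar x)`, where z* solves ∇²₂₂g(x, y*) z =
∇₂f(x, y*). Differentiability of y* is never used. Strong monotonicity makes y* and z* Lipschitz in
x. Then f is expanded along the curve (x, y*(x)), and the expansion of ∇g between two points of that
curve is paired with (0, z*). Since ∇₂g vanishes on the curve and the Hessian is symmetric, the
unknown displacement of y* cancels up to a quadratic remainder (`abs_H_sub_le`). This gives both the
gradient formula and the descent inequality.

Along the iterates, descent on H fails only through three errors: the distance of y to y*(x), the
distance of z to z*(x), and the error of the estimators v. The first two contract at rate βμ/2 and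
γμ/2, up to the estimation error and the drift of the targets as x moves (`tracking_y`,
`tracking_z`). For the third, the same sample is used at the old and the new point, so the error
equals (1 - ρ) times the old error plus centred noise orthogonal to the past. The second moment of
that noise is of order ρ² plus the squared distance just moved (`integral_error_le`). Centredness
has to be derived: differentiation under the expectation follows from mean-squared smoothness,
because f, g and ∇g are known to be differentiable and only the values of their derivatives remain
to be identified.

The outcome is a system of scalar inequalities, `Recursion`. The potential h + A_y y + A_z z + A_w w
/ α decreases by α_k n_k / 2, up to a noise term of order α_{k+1}³, for suitable weights
(`exists_potentialWeights`). The weight 1 / α on w turns the contraction ρ = c α² into a gain of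
order α w, which beats the growth 1 / α_{k+1} - 1 / α_k ≤ α_k. With α_k = (η + k)^{-1/3} the noise
sums to a harmonic series, hence log K, and dividing by K α_K, of order K^{2/3}, gives the rate. The
variances enter only through the noise term, so the algorithmic constants do not depend on them. -/

set_option linter.unusedSectionVars false

noncomputable section

/-! ### Geometry of the product space, perturbed gradient steps, projection on a ball. -/

section Geometry

variable {E F : Type*} [NormedAddCommGroup E] [InnerProductSpace ℝ E]
  [NormedAddCommGroup F] [InnerProductSpace ℝ F]

local notation "⟪" x ", " y "⟫" => inner ℝ x y

@[simp] lemma pt_fst (x : E) (y : F) : (pt x y).fst = x := rfl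

@[simp] lemma pt_snd (x : E) (y : F) : (pt x y).snd = y := rfl

lemma pt_sub (x x' : E) (y y' : F) : pt x y - pt x' y' = pt (x - x') (y - y') := rfl

lemma pt_add (x x' : E) (y y' : F) : pt x y + pt x' y' = pt (x + x') (y + y') := rfl

lemma smul_pt (c : ℝ) (x : E) (y : F) : c • pt x y = pt (c • x) (c • y) := rfl

lemma pt_zero_sub (z z' : F) : pt (0 : E) (z - z') = pt 0 z - pt 0 z' := by
  rw [pt_sub, sub_zero]

lemma norm_pt_sq (x : E) (y : F) : ‖pt x y‖ ^ 2 = ‖x‖ ^ 2 + ‖y‖ ^ 2 :=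
  WithLp.prod_norm_sq_eq_of_L2 _

lemma norm_pt_zero (z : F) : ‖pt (0 : E) z‖ = ‖z‖ := by
  have h := norm_pt_sq (0 : E) z
  rw [norm_zero, zero_pow two_ne_zero, zero_add] at h
  exact (sq_eq_sq₀ (norm_nonneg _) (norm_nonneg _)).1 h

lemma norm_pt_le (x : E) (y : F) : ‖pt x y‖ ≤ ‖x‖ + ‖y‖ := by
  have h := norm_pt_sq x y
  nlinarith [norm_nonneg x, norm_nonneg y, norm_nonneg (pt x y)]

lemma norm_fst_le_joint (u : Joint E F) : ‖u.fst‖ ≤ ‖u‖ := by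
  have h := WithLp.prod_norm_sq_eq_of_L2 u
  exact abs_le_of_sq_le_sq' (by nlinarith [sq_nonneg ‖u.snd‖]) (norm_nonneg _) |>.2

lemma norm_snd_le_joint (u : Joint E F) : ‖u.snd‖ ≤ ‖u‖ := by
  have h := WithLp.prod_norm_sq_eq_of_L2 u
  exact abs_le_of_sq_le_sq' (by nlinarith [sq_nonneg ‖u.fst‖]) (norm_nonneg _) |>.2

lemma inner_joint (u v : Joint E F) : ⟪u, v⟫ = ⟪u.fst, v.fst⟫ + ⟪u.snd, v.snd⟫ :=
  WithLp.prod_inner_apply _ _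

lemma continuous_pt : Continuous fun w : E × F => pt w.1 w.2 :=
  WithLp.prod_continuous_toLp 2 E F

lemma norm_add_sq_le_two (a b : E) : ‖a + b‖ ^ 2 ≤ 2 * ‖a‖ ^ 2 + 2 * ‖b‖ ^ 2 := by
  have := norm_add_le a b
  nlinarith [norm_nonneg a, norm_nonneg b, norm_nonneg (a + b), sq_nonneg (‖a‖ - ‖b‖)]

lemma norm_sub_sq_le_two (a b : E) : ‖a - b‖ ^ 2 ≤ 2 * ‖a‖ ^ 2 + 2 * ‖b‖ ^ 2 := by
  simpa [sub_eq_add_neg] using norm_add_sq_le_two a (-b)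

lemma norm_add_sq_le_young (a b : E) {t : ℝ} (ht : 0 < t) :
    ‖a + b‖ ^ 2 ≤ (1 + t) * ‖a‖ ^ 2 + (1 + 1 / t) * ‖b‖ ^ 2 := by
  have h1 := norm_add_le a b
  have h2 : 2 * ‖a‖ * ‖b‖ ≤ t * ‖a‖ ^ 2 + 1 / t * ‖b‖ ^ 2 := by
    have h : 0 ≤ 1 / t * (t * ‖a‖ - ‖b‖) ^ 2 := by positivity
    have e : 1 / t * (t * ‖a‖ - ‖b‖) ^ 2
        = t * ‖a‖ ^ 2 + 1 / t * ‖b‖ ^ 2 - 2 * ‖a‖ * ‖b‖ := by field_simp; ring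
    linarith
  nlinarith [norm_nonneg a, norm_nonneg b, norm_nonneg (a + b)]

/-- One perturbed gradient step towards the zero of a strongly monotone map, when the target
moves. -/
lemma tracking_step {e d r s : F} {μ L β : ℝ} (hμ : 0 < μ) (hβ : 0 < β) (hβL : β * L ^ 2 ≤ μ)
    (hβμ : β * μ ≤ 1) (hmono : μ * ‖e‖ ^ 2 ≤ ⟪d, e⟫) (hlip : ‖d‖ ≤ L * ‖e‖) :
    ‖e - β • d - β • r + s‖ ^ 2
      ≤ (1 - β * μ / 2) * ‖e‖ ^ 2 + 6 * β / μ * ‖r‖ ^ 2 + 6 / (β * μ) * ‖s‖ ^ 2 := by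
  have hbm : 0 < β * μ := mul_pos hβ hμ
  have h1 : ‖e - β • d‖ ^ 2 ≤ (1 - β * μ) * ‖e‖ ^ 2 := by
    rw [norm_sub_sq_real, inner_smul_right, norm_smul, real_inner_comm, Real.norm_of_nonneg hβ.le]
    have h2 : ‖d‖ ^ 2 ≤ L ^ 2 * ‖e‖ ^ 2 := by
      rw [← mul_pow]; exact pow_le_pow_left₀ (norm_nonneg _) hlip 2
    have h3 : β * (β * ‖d‖ ^ 2) ≤ β * (μ * ‖e‖ ^ 2) := by
      refine mul_le_mul_of_nonneg_left ?_ hβ.le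
      calc β * ‖d‖ ^ 2 ≤ β * (L ^ 2 * ‖e‖ ^ 2) := mul_le_mul_of_nonneg_left h2 hβ.le
        _ = β * L ^ 2 * ‖e‖ ^ 2 := by ring
        _ ≤ μ * ‖e‖ ^ 2 := mul_le_mul_of_nonneg_right hβL (sq_nonneg _)
    have h4 := mul_le_mul_of_nonneg_left hmono hβ.le
    nlinarith
  have h2 : ‖s - β • r‖ ^ 2 ≤ 2 * ‖s‖ ^ 2 + 2 * (β ^ 2 * ‖r‖ ^ 2) := by
    have := norm_sub_sq_le_two s (β • r)
    rwa [norm_smul, Real.norm_of_nonneg hβ.le, mul_pow] at this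
  -- The Young parameter βμ/2 spends half of the contraction: (1 + βμ/2)(1 - βμ) ≤ 1 - βμ/2.
  have h3 := norm_add_sq_le_young (e - β • d) (s - β • r) (half_pos hbm)
  have e1 : e - β • d + (s - β • r) = e - β • d - β • r + s := by abel
  rw [e1] at h3
  have h4 : (1 + β * μ / 2) * ‖e - β • d‖ ^ 2 ≤ (1 - β * μ / 2) * ‖e‖ ^ 2 := by
    calc (1 + β * μ / 2) * ‖e - β • d‖ ^ 2 ≤ (1 + β * μ / 2) * ((1 - β * μ) * ‖e‖ ^ 2) :=
          mul_le_mul_of_nonneg_left h1 (by positivity)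
      _ ≤ (1 - β * μ / 2) * ‖e‖ ^ 2 := by
          have : 0 ≤ (β * μ) ^ 2 * ‖e‖ ^ 2 := by positivity
          nlinarith
  have h5 : (1 + 1 / (β * μ / 2)) * ‖s - β • r‖ ^ 2
      ≤ 3 / (β * μ) * (2 * ‖s‖ ^ 2 + 2 * (β ^ 2 * ‖r‖ ^ 2)) := by
    refine mul_le_mul ?_ h2 (sq_nonneg _) (by positivity)
    rw [div_div_eq_mul_div, ← sub_nonneg]
    have : 3 / (β * μ) - (1 + 1 * 2 / (β * μ)) = (1 - β * μ) / (β * μ) := by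
      field_simp; ring
    rw [this]; exact div_nonneg (by linarith) hbm.le
  have e2 : 3 / (β * μ) * (2 * ‖s‖ ^ 2 + 2 * (β ^ 2 * ‖r‖ ^ 2))
      = 6 * β / μ * ‖r‖ ^ 2 + 6 / (β * μ) * ‖s‖ ^ 2 := by field_simp; ring
  linarith

lemma norm_projBall_le {R : ℝ} (hR : 0 ≤ R) (w : F) : ‖projBall R w‖ ≤ R := by
  unfold projBall
  split_ifs with h
  · exact h
  · have hw : 0 < ‖w‖ := hR.trans_lt (not_le.1 h)
    rw [norm_smul, Real.norm_of_nonneg (by positivity), div_mul_cancel₀ _ hw.ne']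

/-- For w outside the ball, bounding the inner product of w and z by ‖w‖R makes the difference of
the squared distances at least (‖w‖ - R)². Comparison with points of the ball suffices: the targets
z* and the iterates z_k with k ≥ 1 lie there. -/
lemma norm_projBall_sub_le {R : ℝ} (hR : 0 ≤ R) (w : F) {z : F} (hz : ‖z‖ ≤ R) :
    ‖projBall R w - z‖ ≤ ‖w - z‖ := by
  unfold projBall
  split_ifs with h
  · exact le_rfl
  · have hw : 0 < ‖w‖ := hR.trans_lt (not_le.1 h)
    set c := R / ‖w‖ with hc
    have hcw : c * ‖w‖ = R := div_mul_cancel₀ _ hw.ne'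
    have hc0 : 0 ≤ c := by positivity
    have hc1 : c < 1 := by rw [hc, div_lt_one hw]; exact not_le.1 h
    have h1 : ⟪w, z⟫ ≤ ‖w‖ * R := (real_inner_le_norm _ _).trans (by gcongr)
    have h2 : ‖c • w - z‖ ^ 2 ≤ ‖w - z‖ ^ 2 := by
      rw [norm_sub_sq_real, norm_sub_sq_real, norm_smul, Real.norm_of_nonneg hc0, inner_smul_left,
        hcw]
      simp only [conj_trivial]
      have h3 : 0 ≤ (1 - c) * (‖w‖ * R - ⟪w, z⟫) :=
        mul_nonneg (by linarith) (by linarith)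
      have h4 : R ≤ ‖w‖ := (not_le.1 h).le
      nlinarith
    exact abs_le_of_sq_le_sq' h2 (norm_nonneg _) |>.2

lemma measurable_projBall [MeasurableSpace F] [BorelSpace F] (R : ℝ) :
    Measurable (projBall R : F → F) := by
  unfold projBall
  refine Measurable.ite (measurableSet_le measurable_norm measurable_const) measurable_id ?_
  exact (measurable_const.div measurable_norm).smul measurable_id

lemma norm_projBall_le_self {R : ℝ} (hR : 0 ≤ R) (w : F) : ‖projBall R w‖ ≤ ‖w‖ := by
  simpa using norm_projBall_sub_le hR w (z := 0) (by simpa using hR)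

end Geometry

/-! ### Taylor estimates from Lipschitz derivatives. -/

section Smooth

variable {V : Type*} [NormedAddCommGroup V] [InnerProductSpace ℝ V] [CompleteSpace V]

local notation "⟪" x ", " y "⟫" => inner ℝ x y

lemma fderiv_apply_eq_inner_gradient {φ : V → ℝ} (u w : V) : fderiv ℝ φ u w = ⟪∇ φ u, w⟫ := by
  simp [gradient]

lemma abs_taylor_one_le {φ : V → ℝ} (hφ : Differentiable ℝ φ) {L : ℝ}
    (hL : ∀ u v, ‖∇ φ u - ∇ φ v‖ ≤ L * ‖u - v‖) (u v : V) :
    |φ v - φ u - ⟪∇ φ u, v - u⟫| ≤ L * ‖v - u‖ ^ 2 := by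
  have h := Convex.norm_image_sub_le_of_norm_hasFDerivWithin_le' (f := φ) (f' := fderiv ℝ φ)
    (s := segment ℝ u v) (x := u) (y := v) (φ := fderiv ℝ φ u) (C := L * ‖v - u‖) (𝕜 := ℝ)
    (fun x _ => (hφ x).hasFDerivAt.hasFDerivWithinAt) ?_ (convex_segment _ _)
    (left_mem_segment _ _ _) (right_mem_segment _ _ _)
  · rw [fderiv_apply_eq_inner_gradient, Real.norm_eq_abs] at h
    calc _ ≤ _ := h
      _ = _ := by ring
  · intro x hx
    have hd : fderiv ℝ φ x - fderiv ℝ φ u = InnerProductSpace.toDual ℝ V (∇ φ x - ∇ φ u) := by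
      simp [gradient]
    rw [hd, LinearIsometryEquiv.norm_map]
    refine (hL x u).trans ?_
    -- No sign is assumed on L; a negative L forces any two points to coincide.
    have hL0 : 0 ≤ L ∨ ‖x - u‖ = 0 := by
      by_contra! hc
      have h1 := (norm_nonneg _).trans (hL x u)
      have h2 : 0 < ‖x - u‖ := lt_of_le_of_ne (norm_nonneg _) (Ne.symm hc.2)
      nlinarith
    rcases hL0 with h0 | h0
    · refine mul_le_mul_of_nonneg_left ?_ h0
      have := norm_sub_le_of_mem_segment hx
      simpa using this
    · rw [h0, mul_zero]
      have h3 := (norm_nonneg _).trans (hL v u)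
      exact h3

lemma norm_taylor_one_le {W : Type*} [NormedAddCommGroup W] [NormedSpace ℝ W] {φ : V → W}
    (hφ : Differentiable ℝ φ) {L : ℝ} (hL0 : 0 ≤ L)
    (hL : ∀ u v, ‖fderiv ℝ φ u - fderiv ℝ φ v‖ ≤ L * ‖u - v‖) (u v : V) :
    ‖φ v - φ u - fderiv ℝ φ u (v - u)‖ ≤ L * ‖v - u‖ ^ 2 := by
  have h := Convex.norm_image_sub_le_of_norm_hasFDerivWithin_le' (f := φ) (f' := fderiv ℝ φ)
    (s := segment ℝ u v) (x := u) (y := v) (φ := fderiv ℝ φ u) (C := L * ‖v - u‖) (𝕜 := ℝ)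
    (fun x _ => (hφ x).hasFDerivAt.hasFDerivWithinAt) ?_ (convex_segment _ _)
    (left_mem_segment _ _ _) (right_mem_segment _ _ _)
  · calc _ ≤ _ := h
      _ = _ := by ring
  · intro x hx
    exact (hL x u).trans (mul_le_mul_of_nonneg_left (norm_sub_le_of_mem_segment hx) hL0)

lemma opNorm_fderiv_le {W : Type*} [NormedAddCommGroup W] [NormedSpace ℝ W] {φ : V → W}
    {L : ℝ} (hL0 : 0 ≤ L) (hL : ∀ u v, ‖φ u - φ v‖ ≤ L * ‖u - v‖) (u : V) :
    ‖fderiv ℝ φ u‖ ≤ L := by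
  have : LipschitzWith ⟨L, hL0⟩ φ := LipschitzWith.of_dist_le_mul fun a b => by
    rw [dist_eq_norm, dist_eq_norm]; exact hL a b
  exact norm_fderiv_le_of_lipschitz ℝ this

lemma hasGradientAt_of_quadratic {φ : V → ℝ} {u q : V} {L : ℝ}
    (h : ∀ v, |φ v - φ u - ⟪q, v - u⟫| ≤ L * ‖v - u‖ ^ 2) : HasGradientAt φ q u := by
  rw [hasGradientAt_iff_isLittleO]
  have h1 : (fun v => φ v - φ u - ⟪q, v - u⟫) =O[nhds u] fun v => ‖v - u‖ ^ 2 :=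
    Asymptotics.IsBigO.of_bound L (Filter.Eventually.of_forall fun v => by
      simpa using h v)
  have h2 : (fun v => ‖v - u‖ ^ 2) =o[nhds u] fun v => v - u := by
    have h3 := Asymptotics.isLittleO_norm_pow_id (E' := V) (n := 2) (by norm_num)
    have h4 : Filter.Tendsto (fun v => v - u) (nhds u) (nhds 0) := by
      have : Continuous fun v : V => v - u := by fun_prop
      simpa using this.tendsto u
    exact h3.comp_tendsto h4
  exact h1.trans_isLittleO h2

end Smooth

section Hessian

variable {V : Type*} [NormedAddCommGroup V] [InnerProductSpace ℝ V] [CompleteSpace V]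

local notation "⟪" x ", " y "⟫" => inner ℝ x y

/-- The derivative of a differentiable gradient is symmetric. -/
lemma inner_fderiv_gradient_symm {φ : V → ℝ} (hφ : Differentiable ℝ φ) {u : V}
    (hφ' : DifferentiableAt ℝ (∇ φ) u) (v w : V) :
    ⟪fderiv ℝ (∇ φ) u v, w⟫ = ⟪fderiv ℝ (∇ φ) u w, v⟫ := by
  let A : V →L[ℝ] V →L[ℝ] ℝ := (innerₗ V).mkContinuous₂ 1 fun a b => by
    simpa using norm_inner_le_norm (𝕜 := ℝ) a b
  have hA : ∀ a b, A a b = ⟪a, b⟫ := fun a b => rfl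
  have h1 : ∀ y, HasFDerivAt φ (A (∇ φ y)) y := fun y => by
    have : A (∇ φ y) = fderiv ℝ φ y := by
      ext w; rw [hA, fderiv_apply_eq_inner_gradient]
    rw [this]; exact (hφ y).hasFDerivAt
  have h2 : HasFDerivAt (fun y => A (∇ φ y)) (A ∘L fderiv ℝ (∇ φ) u) u :=
    A.hasFDerivAt.comp u hφ'.hasFDerivAt
  simpa [hA] using second_derivative_symmetric h1 h2 v w

end Hessian

/-! ### Lipschitz bounds for the search directions. -/

section Directions

variable {E F : Type*} [NormedAddCommGroup E] [InnerProductSpace ℝ E] [CompleteSpace E]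
  [NormedAddCommGroup F] [InnerProductSpace ℝ F] [CompleteSpace F]

/-- The change of base point is charged to z and the change of vector to the Hessian at u', whose
norm is at most L₁. Only z enters through its size, so z' may be unbounded; later z is taken to be
z* or a projected iterate. -/
lemma norm_hess_sub_le {φ : Joint E F → ℝ} {L₁ L₂ : ℝ} (hL₁ : 0 ≤ L₁)
    (h₁ : ∀ u v, ‖∇ φ u - ∇ φ v‖ ≤ L₁ * ‖u - v‖)
    (h₂ : ∀ u v, ‖hess φ u - hess φ v‖ ≤ L₂ * ‖u - v‖) (u u' : Joint E F) (z z' : F) :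
    ‖hess φ u (pt 0 z) - hess φ u' (pt 0 z')‖
      ≤ L₂ * ‖u - u'‖ * ‖z‖ + L₁ * ‖z - z'‖ := by
  have e : hess φ u (pt 0 z) - hess φ u' (pt 0 z')
      = (hess φ u - hess φ u') (pt 0 z) + hess φ u' (pt 0 (z - z')) := by
    rw [pt_zero_sub, map_sub, sub_apply]; abel
  rw [e]
  refine (norm_add_le _ _).trans (add_le_add ?_ ?_)
  · refine (ContinuousLinearMap.le_opNorm _ _).trans ?_
    rw [norm_pt_zero]
    exact mul_le_mul_of_nonneg_right (h₂ _ _) (norm_nonneg _)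
  · refine (ContinuousLinearMap.le_opNorm _ _).trans ?_
    rw [norm_pt_zero]
    exact mul_le_mul_of_nonneg_right (opNorm_fderiv_le hL₁ h₁ _) (norm_nonneg _)

lemma norm_dirX_sub_le {φ ψ : Joint E F → ℝ} {L₀ L₁ L₂ : ℝ} (hL₁ : 0 ≤ L₁)
    (h₀ : ∀ u v, ‖∇ φ u - ∇ φ v‖ ≤ L₀ * ‖u - v‖)
    (h₁ : ∀ u v, ‖∇ ψ u - ∇ ψ v‖ ≤ L₁ * ‖u - v‖)
    (h₂ : ∀ u v, ‖hess ψ u - hess ψ v‖ ≤ L₂ * ‖u - v‖) (x x' : E) (y y' z z' : F) :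
    ‖dirX φ ψ x y z - dirX φ ψ x' y' z'‖
      ≤ (L₀ + L₂ * ‖z‖) * ‖pt x y - pt x' y'‖ + L₁ * ‖z - z'‖ := by
  have e : dirX φ ψ x y z - dirX φ ψ x' y' z' = (∇ φ (pt x y) - ∇ φ (pt x' y')).fst
      - (hess ψ (pt x y) (pt 0 z) - hess ψ (pt x' y') (pt 0 z')).fst := by
    simp only [dirX, grad₁, hess₁₂, WithLp.sub_fst]; abel
  rw [e]
  refine (norm_sub_le _ _).trans ?_
  have a := (norm_fst_le_joint _).trans (h₀ (pt x y) (pt x' y'))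
  have b := (norm_fst_le_joint _).trans (norm_hess_sub_le hL₁ h₁ h₂ (pt x y) (pt x' y') z z')
  linarith

lemma norm_dirZ_sub_le {φ ψ : Joint E F → ℝ} {L₀ L₁ L₂ : ℝ} (hL₁ : 0 ≤ L₁)
    (h₀ : ∀ u v, ‖∇ φ u - ∇ φ v‖ ≤ L₀ * ‖u - v‖)
    (h₁ : ∀ u v, ‖∇ ψ u - ∇ ψ v‖ ≤ L₁ * ‖u - v‖)
    (h₂ : ∀ u v, ‖hess ψ u - hess ψ v‖ ≤ L₂ * ‖u - v‖) (x x' : E) (y y' z z' : F) :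
    ‖dirZ φ ψ x y z - dirZ φ ψ x' y' z'‖
      ≤ (L₀ + L₂ * ‖z‖) * ‖pt x y - pt x' y'‖ + L₁ * ‖z - z'‖ := by
  have e : dirZ φ ψ x y z - dirZ φ ψ x' y' z' =
      (hess ψ (pt x y) (pt 0 z) - hess ψ (pt x' y') (pt 0 z')).snd
      - (∇ φ (pt x y) - ∇ φ (pt x' y')).snd := by
    simp only [dirZ, grad₂, hess₂₂, WithLp.sub_snd]; abel
  rw [e]
  refine (norm_sub_le _ _).trans ?_
  have a := (norm_snd_le_joint _).trans (h₀ (pt x y) (pt x' y'))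
  have b := (norm_snd_le_joint _).trans (norm_hess_sub_le hL₁ h₁ h₂ (pt x y) (pt x' y') z z')
  linarith

lemma norm_grad₂_sub_le {ψ : Joint E F → ℝ} {L₁ : ℝ}
    (h₁ : ∀ u v, ‖∇ ψ u - ∇ ψ v‖ ≤ L₁ * ‖u - v‖) (x x' : E) (y y' : F) :
    ‖grad₂ ψ x y - grad₂ ψ x' y'‖ ≤ L₁ * ‖pt x y - pt x' y'‖ := by
  have e : grad₂ ψ x y - grad₂ ψ x' y' = (∇ ψ (pt x y) - ∇ ψ (pt x' y')).snd := rfl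
  rw [e]
  exact (norm_snd_le_joint _).trans (h₁ _ _)

end Directions

/-! ### The deterministic bilevel problem: y*, z* and the gradient of H. -/

namespace StochasticBilevel

variable {E F : Type*} [NormedAddCommGroup E] [InnerProductSpace ℝ E] [FiniteDimensional ℝ E]
  [NormedAddCommGroup F] [InnerProductSpace ℝ F] [FiniteDimensional ℝ F]
  {Ξ Z : Type*} [MeasurableSpace Ξ] [MeasurableSpace Z]
  {p : StochasticBilevel E F Ξ Z} {Lf Lg₁ Lg₂ μ Cf : ℝ}

local notation "⟪" x ", " y "⟫" => inner ℝ x y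

/-- Strong convexity on the segment bounds the difference quotient at t > 0 by the right-hand side
minus (1 - t) times the quadratic term; let t decrease to 0. -/
lemma LowerSmooth.le_sub (h : p.LowerSmooth Lg₁ Lg₂ μ) (x : E) (y y' : F) :
    ⟪grad₂ p.g x y, y' - y⟫ + μ / 2 * ‖y' - y‖ ^ 2 ≤ p.g (pt x y') - p.g (pt x y) := by
  set φ : ℝ → ℝ := fun t => p.g (pt x y + t • pt 0 (y' - y)) with hφ
  have hline : HasDerivAt (fun t : ℝ => pt x y + t • pt (0 : E) (y' - y)) (pt 0 (y' - y)) 0 := by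
    simpa using ((hasDerivAt_id (0 : ℝ)).smul_const (pt (0 : E) (y' - y))).const_add (pt x y)
  have hd : HasDerivAt φ ⟪grad₂ p.g x y, y' - y⟫ 0 := by
    have h1 := ((h.diff (pt x y + (0 : ℝ) • pt 0 (y' - y))).hasFDerivAt).comp_hasDerivAt 0 hline
    rw [fderiv_apply_eq_inner_gradient, inner_joint] at h1
    simp only [zero_smul, add_zero, pt_fst, inner_zero_right, zero_add, pt_snd] at h1
    exact h1
  have hpos := hd.hasDerivWithinAt (s := Set.Ioi 0)
  rw [hasDerivWithinAt_iff_tendsto_slope' (by simp)] at hpos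
  have hlim : Filter.Tendsto
      (fun t : ℝ => p.g (pt x y') - p.g (pt x y) - (1 - t) * (μ / 2 * ‖y' - y‖ ^ 2))
      (nhdsWithin 0 (Set.Ioi 0))
      (nhds (p.g (pt x y') - p.g (pt x y) - (1 - 0) * (μ / 2 * ‖y' - y‖ ^ 2))) := by
    refine Filter.Tendsto.mono_left ?_ nhdsWithin_le_nhds
    exact Continuous.tendsto (by fun_prop) 0
  have hle := le_of_tendsto_of_tendsto hpos hlim ?_
  · linarith
  · have hmem : Set.Ioo (0 : ℝ) 1 ∈ nhdsWithin (0 : ℝ) (Set.Ioi 0) :=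
      Ioo_mem_nhdsGT one_pos
    filter_upwards [hmem] with t ht
    have hc := (h.strongConvex x).2 (Set.mem_univ y') (Set.mem_univ y) ht.1.le
      (sub_nonneg.2 ht.2.le) (by ring)
    have e1 : pt x (t • y' + (1 - t) • y) = pt x y + t • pt (0 : E) (y' - y) := by
      rw [smul_pt, pt_add]
      congr 1
      · simp
      · module
    simp only [e1, smul_eq_mul] at hc
    rw [slope_def_field]
    simp only [hφ, zero_smul, add_zero, sub_zero]
    rw [div_le_iff₀ ht.1]
    nlinarith

lemma LowerSmooth.strong_mono (h : p.LowerSmooth Lg₁ Lg₂ μ) (x : E) (y y' : F) :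
    μ * ‖y' - y‖ ^ 2 ≤ ⟪grad₂ p.g x y' - grad₂ p.g x y, y' - y⟫ := by
  have h1 := h.le_sub x y y'
  have h2 := h.le_sub x y' y
  rw [← neg_sub y' y, inner_neg_right, norm_neg] at h2
  rw [inner_sub_left]
  linarith

/-- The quadratic lower bound at y = 0 makes g(x, ·) coercive, and F is finite-dimensional. -/
lemma LowerSmooth.exists_min (h : p.LowerSmooth Lg₁ Lg₂ μ) (hμ : 0 < μ) (x : E) :
    ∃ y, ∀ y', p.g (pt x y) ≤ p.g (pt x y') := by
  refine Continuous.exists_forall_le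
    (h.diff.continuous.comp (continuous_pt.comp (Continuous.prodMk_right x))) ?_
  set b := ‖grad₂ p.g x 0‖
  have hq : Filter.Tendsto (fun r : ℝ => p.g (pt x 0) + r * (μ / 2 * r - b))
      Filter.atTop Filter.atTop := by
    refine Filter.tendsto_atTop_add_const_left _ _
      (Filter.Tendsto.atTop_mul_atTop₀ Filter.tendsto_id ?_)
    exact Filter.tendsto_atTop_add_const_right _ (-b)
      (Filter.Tendsto.const_mul_atTop (half_pos hμ) Filter.tendsto_id)
  refine Filter.tendsto_atTop_mono (fun y => ?_) (hq.comp (tendsto_norm_cocompact_atTop (E := F)))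
  have h1 := h.le_sub x 0 y
  rw [sub_zero] at h1
  have h2 := neg_le_of_abs_le (abs_real_inner_le_norm (grad₂ p.g x 0) y)
  simp only [Function.comp]
  nlinarith

lemma LowerSmooth.yStar_min (h : p.LowerSmooth Lg₁ Lg₂ μ) (hμ : 0 < μ) (x : E) (y' : F) :
    p.g (pt x (p.yStar x)) ≤ p.g (pt x y') :=
  Classical.epsilon_spec (h.exists_min hμ x) y'

lemma LowerSmooth.grad₂_yStar (h : p.LowerSmooth Lg₁ Lg₂ μ) (hμ : 0 < μ) (x : E) :
    grad₂ p.g x (p.yStar x) = 0 := by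
  have hline : HasDerivAt (fun t : ℝ => pt x (p.yStar x)
      + t • pt (0 : E) (grad₂ p.g x (p.yStar x))) (pt 0 (grad₂ p.g x (p.yStar x))) 0 := by
    simpa using ((hasDerivAt_id (0 : ℝ)).smul_const
      (pt (0 : E) (grad₂ p.g x (p.yStar x)))).const_add (pt x (p.yStar x))
  have h1 := ((h.diff (pt x (p.yStar x) + (0 : ℝ) • pt 0 (grad₂ p.g x
    (p.yStar x)))).hasFDerivAt).comp_hasDerivAt 0 hline
  rw [fderiv_apply_eq_inner_gradient, inner_joint] at h1
  have hmin : IsLocalMin ((p.g) ∘ fun t : ℝ => pt x (p.yStar x)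
      + t • pt (0 : E) (grad₂ p.g x (p.yStar x))) 0 := by
    refine Filter.Eventually.of_forall fun t => ?_
    simp only [Function.comp, zero_smul, add_zero]
    rw [smul_pt, pt_add, smul_zero, add_zero]
    exact h.yStar_min hμ x _
  have h2 := hmin.hasDerivAt_eq_zero h1
  simp only [zero_smul, add_zero, pt_fst, inner_zero_right, zero_add, pt_snd] at h2
  exact inner_self_eq_zero.1 h2

/-- Strong monotonicity at x' bounds the distance between the two solutions by ‖∇₂g(x', y*(x))‖ / μ.
This gradient is small because it vanishes once x' is replaced by x. -/
lemma LowerSmooth.norm_yStar_sub_le (h : p.LowerSmooth Lg₁ Lg₂ μ) (hμ : 0 < μ) (x x' : E) :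
    ‖p.yStar x' - p.yStar x‖ ≤ Lg₁ / μ * ‖x' - x‖ := by
  have h1 := h.strong_mono x' (p.yStar x) (p.yStar x')
  have h2 := norm_grad₂_sub_le h.lipGrad x x' (p.yStar x) (p.yStar x)
  rw [h.grad₂_yStar hμ x'] at h1
  rw [h.grad₂_yStar hμ x, zero_sub, norm_neg, pt_sub, sub_self] at h2
  have h3 : ‖pt (x - x') (0 : F)‖ = ‖x' - x‖ := by
    have := norm_pt_sq (x - x') (0 : F)
    rw [norm_zero, zero_pow two_ne_zero, add_zero, norm_sub_rev] at this
    exact (sq_eq_sq₀ (norm_nonneg _) (norm_nonneg _)).1 this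
  rw [h3] at h2
  rw [zero_sub, inner_neg_left] at h1
  have h4 := neg_le_of_abs_le (abs_real_inner_le_norm (grad₂ p.g x' (p.yStar x))
    (p.yStar x' - p.yStar x))
  have h5 : μ * ‖p.yStar x' - p.yStar x‖ ^ 2 ≤ Lg₁ * ‖x' - x‖ * ‖p.yStar x' - p.yStar x‖ := by
    nlinarith [norm_nonneg (p.yStar x' - p.yStar x)]
  rw [div_mul_eq_mul_div, le_div_iff₀ hμ]
  rcases (norm_nonneg (p.yStar x' - p.yStar x)).eq_or_lt with h6 | h6
  · rw [← h6, zero_mul]; exact (norm_nonneg _).trans h2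
  · nlinarith

/-- The infinitesimal form of strong monotonicity: compare y with y + t w, divide by t² and let t
decrease to 0. -/
lemma LowerSmooth.coercive (h : p.LowerSmooth Lg₁ Lg₂ μ) (x : E) (y w : F) :
    μ * ‖w‖ ^ 2 ≤ ⟪hess₂₂ p.g x y w, w⟫ := by
  have hline : HasDerivAt (fun t : ℝ => pt x y + t • pt (0 : E) w) (pt 0 w) 0 := by
    simpa using ((hasDerivAt_id (0 : ℝ)).smul_const (pt (0 : E) w)).const_add (pt x y)
  have h1 := ((h.diffGrad (pt x y + (0 : ℝ) • pt 0 w)).hasFDerivAt).comp_hasDerivAt 0 hline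
  have h2 := (h1.inner ℝ (hasDerivAt_const (0 : ℝ) (pt (0 : E) w))).hasDerivWithinAt
    (s := Set.Ioi 0)
  rw [hasDerivWithinAt_iff_tendsto_slope' (by simp)] at h2
  simp only [inner_zero_right, zero_add, zero_smul, add_zero] at h2
  have e : ⟪fderiv ℝ (∇ p.g) (pt x y) (pt 0 w), pt (0 : E) w⟫ = ⟪hess₂₂ p.g x y w, w⟫ := by
    rw [inner_joint]; simp [hess₂₂, hess]
  rw [e] at h2
  refine ge_of_tendsto h2 ?_
  filter_upwards [self_mem_nhdsWithin] with t (ht : 0 < t)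
  rw [slope_def_field, sub_zero, le_div_iff₀ ht]
  simp only [Function.comp, zero_smul, add_zero]
  rw [← inner_sub_left, inner_joint, pt_fst, inner_zero_right, zero_add, pt_snd, smul_pt, pt_add,
    smul_zero, add_zero]
  have h3 := h.strong_mono x y (y + t • w)
  rw [add_sub_cancel_left, inner_smul_right, norm_smul, Real.norm_of_nonneg ht.le] at h3
  have h4 : t * (μ * ‖w‖ ^ 2 * t) ≤ t * ⟪grad₂ p.g x (y + t • w) - grad₂ p.g x y, w⟫ := by
    linarith [h3]
  exact le_of_mul_le_mul_left h4 ht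

lemma LowerSmooth.le_norm_hess₂₂ (h : p.LowerSmooth Lg₁ Lg₂ μ) (x : E) (y w : F) :
    μ * ‖w‖ ≤ ‖hess₂₂ p.g x y w‖ := by
  have h1 := (h.coercive x y w).trans (real_inner_le_norm _ _)
  rcases (norm_nonneg w).eq_or_lt with h6 | h6
  · rw [← h6, mul_zero]; exact norm_nonneg _
  · nlinarith

lemma hess₂₂_sub (φ : Joint E F → ℝ) (x : E) (y z z' : F) :
    hess₂₂ φ x y (z - z') = hess₂₂ φ x y z - hess₂₂ φ x y z' := by
  simp [hess₂₂, pt_zero_sub]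

lemma LowerSmooth.exists_zStar (h : p.LowerSmooth Lg₁ Lg₂ μ) (hμ : 0 < μ) (x : E) (y q : F) :
    ∃ z, hess₂₂ p.g x y z = q := by
  let B : F →ₗ[ℝ] F :=
    { toFun := fun z => hess₂₂ p.g x y z
      map_add' := fun a b => by
        have : pt (0 : E) (a + b) = pt 0 a + pt 0 b := by rw [pt_add, add_zero]
        simp [hess₂₂, this]
      map_smul' := fun c a => by
        have : pt (0 : E) (c • a) = c • pt 0 a := by rw [smul_pt, smul_zero]
        simp [hess₂₂, this] }
  have hB : Function.Injective B := by
    refine (injective_iff_map_eq_zero B).2 fun z hz => ?_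
    have := h.le_norm_hess₂₂ x y z
    have hz' : hess₂₂ p.g x y z = 0 := hz
    rw [hz', norm_zero] at this
    exact norm_le_zero_iff.1 (by nlinarith [norm_nonneg z])
  exact LinearMap.injective_iff_surjective.1 hB q

/-- The solution `z` of `∇²₂₂g(x, y*(x)) z = ∇₂f(x, y*(x))`. -/
def zStar (p : StochasticBilevel E F Ξ Z) (x : E) : F :=
  Classical.epsilon fun z => hess₂₂ p.g x (p.yStar x) z = grad₂ p.f x (p.yStar x)

lemma LowerSmooth.hess₂₂_zStar (h : p.LowerSmooth Lg₁ Lg₂ μ) (hμ : 0 < μ) (x : E) :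
    hess₂₂ p.g x (p.yStar x) (p.zStar x) = grad₂ p.f x (p.yStar x) :=
  Classical.epsilon_spec (h.exists_zStar hμ x _ _)

lemma LowerSmooth.norm_zStar_le (h : p.LowerSmooth Lg₁ Lg₂ μ) (hf : p.UpperSmooth Lf Cf)
    (hμ : 0 < μ) (x : E) : ‖p.zStar x‖ ≤ Cf / μ := by
  have h1 := h.le_norm_hess₂₂ x (p.yStar x) (p.zStar x)
  rw [h.hess₂₂_zStar hμ] at h1
  rw [le_div_iff₀ hμ, mul_comm]
  exact h1.trans (hf.bddGrad₂ x)

lemma LowerSmooth.norm_pt_yStar_sub_le (h : p.LowerSmooth Lg₁ Lg₂ μ) (hμ : 0 < μ) (x x' : E) :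
    ‖pt x' (p.yStar x') - pt x (p.yStar x)‖ ≤ (1 + Lg₁ / μ) * ‖x' - x‖ := by
  rw [pt_sub]
  refine (norm_pt_le _ _).trans ?_
  linarith [h.norm_yStar_sub_le hμ x x']

lemma LowerSmooth.dirZ_star (h : p.LowerSmooth Lg₁ Lg₂ μ) (hμ : 0 < μ) (x : E) :
    dirZ p.f p.g x (p.yStar x) (p.zStar x) = 0 := by
  rw [dirZ, h.hess₂₂_zStar hμ, sub_self]

/-- Coercivity at x' reduces the claim to the residual of z*(x) in the linear system at x'. The
residual of the same vector vanishes at x, so `norm_dirZ_sub_le` with z = z' applies, and ‖z*(x)‖ ≤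
Cf / μ. -/
lemma LowerSmooth.norm_zStar_sub_le (h : p.LowerSmooth Lg₁ Lg₂ μ) (hf : p.UpperSmooth Lf Cf)
    (hLf : 0 ≤ Lf) (hLg₁ : 0 ≤ Lg₁) (hLg₂ : 0 ≤ Lg₂) (hμ : 0 < μ) (x x' : E) :
    ‖p.zStar x' - p.zStar x‖
      ≤ (Lf + Lg₂ * (Cf / μ)) * (1 + Lg₁ / μ) / μ * ‖x' - x‖ := by
  have h1 := h.le_norm_hess₂₂ x' (p.yStar x') (p.zStar x' - p.zStar x)
  have e : hess₂₂ p.g x' (p.yStar x') (p.zStar x' - p.zStar x)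
      = -(dirZ p.f p.g x' (p.yStar x') (p.zStar x)
        - dirZ p.f p.g x (p.yStar x) (p.zStar x)) := by
    rw [h.dirZ_star hμ, hess₂₂_sub, h.hess₂₂_zStar hμ, dirZ]; abel
  have h2 := norm_dirZ_sub_le hLg₁ hf.lipGrad h.lipGrad h.lipHess x' x (p.yStar x') (p.yStar x)
    (p.zStar x) (p.zStar x)
  rw [sub_self, norm_zero, mul_zero, add_zero] at h2
  rw [e, norm_neg] at h1
  have h3 := h.norm_zStar_le hf hμ x
  have h4 := h.norm_pt_yStar_sub_le hμ x x'
  rw [div_mul_eq_mul_div, le_div_iff₀ hμ, mul_comm _ μ]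
  refine (h1.trans h2).trans ?_
  rw [mul_assoc]
  refine mul_le_mul ?_ h4 (norm_nonneg _) ?_
  · nlinarith
  · have := (norm_nonneg _).trans h3
    positivity

lemma norm_snd_pt_grad {φ : Joint E F → ℝ} (x : E) (y : F) :
    (∇ φ (pt x y)).snd = grad₂ φ x y := rfl

/-- A first-order expansion of `H` with quadratic remainder, the gradient being
`∇₁f - ∇²₁₂g z*`. -/
lemma abs_H_sub_le (h : p.LowerSmooth Lg₁ Lg₂ μ) (hf : p.UpperSmooth Lf Cf)
    (hLf : 0 ≤ Lf) (hLg₂ : 0 ≤ Lg₂) (hμ : 0 < μ) (x x' : E) :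
    |p.H x' - p.H x - ⟪dirX p.f p.g x (p.yStar x) (p.zStar x), x' - x⟫|
      ≤ (Lf + Lg₂ * (Cf / μ)) * (1 + Lg₁ / μ) ^ 2 * ‖x' - x‖ ^ 2 := by
  set u := pt x (p.yStar x) with hu
  set u' := pt x' (p.yStar x') with hu'
  set z := p.zStar x with hz
  have h1 := abs_taylor_one_le hf.diff hf.lipGrad u u'
  have h2 := norm_taylor_one_le h.diffGrad hLg₂ h.lipHess u u'
  have h3 := abs_real_inner_le_norm (pt (0 : E) z)
    (∇ p.g u' - ∇ p.g u - fderiv ℝ (∇ p.g) u (u' - u))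
  rw [norm_pt_zero] at h3
  -- Lower-level optimality at both points kills this pairing, so the linear term of the expansion
  -- of ∇g is itself of second order after pairing with (0, z*).
  have e1 : ⟪pt (0 : E) z, ∇ p.g u' - ∇ p.g u⟫ = 0 := by
    rw [inner_joint, pt_fst, inner_zero_left, zero_add, WithLp.sub_snd, hu, hu',
      norm_snd_pt_grad, norm_snd_pt_grad, h.grad₂_yStar hμ, h.grad₂_yStar hμ, sub_zero,
      inner_zero_right]
  have e2 : ⟪pt (0 : E) z, fderiv ℝ (∇ p.g) u (u' - u)⟫ = ⟪hess p.g u (pt 0 z), u' - u⟫ := by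
    rw [real_inner_comm, inner_fderiv_gradient_symm h.diff (h.diffGrad u)]; rfl
  rw [inner_sub_right, e1, e2, zero_sub, abs_neg] at h3
  have e3 : ⟪dirX p.f p.g x (p.yStar x) z, x' - x⟫
      = ⟪∇ p.f u, u' - u⟫ - ⟪hess p.g u (pt 0 z), u' - u⟫ := by
    rw [← inner_sub_left, inner_joint]
    -- This is the equation defining z*; it removes the displacement of y* from the first-order
    -- term.
    have e4 : (∇ p.f u - hess p.g u (pt 0 z)).snd = 0 := by
      have := h.hess₂₂_zStar hμ x
      simp only [WithLp.sub_snd]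
      exact sub_eq_zero.2 this.symm
    rw [e4, inner_zero_left, add_zero]
    rfl
  have e5 : p.H x' - p.H x - ⟪dirX p.f p.g x (p.yStar x) z, x' - x⟫
      = (p.f u' - p.f u - ⟪∇ p.f u, u' - u⟫) + ⟪hess p.g u (pt 0 z), u' - u⟫ := by
    rw [e3]; simp only [H]; rw [← hu, ← hu']; ring
  have h4 := h.norm_pt_yStar_sub_le hμ x x'
  have h5 := h.norm_zStar_le hf hμ x
  have h6 : ‖u' - u‖ ^ 2 ≤ (1 + Lg₁ / μ) ^ 2 * ‖x' - x‖ ^ 2 := by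
    rw [← mul_pow]; exact pow_le_pow_left₀ (norm_nonneg _) h4 2
  have h7 : ‖z‖ * ‖∇ p.g u' - ∇ p.g u - fderiv ℝ (∇ p.g) u (u' - u)‖
      ≤ Cf / μ * (Lg₂ * ‖u' - u‖ ^ 2) :=
    mul_le_mul h5 h2 (norm_nonneg _) ((norm_nonneg _).trans h5)
  have h8 : 0 ≤ Lf + Lg₂ * (Cf / μ) := by
    have := (norm_nonneg _).trans h5
    positivity
  rw [e5]
  calc _ ≤ |p.f u' - p.f u - ⟪∇ p.f u, u' - u⟫| + |⟪hess p.g u (pt 0 z), u' - u⟫| := abs_add_le _ _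
    _ ≤ (Lf + Lg₂ * (Cf / μ)) * ‖u' - u‖ ^ 2 := by linarith
    _ ≤ _ := by rw [mul_assoc]; exact mul_le_mul_of_nonneg_left h6 h8

lemma hasGradientAt_H (h : p.LowerSmooth Lg₁ Lg₂ μ) (hf : p.UpperSmooth Lf Cf)
    (hLf : 0 ≤ Lf) (hLg₂ : 0 ≤ Lg₂) (hμ : 0 < μ) (x : E) :
    HasGradientAt p.H (dirX p.f p.g x (p.yStar x) (p.zStar x)) x :=
  hasGradientAt_of_quadratic (abs_H_sub_le h hf hLf hLg₂ hμ x)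

end StochasticBilevel

/-! ### Second moments as Lebesgue integrals. -/

section SecondMoment

variable {S : Type*} [MeasurableSpace S] {ν : Measure S} {V : Type*} [NormedAddCommGroup V]

lemma memLp_two_of_lintegral_sq_lt_top {X : S → V} (hX : AEStronglyMeasurable X ν)
    (h : ∫⁻ s, ‖X s‖ₑ ^ 2 ∂ν < ⊤) : MemLp X 2 ν := by
  refine ⟨hX, ?_⟩
  rw [eLpNorm_lt_top_iff_lintegral_rpow_enorm_lt_top two_ne_zero ENNReal.ofNat_ne_top]
  simpa using h

lemma integral_norm_sq_le_of_lintegral {X : S → V} (hX : AEStronglyMeasurable X ν) {c : ℝ}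
    (hc : 0 ≤ c) (h : ∫⁻ s, ‖X s‖ₑ ^ 2 ∂ν ≤ ENNReal.ofReal c) : ∫ s, ‖X s‖ ^ 2 ∂ν ≤ c := by
  rw [integral_eq_lintegral_of_nonneg_ae (f := fun s => ‖X s‖ ^ 2)
    (Filter.Eventually.of_forall fun _ => by positivity) (hX.norm.pow 2)]
  refine ENNReal.toReal_le_of_le_ofReal hc (le_trans (le_of_eq ?_) h)
  refine lintegral_congr fun s => ?_
  rw [ENNReal.ofReal_pow (norm_nonneg _), ofReal_norm]

lemma lintegral_enorm_le_of_sq [IsProbabilityMeasure ν] {X : S → V}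
    (hX : AEStronglyMeasurable X ν) {c : ℝ} (hc : 0 ≤ c)
    (h : ∫⁻ s, ‖X s‖ₑ ^ 2 ∂ν ≤ ENNReal.ofReal (c ^ 2)) :
    ∫⁻ s, ‖X s‖ₑ ∂ν ≤ ENNReal.ofReal c := by
  have h1 : eLpNorm X 1 ν ≤ eLpNorm X 2 ν :=
    eLpNorm_le_eLpNorm_of_exponent_le (by norm_num) hX
  rw [eLpNorm_one_eq_lintegral_enorm] at h1
  refine h1.trans ?_
  rw [eLpNorm_eq_lintegral_rpow_enorm_toReal two_ne_zero ENNReal.ofNat_ne_top]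
  simp only [ENNReal.toReal_ofNat, ENNReal.rpow_ofNat, one_div]
  rw [ENNReal.rpow_inv_le_iff two_pos, ENNReal.rpow_ofNat, ← ENNReal.ofReal_pow hc]
  exact h

end SecondMoment

/-! ### Joint measurability of gradients in the point and the sample. -/

section Measurability

variable {S : Type*} [MeasurableSpace S] {V : Type*} [NormedAddCommGroup V]
  [InnerProductSpace ℝ V] [FiniteDimensional ℝ V] [MeasurableSpace V] [BorelSpace V]

/-- A sequence of difference quotients lets measurability pass to derivatives and, through Fatou,
second-moment bounds as well. -/
lemma tendsto_diffQuot {V W : Type*} [NormedAddCommGroup V] [NormedSpace ℝ V]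
    [NormedAddCommGroup W] [NormedSpace ℝ W] {φ : V → W} (hφ : Differentiable ℝ φ) (u w : V) :
    Filter.Tendsto (fun n : ℕ => ((n : ℝ) + 1) • (φ (u + ((n : ℝ) + 1)⁻¹ • w) - φ u))
      Filter.atTop (nhds (fderiv ℝ φ u w)) := by
  refine ((hφ u).hasFDerivAt.lim_real w).comp (g := fun c : ℝ => c • (φ (u + c⁻¹ • w) - φ u)) ?_
  exact Filter.tendsto_atTop_add_const_right _ _ tendsto_natCast_atTop_atTop

/-- Derivatives of a jointly measurable map in a Banach-space variable are jointly measurable. -/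
lemma measurable_fderiv_apply_param {W : Type*} [NormedAddCommGroup W] [NormedSpace ℝ W]
    [MeasurableSpace W] [BorelSpace W] [SecondCountableTopology W] {Ψ : V → S → W}
    (hm : Measurable fun q : V × S => Ψ q.1 q.2)
    (hd : ∀ s, Differentiable ℝ fun u => Ψ u s) :
    Measurable fun q : V × V × S => fderiv ℝ (fun u => Ψ u q.2.2) q.1 q.2.1 := by
  refine measurable_of_tendsto_metrizable
    (f := fun (n : ℕ) (q : V × V × S) => ((n : ℝ) + 1) •
      (Ψ (q.1 + ((n : ℝ) + 1)⁻¹ • q.2.1) q.2.2 - Ψ q.1 q.2.2)) (fun n => ?_)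
    (tendsto_pi_nhds.2 fun q => tendsto_diffQuot (hd q.2.2) q.1 q.2.1)
  refine Measurable.const_smul (Measurable.sub ?_ ?_) _
  · exact hm.comp (Measurable.prodMk (measurable_fst.add
      (measurable_snd.fst.const_smul _)) measurable_snd.snd)
  · exact hm.comp (Measurable.prodMk measurable_fst measurable_snd.snd)

lemma measurable_of_measurable_inner {A : Type*} [MeasurableSpace A] {X : A → V}
    (h : ∀ w, Measurable fun a => inner ℝ (X a) w) : Measurable X := by
  have e : X = fun a => ∑ i, inner ℝ (X a) (stdOrthonormalBasis ℝ V i)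
      • stdOrthonormalBasis ℝ V i := by
    funext a
    conv_lhs => rw [← (stdOrthonormalBasis ℝ V).sum_repr' (X a)]
    exact Finset.sum_congr rfl fun i _ => by rw [real_inner_comm]
  rw [e]
  exact Finset.measurable_sum _ fun i _ => (h _).smul_const _

/-- Measurability is given only for each fixed u; continuity in u upgrades it to joint
measurability, and components of the gradient are limits of difference quotients. -/
lemma measurable_gradient_param {Φ : V → S → ℝ} (hm : ∀ u, Measurable (Φ u))
    (hd : ∀ s, Differentiable ℝ fun u => Φ u s) :
    Measurable fun q : V × S => ∇ (fun u => Φ u q.2) q.1 := by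
  have hj : Measurable fun q : V × S => Φ q.1 q.2 :=
    measurable_uncurry_of_continuous_of_measurable (fun s => (hd s).continuous) hm
  refine measurable_of_measurable_inner fun w => ?_
  have := (measurable_fderiv_apply_param hj hd).comp
    (f := fun q : V × S => (q.1, w, q.2)) (by fun_prop)
  simpa only [Function.comp_def, fderiv_apply_eq_inner_gradient] using this

end Measurability

/-! ### Differentiation under the expectation. -/

section Interchange

variable {S : Type*} [MeasurableSpace S] {ν : Measure S} [IsProbabilityMeasure ν]

/-- Differentiability of the expectation is a hypothesis, so only the value of its derivative must
be found. Integrating ψ' t - ψ' 0 in t for each sample, then over the samples by Tonelli, gives a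
remainder of at most K T² at T > 0. One-sided slopes therefore converge to the expectation of ψ' 0.
-/
lemma deriv_integral_eq {ψ ψ' : ℝ → S → ℝ} (hψ : ∀ t, Integrable (ψ t) ν)
    (hψ' : Measurable fun q : ℝ × S => ψ' q.1 q.2) (hint : Integrable (ψ' 0) ν)
    (hd : ∀ s t, HasDerivAt (fun t => ψ t s) (ψ' t s) t) {K : ℝ} (hK : 0 ≤ K)
    (hlip : ∀ t, 0 ≤ t → ∫⁻ s, ‖ψ' t s - ψ' 0 s‖ₑ ∂ν ≤ ENNReal.ofReal (K * t)) {d : ℝ}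
    (hφ : HasDerivAt (fun t => ∫ s, ψ t s ∂ν) d 0) : ∫ s, ψ' 0 s ∂ν = d := by
  have key : ∀ T : ℝ, 0 < T →
      |(∫ s, ψ T s ∂ν) - (∫ s, ψ 0 s ∂ν) - T * ∫ s, ψ' 0 s ∂ν| ≤ K * T * T := by
    intro T hT
    have hpt : ∀ s, ‖ψ T s - ψ 0 s - T * ψ' 0 s‖ₑ
        ≤ ∫⁻ t in Set.Ioc 0 T, ‖ψ' t s - ψ' 0 s‖ₑ := by
      intro s
      -- ψ' need not be continuous in t, so the fundamental theorem of calculus requires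
      -- integrability; where that fails the bound is infinite.
      by_cases hfin : ∫⁻ t in Set.Ioc 0 T, ‖ψ' t s - ψ' 0 s‖ₑ < ⊤
      · have hms : Measurable fun t => ψ' t s - ψ' 0 s :=
          (hψ'.comp (measurable_id.prodMk measurable_const)).sub measurable_const
        have hI : IntervalIntegrable (fun t => ψ' t s - ψ' 0 s) volume 0 T := by
          rw [intervalIntegrable_iff_integrableOn_Ioc_of_le hT.le]
          exact ⟨hms.aestronglyMeasurable, hfin⟩
        have h1 := intervalIntegral.integral_eq_sub_of_hasDerivAt
          (f := fun t => ψ t s - t * ψ' 0 s) (fun t _ => (hd s t).sub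
            (by simpa using (hasDerivAt_id t).mul_const (ψ' 0 s))) hI
        have e : ψ T s - ψ 0 s - T * ψ' 0 s = ∫ t in Set.Ioc 0 T, (ψ' t s - ψ' 0 s) := by
          rw [← intervalIntegral.integral_of_le hT.le, h1]; ring
        rw [e]
        exact enorm_integral_le_lintegral_enorm _
      · rw [not_lt_top_iff.1 hfin]; exact le_top
    have hm2 : Measurable fun q : S × ℝ => ‖ψ' q.2 q.1 - ψ' 0 q.1‖ₑ := by
      have h1 : Measurable fun q : S × ℝ => ψ' q.2 q.1 := hψ'.comp measurable_swap
      have h2 : Measurable fun q : S × ℝ => ψ' 0 q.1 :=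
        hψ'.comp (measurable_const.prodMk measurable_fst)
      exact (h1.sub h2).enorm
    have hI : Integrable (fun s => ψ T s - ψ 0 s - T * ψ' 0 s) ν :=
      ((hψ T).sub (hψ 0)).sub (hint.const_mul T)
    have e : (∫ s, ψ T s ∂ν) - (∫ s, ψ 0 s ∂ν) - T * ∫ s, ψ' 0 s ∂ν
        = ∫ s, (ψ T s - ψ 0 s - T * ψ' 0 s) ∂ν := by
      rw [integral_sub (f := fun s => ψ T s - ψ 0 s) ((hψ T).sub (hψ 0)) (hint.const_mul T),
        integral_sub (hψ T) (hψ 0), integral_const_mul]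
    rw [e, ← Real.norm_eq_abs, ← toReal_enorm]
    refine ENNReal.toReal_le_of_le_ofReal (by positivity) ?_
    calc ‖∫ s, (ψ T s - ψ 0 s - T * ψ' 0 s) ∂ν‖ₑ
        ≤ ∫⁻ s, ‖ψ T s - ψ 0 s - T * ψ' 0 s‖ₑ ∂ν := enorm_integral_le_lintegral_enorm _
      _ ≤ ∫⁻ s, (∫⁻ t in Set.Ioc 0 T, ‖ψ' t s - ψ' 0 s‖ₑ) ∂ν := lintegral_mono hpt
      _ = ∫⁻ t in Set.Ioc 0 T, ∫⁻ s, ‖ψ' t s - ψ' 0 s‖ₑ ∂ν :=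
          lintegral_lintegral_swap hm2.aemeasurable
      _ ≤ ∫⁻ _ in Set.Ioc 0 T, ENNReal.ofReal (K * T) := by
          refine setLIntegral_mono measurable_const fun t ht => (hlip t ht.1.le).trans ?_
          exact ENNReal.ofReal_le_ofReal (mul_le_mul_of_nonneg_left ht.2 hK)
      _ = ENNReal.ofReal (K * T * T) := by
          rw [setLIntegral_const, Real.volume_Ioc, sub_zero, ← ENNReal.ofReal_mul (by positivity)]
  have hpos := hφ.hasDerivWithinAt (s := Set.Ioi 0)
  rw [hasDerivWithinAt_iff_tendsto_slope' (by simp)] at hpos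
  refine tendsto_nhds_unique (f := slope (fun t => ∫ s, ψ t s ∂ν) 0)
    (l := nhdsWithin (0 : ℝ) (Set.Ioi 0)) ?_ hpos
  rw [tendsto_iff_norm_sub_tendsto_zero]
  refine squeeze_zero' (Filter.Eventually.of_forall fun _ => norm_nonneg _)
    (g := fun t => K * t) ?_ ?_
  · filter_upwards [self_mem_nhdsWithin] with t (ht : 0 < t)
    rw [slope_def_field, sub_zero, Real.norm_eq_abs]
    have h1 := key t ht
    have e : (((∫ s, ψ t s ∂ν) - ∫ s, ψ 0 s ∂ν) / t - ∫ s, ψ' 0 s ∂ν)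
        = ((∫ s, ψ t s ∂ν) - (∫ s, ψ 0 s ∂ν) - t * ∫ s, ψ' 0 s ∂ν) / t := by field_simp
    rw [e, abs_div, abs_of_pos ht, div_le_iff₀ ht]
    exact h1
  · have : Filter.Tendsto (fun t : ℝ => K * t) (nhds 0) (nhds (K * 0)) :=
      (continuous_const.mul continuous_id).tendsto 0
    rw [mul_zero] at this
    exact this.mono_left nhdsWithin_le_nhds

/-- Differentiation under the expectation, when the derivative is Lipschitz in mean square. -/
lemma integral_fderiv_apply_eq {V : Type*} [NormedAddCommGroup V]
    [InnerProductSpace ℝ V] [FiniteDimensional ℝ V] [MeasurableSpace V] [BorelSpace V]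
    {Φ : V → S → ℝ} (hm : ∀ u, Measurable (Φ u)) (hd : ∀ s, Differentiable ℝ fun u => Φ u s)
    (hi : ∀ u, Integrable (Φ u) ν) {u w : V}
    (hi' : Integrable (fun s => fderiv ℝ (fun v => Φ v s) u w) ν) {K : ℝ} (hK : 0 ≤ K)
    (hlip : ∀ v, ∫⁻ s, ‖fderiv ℝ (fun v => Φ v s) v w - fderiv ℝ (fun v => Φ v s) u w‖ₑ ^ 2 ∂ν
      ≤ ENNReal.ofReal ((K * ‖v - u‖) ^ 2))
    {φ' : V →L[ℝ] ℝ} (hφ : HasFDerivAt (fun v => ∫ s, Φ v s ∂ν) φ' u) :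
    ∫ s, fderiv ℝ (fun v => Φ v s) u w ∂ν = φ' w := by
  have hline : ∀ t : ℝ, HasDerivAt (fun t : ℝ => u + t • w) w t := fun t => by
    simpa using ((hasDerivAt_id t).smul_const w).const_add u
  have hj : Measurable fun q : V × S => Φ q.1 q.2 :=
    measurable_uncurry_of_continuous_of_measurable (fun s => (hd s).continuous) hm
  have hM := (measurable_fderiv_apply_param hj hd).comp
    (f := fun q : ℝ × S => (u + q.1 • w, w, q.2))
    (((measurable_fst.smul_const w).const_add u).prodMk (measurable_const.prodMk measurable_snd))
  have := deriv_integral_eq (ν := ν) (ψ := fun t s => Φ (u + t • w) s)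
    (ψ' := fun t s => fderiv ℝ (fun v => Φ v s) (u + t • w) w) (d := φ' w)
    (fun t => hi _) hM (by simpa using hi')
    (fun s t => ((hd s (u + t • w)).hasFDerivAt).comp_hasDerivAt (f := fun t : ℝ => u + t • w) t
      (hline t))
    (K := K * ‖w‖) (by positivity) (fun t ht => ?_)
    (by
      have h1 : HasFDerivAt (fun v => ∫ s, Φ v s ∂ν) φ' (u + (0 : ℝ) • w) := by simpa using hφ
      exact h1.comp_hasDerivAt (f := fun t : ℝ => u + t • w) 0 (hline 0))
  · simpa using this
  · refine lintegral_enorm_le_of_sq ?_ (by positivity) ?_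
    · exact ((hM.comp (measurable_const.prodMk measurable_id)).sub
        (hM.comp (measurable_const.prodMk measurable_id))).aestronglyMeasurable
    · simp only [zero_smul, add_zero]
      refine (hlip (u + t • w)).trans (le_of_eq ?_)
      rw [add_sub_cancel_left, norm_smul, Real.norm_of_nonneg ht]
      congr 2; ring

end Interchange

section SecondMomentBounds

variable {S : Type*} [MeasurableSpace S] {ν : Measure S} {V W : Type*} [NormedAddCommGroup V]
  [NormedAddCommGroup W]

lemma lintegral_sq_le_of_norm_le {X : S → V} {Y : S → W} {C c : ℝ} (_hC : 0 ≤ C)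
    (hXY : ∀ s, ‖Y s‖ ≤ C * ‖X s‖) (h : ∫⁻ s, ‖X s‖ₑ ^ 2 ∂ν ≤ ENNReal.ofReal c) :
    ∫⁻ s, ‖Y s‖ₑ ^ 2 ∂ν ≤ ENNReal.ofReal (C ^ 2 * c) := by
  calc ∫⁻ s, ‖Y s‖ₑ ^ 2 ∂ν ≤ ∫⁻ s, ENNReal.ofReal (C ^ 2) * ‖X s‖ₑ ^ 2 ∂ν := by
        refine lintegral_mono fun s => ?_
        rw [← ofReal_norm, ← ofReal_norm, ← ENNReal.ofReal_pow (norm_nonneg _),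
          ← ENNReal.ofReal_pow (norm_nonneg _), ← ENNReal.ofReal_mul (by positivity), ← mul_pow]
        exact ENNReal.ofReal_le_ofReal (pow_le_pow_left₀ (norm_nonneg _) (hXY s) 2)
    _ = ENNReal.ofReal (C ^ 2) * ∫⁻ s, ‖X s‖ₑ ^ 2 ∂ν :=
        lintegral_const_mul' _ _ ENNReal.ofReal_ne_top
    _ ≤ _ := by rw [ENNReal.ofReal_mul (by positivity)]; gcongr

lemma lintegral_add_sq_le [MeasurableSpace V] [OpensMeasurableSpace V] {X Y : S → V}
    (hX : Measurable X) {a b : ℝ} (ha : 0 ≤ a) (hb : 0 ≤ b)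
    (h₁ : ∫⁻ s, ‖X s‖ₑ ^ 2 ∂ν ≤ ENNReal.ofReal a) (h₂ : ∫⁻ s, ‖Y s‖ₑ ^ 2 ∂ν ≤ ENNReal.ofReal b) :
    ∫⁻ s, ‖X s + Y s‖ₑ ^ 2 ∂ν ≤ ENNReal.ofReal (2 * a + 2 * b) := by
  calc ∫⁻ s, ‖X s + Y s‖ₑ ^ 2 ∂ν ≤ ∫⁻ s, (2 * ‖X s‖ₑ ^ 2 + 2 * ‖Y s‖ₑ ^ 2) ∂ν := by
        refine lintegral_mono fun s => ?_
        have h : ‖X s + Y s‖ ^ 2 ≤ 2 * ‖X s‖ ^ 2 + 2 * ‖Y s‖ ^ 2 := by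
          have := norm_add_le (X s) (Y s)
          nlinarith [norm_nonneg (X s), norm_nonneg (Y s), norm_nonneg (X s + Y s),
            sq_nonneg (‖X s‖ - ‖Y s‖)]
        have h' := ENNReal.ofReal_le_ofReal h
        rw [ENNReal.ofReal_add (by positivity) (by positivity), ENNReal.ofReal_mul two_pos.le,
          ENNReal.ofReal_mul two_pos.le, ENNReal.ofReal_pow (norm_nonneg _),
          ENNReal.ofReal_pow (norm_nonneg _), ENNReal.ofReal_pow (norm_nonneg _)] at h'
        simpa [ofReal_norm] using h'
    _ = 2 * ∫⁻ s, ‖X s‖ₑ ^ 2 ∂ν + 2 * ∫⁻ s, ‖Y s‖ₑ ^ 2 ∂ν := by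
        rw [lintegral_add_left ((hX.enorm.pow_const 2).const_mul 2),
          lintegral_const_mul' _ _ ENNReal.ofNat_ne_top,
          lintegral_const_mul' _ _ ENNReal.ofNat_ne_top]
    _ ≤ _ := by
        rw [ENNReal.ofReal_add (by positivity) (by positivity), ENNReal.ofReal_mul two_pos.le,
          ENNReal.ofReal_mul two_pos.le, ENNReal.ofReal_ofNat]
        gcongr

end SecondMomentBounds

/-! ### The interchange for gradients and Hessian-vector products. -/

section VectorInterchange

variable {S : Type*} [MeasurableSpace S] {ν : Measure S} [IsProbabilityMeasure ν]
  {V : Type*} [NormedAddCommGroup V] [InnerProductSpace ℝ V] [FiniteDimensional ℝ V]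
  [MeasurableSpace V] [BorelSpace V]

lemma integral_eq_of_inner {X : S → V} (hX : Integrable X ν) {q : V}
    (h : ∀ a, ∫ s, inner ℝ a (X s) ∂ν = inner ℝ a q) : ∫ s, X s ∂ν = q :=
  ext_inner_left ℝ fun a => by rw [← integral_inner hX, h]

lemma integrable_of_sq_sub_le {X : S → V} (hX : Measurable X) {q : V} {c : ℝ}
    (h : ∫⁻ s, ‖X s - q‖ₑ ^ 2 ∂ν ≤ ENNReal.ofReal c) : Integrable X ν := by
  have h1 : MemLp (fun s => X s - q) 2 ν := memLp_two_of_lintegral_sq_lt_top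
    (hX.sub_const q).aestronglyMeasurable (h.trans_lt ENNReal.ofReal_lt_top)
  exact ((h1.integrable one_le_two).add (integrable_const q)).congr
    (Filter.Eventually.of_forall fun s => sub_add_cancel (X s) q)

lemma integral_gradient_eq {Φ : V → S → ℝ} (hm : ∀ u, Measurable (Φ u))
    (hd : ∀ s, Differentiable ℝ fun u => Φ u s) (hi : ∀ u, Integrable (Φ u) ν)
    (hφ : Differentiable ℝ fun u => ∫ s, Φ u s ∂ν) {L : ℝ} (hL : 0 ≤ L)
    (hlip : ∀ u v, ∫⁻ s, ‖∇ (fun w => Φ w s) u - ∇ (fun w => Φ w s) v‖ₑ ^ 2 ∂ν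
      ≤ ENNReal.ofReal ((L * ‖u - v‖) ^ 2)) (u : V)
    (hint : Integrable (fun s => ∇ (fun w => Φ w s) u) ν) :
    ∫ s, ∇ (fun w => Φ w s) u ∂ν = ∇ (fun u => ∫ s, Φ u s ∂ν) u := by
  refine integral_eq_of_inner hint fun a => ?_
  have e : ∀ s v, fderiv ℝ (fun w => Φ w s) v a = inner ℝ a (∇ (fun w => Φ w s) v) := fun s v => by
    rw [fderiv_apply_eq_inner_gradient, real_inner_comm]
  have := integral_fderiv_apply_eq hm hd hi (u := u) (w := a) (K := ‖a‖ * L)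
    (by simp_rw [e]; exact hint.const_inner a) (by positivity) (fun v => ?_) (hφ u).hasFDerivAt
  · simp_rw [e] at this
    rw [this, fderiv_apply_eq_inner_gradient, real_inner_comm]
  · simp_rw [e, ← inner_sub_right]
    refine (lintegral_sq_le_of_norm_le (norm_nonneg a) (fun s => norm_inner_le_norm _ _)
      (hlip v u)).trans (le_of_eq ?_)
    congr 1; ring

/-- The scalar interchange is applied to the inner products of Ψ with fixed vectors a. With Ψ = ∇G
it gives unbiasedness of Hessian-vector products. -/
lemma integral_fderiv_vector_eq {Ψ : V → S → V} (hm : Measurable fun q : V × S => Ψ q.1 q.2)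
    (hd : ∀ s, Differentiable ℝ fun u => Ψ u s) (hi : ∀ u, Integrable (Ψ u) ν)
    (hφ : Differentiable ℝ fun u => ∫ s, Ψ u s ∂ν) {L : ℝ} (hL : 0 ≤ L)
    (hlip : ∀ u v, ∫⁻ s, ‖fderiv ℝ (fun w => Ψ w s) u - fderiv ℝ (fun w => Ψ w s) v‖ₑ ^ 2 ∂ν
      ≤ ENNReal.ofReal ((L * ‖u - v‖) ^ 2)) (u b : V)
    (hint : Integrable (fun s => fderiv ℝ (fun w => Ψ w s) u b) ν) :
    ∫ s, fderiv ℝ (fun w => Ψ w s) u b ∂ν = fderiv ℝ (fun u => ∫ s, Ψ u s ∂ν) u b := by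
  refine integral_eq_of_inner hint fun a => ?_
  have hdi : ∀ s, Differentiable ℝ fun v => inner ℝ a (Ψ v s) := fun s =>
    (differentiable_const a).inner ℝ (hd s)
  have e : ∀ s v, fderiv ℝ (fun w => inner ℝ a (Ψ w s)) v b
      = inner ℝ a (fderiv ℝ (fun w => Ψ w s) v b) := fun s v => by
    rw [fderiv_inner_apply ℝ (differentiableAt_const a) (hd s v)]; simp
  have h1 : HasFDerivAt (fun v => ∫ s, inner ℝ a (Ψ v s) ∂ν)
      ((innerSL ℝ a) ∘L fderiv ℝ (fun u => ∫ s, Ψ u s ∂ν) u) u := by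
    have e1 : (fun v => ∫ s, inner ℝ a (Ψ v s) ∂ν) = fun v => innerSL ℝ a (∫ s, Ψ v s ∂ν) := by
      funext v; rw [integral_inner (hi v)]; rfl
    rw [e1]
    exact (innerSL ℝ a).hasFDerivAt.comp u (hφ u).hasFDerivAt
  have := integral_fderiv_apply_eq (Φ := fun v s => inner ℝ a (Ψ v s))
    (fun v => (hm.comp measurable_prodMk_left).const_inner) hdi
    (fun v => (hi v).const_inner a) (u := u) (w := b) (K := ‖a‖ * ‖b‖ * L)
    (by simp_rw [e]; exact hint.const_inner a) (by positivity) (fun v => ?_) h1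
  · simp_rw [e] at this
    rw [this]; rfl
  · simp_rw [e, ← inner_sub_right, ← sub_apply]
    refine (lintegral_sq_le_of_norm_le (C := ‖a‖ * ‖b‖) (by positivity) (fun s => ?_)
      (hlip v u)).trans (le_of_eq ?_)
    · refine (norm_inner_le_norm _ _).trans ?_
      rw [mul_assoc, mul_comm ‖b‖]
      exact mul_le_mul_of_nonneg_left (ContinuousLinearMap.le_opNorm _ _) (norm_nonneg _)
    · congr 1; ring

/-- A map that is Lipschitz in mean square has a derivative bounded in mean square. -/
lemma lintegral_fderiv_sq_le {Ψ : V → S → V} (hm : Measurable fun q : V × S => Ψ q.1 q.2)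
    (hd : ∀ s, Differentiable ℝ fun u => Ψ u s) {L : ℝ}
    (hlip : ∀ u v, ∫⁻ s, ‖Ψ u s - Ψ v s‖ₑ ^ 2 ∂ν ≤ ENNReal.ofReal ((L * ‖u - v‖) ^ 2)) (u b : V) :
    ∫⁻ s, ‖fderiv ℝ (fun w => Ψ w s) u b‖ₑ ^ 2 ∂ν ≤ ENNReal.ofReal ((L * ‖b‖) ^ 2) := by
  set q : ℕ → S → V := fun n s =>
    ((n : ℝ) + 1) • (Ψ (u + ((n : ℝ) + 1)⁻¹ • b) s - Ψ u s) with hq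
  have hms : ∀ v, Measurable (Ψ v) := fun v => hm.comp measurable_prodMk_left
  have hlim : ∀ s, Filter.liminf (fun n => ‖q n s‖ₑ ^ 2) Filter.atTop
      = ‖fderiv ℝ (fun w => Ψ w s) u b‖ₑ ^ 2 := fun s =>
    (((ENNReal.continuous_pow 2).tendsto _).comp (tendsto_diffQuot (hd s) u b).enorm).liminf_eq
  have hle : ∀ n, ∫⁻ s, ‖q n s‖ₑ ^ 2 ∂ν ≤ ENNReal.ofReal ((L * ‖b‖) ^ 2) := fun n => by
    have hn : (0 : ℝ) < (n : ℝ) + 1 := by positivity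
    refine (lintegral_sq_le_of_norm_le (C := (n : ℝ) + 1) hn.le (fun s => ?_)
      (hlip (u + ((n : ℝ) + 1)⁻¹ • b) u)).trans (le_of_eq ?_)
    · rw [hq, norm_smul, Real.norm_of_nonneg hn.le]
    · rw [add_sub_cancel_left, norm_smul, Real.norm_of_nonneg (inv_nonneg.2 hn.le)]
      congr 1; field_simp
  calc ∫⁻ s, ‖fderiv ℝ (fun w => Ψ w s) u b‖ₑ ^ 2 ∂ν
      = ∫⁻ s, Filter.liminf (fun n => ‖q n s‖ₑ ^ 2) Filter.atTop ∂ν :=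
        lintegral_congr fun s => (hlim s).symm
    _ ≤ Filter.liminf (fun n => ∫⁻ s, ‖q n s‖ₑ ^ 2 ∂ν) Filter.atTop :=
        lintegral_liminf_le fun n => ((((hms _).sub (hms _)).const_smul _).enorm).pow_const 2
    _ ≤ Filter.liminf (fun _ : ℕ => ENNReal.ofReal ((L * ‖b‖) ^ 2)) Filter.atTop :=
        Filter.liminf_le_liminf (Filter.Eventually.of_forall hle)
    _ = _ := Filter.liminf_const _

end VectorInterchange

/-! ### Integrability and unbiasedness of the stochastic oracles. -/

namespace StochasticBilevel

variable {E F : Type*} [NormedAddCommGroup E] [InnerProductSpace ℝ E] [FiniteDimensional ℝ E]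
  [NormedAddCommGroup F] [InnerProductSpace ℝ F] [FiniteDimensional ℝ F]
  [MeasurableSpace E] [BorelSpace E] [MeasurableSpace F] [BorelSpace F]
  {Ξ Z : Type*} [MeasurableSpace Ξ] [MeasurableSpace Z]
  {p : StochasticBilevel E F Ξ Z} {Lf Lg₁ Lg₂ μ Cf σf σg₁ σg₂ : ℝ}

/-- `∇F(u; ξ)`. -/
def gradF (p : StochasticBilevel E F Ξ Z) (u : Joint E F) (ξ : Ξ) : Joint E F :=
  ∇ (fun w => p.upper w ξ) u

/-- `∇G(u; ζ)`. -/
def gradG (p : StochasticBilevel E F Ξ Z) (u : Joint E F) (ζ : Z) : Joint E F :=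
  ∇ (fun w => p.lower w ζ) u

/-- `∇²G(u; ζ)`. -/
def hessG (p : StochasticBilevel E F Ξ Z) (u : Joint E F) (ζ : Z) :
    Joint E F →L[ℝ] Joint E F :=
  hess (fun w => p.lower w ζ) u

lemma WellPosed.measurable_gradF (h : p.WellPosed) :
    Measurable fun q : Joint E F × Ξ => p.gradF q.1 q.2 :=
  measurable_gradient_param h.measF h.diffF

lemma WellPosed.measurable_gradG (h : p.WellPosed) :
    Measurable fun q : Joint E F × Z => p.gradG q.1 q.2 :=
  measurable_gradient_param h.measG h.diffG

lemma WellPosed.measurable_hessG (h : p.WellPosed) :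
    Measurable fun q : Joint E F × Joint E F × Z => p.hessG q.1 q.2.2 q.2.1 :=
  measurable_fderiv_apply_param (Ψ := p.gradG) h.measurable_gradG h.diffGradG

lemma lintegral_hessG_sub_apply_le (hB : p.BoundedVariance σf σg₁ σg₂) (u b : Joint E F) :
    ∫⁻ ζ, ‖p.hessG u ζ b - hess p.g u b‖ₑ ^ 2 ∂p.lawζ ≤ ENNReal.ofReal (‖b‖ ^ 2 * σg₂ ^ 2) :=
  lintegral_sq_le_of_norm_le (X := fun ζ => p.hessG u ζ - hess p.g u) (norm_nonneg b)
    (fun ζ => (ContinuousLinearMap.le_opNorm (p.hessG u ζ - hess p.g u) b).trans_eq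
      (mul_comm _ _)) (hB.hessG u)

lemma integrable_gradF (h : p.WellPosed) (hB : p.BoundedVariance σf σg₁ σg₂) (u : Joint E F) :
    Integrable (p.gradF u) p.lawξ :=
  have := h.probξ
  integrable_of_sq_sub_le (h.measurable_gradF.comp measurable_prodMk_left) (hB.gradF u)

lemma integrable_gradG (h : p.WellPosed) (hB : p.BoundedVariance σf σg₁ σg₂) (u : Joint E F) :
    Integrable (p.gradG u) p.lawζ :=
  have := h.probζ
  integrable_of_sq_sub_le (h.measurable_gradG.comp measurable_prodMk_left) (hB.gradG u)

lemma integrable_hessG (h : p.WellPosed) (hB : p.BoundedVariance σf σg₁ σg₂) (u b : Joint E F) :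
    Integrable (fun ζ => p.hessG u ζ b) p.lawζ :=
  have := h.probζ
  integrable_of_sq_sub_le (h.measurable_hessG.comp
    (measurable_const.prodMk (measurable_const.prodMk measurable_id)))
    (lintegral_hessG_sub_apply_le hB u b)

lemma integral_gradF (h : p.WellPosed) (hf : p.UpperSmooth Lf Cf)
    (hB : p.BoundedVariance σf σg₁ σg₂) (hM : p.MeanSquaredSmooth Lf Lg₁ Lg₂) (hLf : 0 ≤ Lf)
    (u : Joint E F) : ∫ ξ, p.gradF u ξ ∂p.lawξ = ∇ p.f u :=
  have := h.probξ
  integral_gradient_eq h.measF h.diffF h.intF hf.diff hLf hM.gradF u (integrable_gradF h hB u)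

lemma integral_gradG (h : p.WellPosed) (hg : p.LowerSmooth Lg₁ Lg₂ μ)
    (hB : p.BoundedVariance σf σg₁ σg₂) (hM : p.MeanSquaredSmooth Lf Lg₁ Lg₂) (hLg₁ : 0 ≤ Lg₁)
    (u : Joint E F) : ∫ ζ, p.gradG u ζ ∂p.lawζ = ∇ p.g u :=
  have := h.probζ
  integral_gradient_eq h.measG h.diffG h.intG hg.diff hLg₁ hM.gradG u (integrable_gradG h hB u)

lemma integral_hessG (h : p.WellPosed) (hg : p.LowerSmooth Lg₁ Lg₂ μ)
    (hB : p.BoundedVariance σf σg₁ σg₂) (hM : p.MeanSquaredSmooth Lf Lg₁ Lg₂) (hLg₁ : 0 ≤ Lg₁)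
    (hLg₂ : 0 ≤ Lg₂) (u b : Joint E F) : ∫ ζ, p.hessG u ζ b ∂p.lawζ = hess p.g u b := by
  have := h.probζ
  have e : (fun u => ∫ ζ, p.gradG u ζ ∂p.lawζ) = ∇ p.g :=
    funext fun u => integral_gradG h hg hB hM hLg₁ u
  have := integral_fderiv_vector_eq (Ψ := p.gradG) h.measurable_gradG h.diffGradG
    (integrable_gradG h hB) (by rw [e]; exact hg.diffGrad) hLg₂ hM.hessG u b
    (integrable_hessG h hB u b)
  rw [e] at this
  exact this

/-- This bounds the effect of a change in z on sampled Hessian-vector products. The variance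
assumption would also give a bound, but one involving σ_{g,2}, and the momentum constants would then
depend on the noise level. -/
lemma lintegral_hessG_apply_le (h : p.WellPosed) (hM : p.MeanSquaredSmooth Lf Lg₁ Lg₂)
    (u b : Joint E F) :
    ∫⁻ ζ, ‖p.hessG u ζ b‖ₑ ^ 2 ∂p.lawζ ≤ ENNReal.ofReal ((Lg₁ * ‖b‖) ^ 2) :=
  have := h.probζ
  lintegral_fderiv_sq_le (Ψ := p.gradG) h.measurable_gradG h.diffGradG hM.gradG u b

end StochasticBilevel

/-! ### Fresh samples: conditioning on the past through product laws. -/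

section Freezing

variable {Ω S A V : Type*} {m mΩ : MeasurableSpace Ω} [MeasurableSpace S] [MeasurableSpace A]
  {P : Measure Ω} [IsProbabilityMeasure P] {ν : Measure S}
  [NormedAddCommGroup V] [InnerProductSpace ℝ V] [FiniteDimensional ℝ V] [MeasurableSpace V]
  [BorelSpace V]

lemma map_prodMk_eq_prod (hm : m ≤ mΩ) {X : Ω → S} (hX : Measurable X) (hν : P.map X = ν)
    (hind : Indep m (MeasurableSpace.comap X inferInstance) P) {a : Ω → A} (ha : Measurable[m] a) :
    P.map (fun ω => (a ω, X ω)) = (P.map a).prod ν := by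
  have h : IndepFun a X P := by
    rw [IndepFun_iff_Indep]
    exact indep_of_indep_of_le_left hind ha.comap_le
  rw [(indepFun_iff_map_prod_eq_prod_map_map (ha.mono hm le_rfl).aemeasurable
    hX.aemeasurable).1 h, hν]

/-- A second-moment bound that holds for every frozen value of the past holds on average. -/
lemma memLp_and_integral_sq_le_of_indep (hm : m ≤ mΩ) {X : Ω → S} (hX : Measurable X)
    (hν : P.map X = ν) (hind : Indep m (MeasurableSpace.comap X inferInstance) P) {a : Ω → A}
    (ha : Measurable[m] a) {ψ : A → S → V} (hψ : Measurable fun q : A × S => ψ q.1 q.2)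
    {b : Ω → ℝ} (hb : Integrable b P) (hb0 : ∀ ω, 0 ≤ b ω)
    (h : ∀ ω, ∫⁻ s, ‖ψ (a ω) s‖ₑ ^ 2 ∂ν ≤ ENNReal.ofReal (b ω)) :
    MemLp (fun ω => ψ (a ω) (X ω)) 2 P ∧ ∫ ω, ‖ψ (a ω) (X ω)‖ ^ 2 ∂P ≤ ∫ ω, b ω ∂P := by
  have : IsProbabilityMeasure ν := hν ▸ Measure.isProbabilityMeasure_map hX.aemeasurable
  have ha' : Measurable a := ha.mono hm le_rfl
  have hax : Measurable fun ω => (a ω, X ω) := ha'.prodMk hX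
  have hm2 : Measurable fun q : A × S => ‖ψ q.1 q.2‖ₑ ^ 2 := hψ.enorm.pow_const 2
  have hmX : AEStronglyMeasurable (fun ω => ψ (a ω) (X ω)) P :=
    (hψ.comp hax).aestronglyMeasurable
  have key : ∫⁻ ω, ‖ψ (a ω) (X ω)‖ₑ ^ 2 ∂P ≤ ENNReal.ofReal (∫ ω, b ω ∂P) := by
    calc ∫⁻ ω, ‖ψ (a ω) (X ω)‖ₑ ^ 2 ∂P
        = ∫⁻ q, ‖ψ q.1 q.2‖ₑ ^ 2 ∂(P.map fun ω => (a ω, X ω)) :=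
          (lintegral_map hm2 hax).symm
      _ = ∫⁻ c, ∫⁻ s, ‖ψ c s‖ₑ ^ 2 ∂ν ∂(P.map a) := by
          rw [map_prodMk_eq_prod hm hX hν hind ha, lintegral_prod _ hm2.aemeasurable]
      _ = ∫⁻ ω, ∫⁻ s, ‖ψ (a ω) s‖ₑ ^ 2 ∂ν ∂P := lintegral_map hm2.lintegral_prod_right' ha'
      _ ≤ ∫⁻ ω, ENNReal.ofReal (b ω) ∂P := lintegral_mono h
      _ = _ := (ofReal_integral_eq_lintegral_ofReal hb (Filter.Eventually.of_forall hb0)).symm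
  exact ⟨memLp_two_of_lintegral_sq_lt_top hmX (key.trans_lt ENNReal.ofReal_lt_top),
    integral_norm_sq_le_of_lintegral hmX (integral_nonneg hb0) key⟩

lemma integrable_inner_of_memLp {X Y : Ω → V} (hX : MemLp X 2 P) (hY : MemLp Y 2 P) :
    Integrable (fun ω => inner ℝ (X ω) (Y ω)) P :=
  (hX.norm.integrable_mul hY.norm).mono' (hX.1.inner hY.1)
    (Filter.Eventually.of_forall fun _ => norm_inner_le_norm _ _)

/-- Centred fresh noise is orthogonal to the past. -/
lemma integral_inner_eq_zero_of_indep (hm : m ≤ mΩ) {X : Ω → S} (hX : Measurable X)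
    (hν : P.map X = ν) (hind : Indep m (MeasurableSpace.comap X inferInstance) P) {a : Ω → A}
    (ha : Measurable[m] a) {ψ : A → S → V} (hψ : Measurable fun q : A × S => ψ q.1 q.2)
    (hint : ∀ c, Integrable (ψ c) ν) (hzero : ∀ c, ∫ s, ψ c s ∂ν = 0) {w : Ω → V}
    (hw : Measurable[m] w) (hw2 : MemLp w 2 P) (hψ2 : MemLp (fun ω => ψ (a ω) (X ω)) 2 P) :
    ∫ ω, inner ℝ (w ω) (ψ (a ω) (X ω)) ∂P = 0 := by
  have : IsProbabilityMeasure ν := hν ▸ Measure.isProbabilityMeasure_map hX.aemeasurable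
  have haw : Measurable[m] fun ω => (a ω, w ω) := ha.prodMk hw
  have hax : Measurable fun ω => ((a ω, w ω), X ω) := (haw.mono hm le_rfl).prodMk hX
  have hm2 : Measurable fun q : (A × V) × S => inner ℝ q.1.2 (ψ q.1.1 q.2) :=
    measurable_fst.snd.inner (hψ.comp (measurable_fst.fst.prodMk measurable_snd))
  have hI : Integrable (fun ω => inner ℝ (w ω) (ψ (a ω) (X ω))) P := integrable_inner_of_memLp hw2 hψ2
  have hI' : Integrable (fun q : (A × V) × S => inner ℝ q.1.2 (ψ q.1.1 q.2))
      ((P.map fun ω => (a ω, w ω)).prod ν) := by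
    rw [← map_prodMk_eq_prod hm hX hν hind haw]
    exact (integrable_map_measure hm2.aestronglyMeasurable hax.aemeasurable).2 hI
  calc ∫ ω, inner ℝ (w ω) (ψ (a ω) (X ω)) ∂P
      = ∫ q, inner ℝ q.1.2 (ψ q.1.1 q.2) ∂(P.map fun ω => ((a ω, w ω), X ω)) :=
        (integral_map hax.aemeasurable hm2.aestronglyMeasurable).symm
    _ = ∫ c, ∫ s, inner ℝ c.2 (ψ c.1 s) ∂ν ∂(P.map fun ω => (a ω, w ω)) := by
        rw [map_prodMk_eq_prod hm hX hν hind haw, integral_prod _ hI']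
    _ = 0 := by
        have : ∀ c : A × V, ∫ s, inner ℝ c.2 (ψ c.1 s) ∂ν = 0 := fun c => by
          rw [integral_inner (hint c.1), hzero, inner_zero_right]
        simp [this]

lemma integral_norm_add_sq_of_orthogonal {X Y : Ω → V} (hX : MemLp X 2 P) (hY : MemLp Y 2 P)
    (h : ∫ ω, inner ℝ (X ω) (Y ω) ∂P = 0) :
    ∫ ω, ‖X ω + Y ω‖ ^ 2 ∂P = ∫ ω, ‖X ω‖ ^ 2 ∂P + ∫ ω, ‖Y ω‖ ^ 2 ∂P := by
  have h1 := hX.integrable_norm_pow two_ne_zero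
  have h2 := hY.integrable_norm_pow two_ne_zero
  have h3 := integrable_inner_of_memLp hX hY
  simp_rw [norm_add_sq_real]
  rw [integral_add (f := fun ω => ‖X ω‖ ^ 2 + 2 * inner ℝ (X ω) (Y ω)) (h1.add (h3.const_mul 2)) h2,
    integral_add h1 (h3.const_mul 2),
    integral_const_mul, h, mul_zero, add_zero]

lemma integral_norm_add_sq_le {X Y : Ω → V} (hX : MemLp X 2 P) (hY : MemLp Y 2 P) :
    ∫ ω, ‖X ω + Y ω‖ ^ 2 ∂P ≤ 2 * ∫ ω, ‖X ω‖ ^ 2 ∂P + 2 * ∫ ω, ‖Y ω‖ ^ 2 ∂P := by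
  have h1 := (hX.integrable_norm_pow two_ne_zero).const_mul 2
  have h2 := (hY.integrable_norm_pow two_ne_zero).const_mul 2
  rw [← integral_const_mul, ← integral_const_mul, ← integral_add h1 h2]
  exact integral_mono ((hX.add hY).integrable_norm_pow two_ne_zero) (h1.add h2)
    fun ω => norm_add_sq_le_two (X ω) (Y ω)

/-- The recursive-momentum variance recursion, in terms of the noise `N` and `N'` of the same
sample at the current and at the previous point. -/
lemma integral_momentum_error_le {w N N' : Ω → V} (hw : MemLp w 2 P) (hN : MemLp N 2 P)
    (hN' : MemLp N' 2 P) (h : ∫ ω, inner ℝ (w ω) (N ω) ∂P = 0)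
    (h' : ∫ ω, inner ℝ (w ω) (N' ω) ∂P = 0) {ρ : ℝ} (hρ0 : 0 ≤ ρ) (hρ1 : ρ ≤ 1) :
    ∫ ω, ‖(1 - ρ) • w ω + (N ω - (1 - ρ) • N' ω)‖ ^ 2 ∂P
      ≤ (1 - ρ) * ∫ ω, ‖w ω‖ ^ 2 ∂P + 2 * ρ ^ 2 * ∫ ω, ‖N ω‖ ^ 2 ∂P
        + 2 * ∫ ω, ‖N ω - N' ω‖ ^ 2 ∂P := by
  have hB : MemLp (fun ω => N ω - (1 - ρ) • N' ω) 2 P := hN.sub (hN'.const_smul _)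
  have horth : ∫ ω, inner ℝ ((1 - ρ) • w ω) (N ω - (1 - ρ) • N' ω) ∂P = 0 := by
    have e : ∀ ω, inner ℝ ((1 - ρ) • w ω) (N ω - (1 - ρ) • N' ω)
        = (1 - ρ) * inner ℝ (w ω) (N ω) - (1 - ρ) * (1 - ρ) * inner ℝ (w ω) (N' ω) := fun ω => by
      rw [real_inner_smul_left, inner_sub_right, real_inner_smul_right]; ring
    simp_rw [e]
    rw [integral_sub ((integrable_inner_of_memLp hw hN).const_mul _) ((integrable_inner_of_memLp hw hN').const_mul _),
      integral_const_mul, integral_const_mul, h, h']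
    ring
  have hadd := integral_norm_add_sq_of_orthogonal (X := fun ω => (1 - ρ) • w ω)
    (hw.const_smul (1 - ρ)) hB horth
  rw [hadd]
  have h1 : ∫ ω, ‖(1 - ρ) • w ω‖ ^ 2 ∂P ≤ (1 - ρ) * ∫ ω, ‖w ω‖ ^ 2 ∂P := by
    simp_rw [norm_smul, mul_pow]
    rw [integral_const_mul, Real.norm_of_nonneg (sub_nonneg.2 hρ1)]
    refine mul_le_mul_of_nonneg_right (by nlinarith) (integral_nonneg fun _ => by positivity)
  have h2 : ∫ ω, ‖N ω - (1 - ρ) • N' ω‖ ^ 2 ∂P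
      ≤ 2 * ρ ^ 2 * ∫ ω, ‖N ω‖ ^ 2 ∂P + 2 * ∫ ω, ‖N ω - N' ω‖ ^ 2 ∂P := by
    -- Write N - (1 - ρ) N' = ρ N + (1 - ρ)(N - N'): the raw noise is damped by ρ, and the rest is a
    -- change between two points under one sample.
    have h3 := integral_norm_add_sq_le (hN.const_smul ρ) ((hN.sub hN').const_smul (1 - ρ))
    have e1 : ∀ ω, (ρ • N) ω + ((1 - ρ) • (N - N')) ω = N ω - (1 - ρ) • N' ω := fun ω => by
      simp only [Pi.smul_apply, Pi.sub_apply]; module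
    simp_rw [e1] at h3
    simp only [Pi.smul_apply, Pi.sub_apply, norm_smul, mul_pow] at h3
    rw [integral_const_mul, integral_const_mul, Real.norm_of_nonneg hρ0,
      Real.norm_of_nonneg (sub_nonneg.2 hρ1)] at h3
    have h4 : 0 ≤ ∫ ω, ‖N ω - N' ω‖ ^ 2 ∂P := integral_nonneg fun _ => by positivity
    have h5 : (1 - ρ) ^ 2 ≤ 1 := by nlinarith
    nlinarith
  linarith

end Freezing

/-! ### Centred noise of the estimators: measurability, mean zero, second moments. -/

namespace StochasticBilevel

variable {E F : Type*} [NormedAddCommGroup E] [InnerProductSpace ℝ E] [FiniteDimensional ℝ E]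
  [NormedAddCommGroup F] [InnerProductSpace ℝ F] [FiniteDimensional ℝ F]
  [MeasurableSpace E] [BorelSpace E] [MeasurableSpace F] [BorelSpace F]
  {V : Type*} [NormedAddCommGroup V] [InnerProductSpace ℝ V] [FiniteDimensional ℝ V]
  [MeasurableSpace V] [BorelSpace V]
  {Ξ Z : Type*} [MeasurableSpace Ξ] [MeasurableSpace Z]
  {p : StochasticBilevel E F Ξ Z} {Lf Lg₁ Lg₂ μ Cf σf σg₁ σg₂ R : ℝ}

/-- The conditions on the problem, collected. -/
structure Regular (p : StochasticBilevel E F Ξ Z) (Lf Lg₁ Lg₂ μ Cf σf σg₁ σg₂ : ℝ) : Prop where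
  Lf_nonneg : 0 ≤ Lf
  Lg₁_nonneg : 0 ≤ Lg₁
  Lg₂_nonneg : 0 ≤ Lg₂
  μ_pos : 0 < μ
  Cf_pos : 0 < Cf
  wp : p.WellPosed
  up : p.UpperSmooth Lf Cf
  low : p.LowerSmooth Lg₁ Lg₂ μ
  var : p.BoundedVariance σf σg₁ σg₂
  mss : p.MeanSquaredSmooth Lf Lg₁ Lg₂

lemma continuous_of_norm_sub_le {X Y : Type*} [NormedAddCommGroup X] [NormedAddCommGroup Y]
    {φ : X → Y} {L : ℝ} (h : ∀ u v, ‖φ u - φ v‖ ≤ L * ‖u - v‖) : Continuous φ := by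
  refine (LipschitzWith.of_dist_le_mul (K := L.toNNReal) fun a b => ?_).continuous
  rw [dist_eq_norm, dist_eq_norm]
  exact (h a b).trans (mul_le_mul_of_nonneg_right (Real.le_coe_toNNReal L) (norm_nonneg _))

namespace Regular

variable (h : p.Regular Lf Lg₁ Lg₂ μ Cf σf σg₁ σg₂)
include h

lemma continuous_gradf : Continuous (∇ p.f) := continuous_of_norm_sub_le h.up.lipGrad

lemma continuous_gradg : Continuous (∇ p.g) := continuous_of_norm_sub_le h.low.lipGrad

lemma continuous_hessg : Continuous fun q : Joint E F × F => hess p.g q.1 (pt 0 q.2) :=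
  ((continuous_of_norm_sub_le h.low.lipHess).comp continuous_fst).clm_apply
    (continuous_pt.comp (continuous_const.prodMk continuous_snd))

end Regular

/-- The part of the noise of an estimator that comes from `∇F`. -/
def noiseξ (p : StochasticBilevel E F Ξ Z) (L₁ : Joint E F →L[ℝ] V) (u : Joint E F) (ξ : Ξ) : V :=
  L₁ (p.gradF u ξ - ∇ p.f u)

/-- The part of the noise of an estimator that comes from `∇G` and `∇²G`. -/
def noiseζ (p : StochasticBilevel E F Ξ Z) (L₂ L₃ : Joint E F →L[ℝ] V) (q : Joint E F × F)
    (ζ : Z) : V :=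
  L₂ (p.gradG q.1 ζ - ∇ p.g q.1) + L₃ (p.hessG q.1 ζ (pt 0 q.2) - hess p.g q.1 (pt 0 q.2))

lemma measurable_pt : Measurable fun w : E × F => pt w.1 w.2 := continuous_pt.measurable

namespace Regular

variable (h : p.Regular Lf Lg₁ Lg₂ μ Cf σf σg₁ σg₂)
include h

lemma measurable_noiseξ (L₁ : Joint E F →L[ℝ] V) :
    Measurable fun q : Joint E F × Ξ => p.noiseξ L₁ q.1 q.2 :=
  L₁.measurable.comp (h.wp.measurable_gradF.sub
    (h.continuous_gradf.measurable.comp measurable_fst))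

lemma measurable_hessG_pt : Measurable fun q : (Joint E F × F) × Z => p.hessG q.1.1 q.2 (pt 0 q.1.2) :=
  h.wp.measurable_hessG.comp (measurable_fst.fst.prodMk
      ((measurable_pt.comp (measurable_const.prodMk measurable_fst.snd)).prodMk measurable_snd))

lemma measurable_noiseζ (L₂ L₃ : Joint E F →L[ℝ] V) :
    Measurable fun q : (Joint E F × F) × Z => p.noiseζ L₂ L₃ q.1 q.2 := by
  refine (L₂.measurable.comp (Measurable.sub ?_ ?_)).add
    (L₃.measurable.comp (Measurable.sub h.measurable_hessG_pt ?_))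
  · exact h.wp.measurable_gradG.comp (measurable_fst.fst.prodMk measurable_snd)
  · exact h.continuous_gradg.measurable.comp measurable_fst.fst
  · exact h.continuous_hessg.measurable.comp measurable_fst

lemma integrable_noiseξ (L₁ : Joint E F →L[ℝ] V) (u : Joint E F) :
    Integrable (p.noiseξ L₁ u) p.lawξ :=
  have := h.wp.probξ
  L₁.integrable_comp ((integrable_gradF h.wp h.var u).sub (integrable_const _))

lemma integral_noiseξ (L₁ : Joint E F →L[ℝ] V) (u : Joint E F) :
    ∫ ξ, p.noiseξ L₁ u ξ ∂p.lawξ = 0 := by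
  have := h.wp.probξ
  have hi := integrable_gradF h.wp h.var u
  have e := L₁.integral_comp_comm (φ := fun ξ => p.gradF u ξ - ∇ p.f u)
    (hi.sub (integrable_const _))
  rw [integral_sub hi (integrable_const _), integral_gradF h.wp h.up h.var h.mss h.Lf_nonneg] at e
  simpa [noiseξ, -map_sub] using e

lemma integrable_noiseζ (L₂ L₃ : Joint E F →L[ℝ] V) (q : Joint E F × F) :
    Integrable (p.noiseζ L₂ L₃ q) p.lawζ :=
  have := h.wp.probζ
  (L₂.integrable_comp ((integrable_gradG h.wp h.var q.1).sub (integrable_const _))).add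
    (L₃.integrable_comp ((integrable_hessG h.wp h.var q.1 _).sub (integrable_const _)))

lemma integral_noiseζ (L₂ L₃ : Joint E F →L[ℝ] V) (q : Joint E F × F) :
    ∫ ζ, p.noiseζ L₂ L₃ q ζ ∂p.lawζ = 0 := by
  have := h.wp.probζ
  have hi := integrable_gradG h.wp h.var q.1
  have hi' := integrable_hessG h.wp h.var q.1 (pt 0 q.2)
  have hj : Integrable (fun ζ => p.gradG q.1 ζ - ∇ p.g q.1) p.lawζ := hi.sub (integrable_const _)
  have hj' : Integrable (fun ζ => p.hessG q.1 ζ (pt 0 q.2) - hess p.g q.1 (pt 0 q.2)) p.lawζ :=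
    hi'.sub (integrable_const _)
  have e := L₂.integral_comp_comm hj
  have e' := L₃.integral_comp_comm hj'
  rw [integral_sub hi (integrable_const _), integral_gradG h.wp h.low h.var h.mss h.Lg₁_nonneg]
    at e
  rw [integral_sub hi' (integrable_const _),
    integral_hessG h.wp h.low h.var h.mss h.Lg₁_nonneg h.Lg₂_nonneg] at e'
  have e3 := integral_add (L₂.integrable_comp hj) (L₃.integrable_comp hj')
  rw [e, e'] at e3
  simpa [noiseζ, -map_sub] using e3

variable {L₁ L₂ L₃ : Joint E F →L[ℝ] V}

lemma lintegral_noiseξ_sq_le (h₁ : ∀ a, ‖L₁ a‖ ≤ ‖a‖) (u : Joint E F) :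
    ∫⁻ ξ, ‖p.noiseξ L₁ u ξ‖ₑ ^ 2 ∂p.lawξ ≤ ENNReal.ofReal (σf ^ 2) := by
  simpa using lintegral_sq_le_of_norm_le (C := 1) zero_le_one
    (fun ξ => by rw [one_mul]; exact h₁ (p.gradF u ξ - ∇ p.f u)) (h.var.gradF u)

lemma lintegral_noiseζ_sq_le (h₂ : ∀ a, ‖L₂ a‖ ≤ ‖a‖) (h₃ : ∀ a, ‖L₃ a‖ ≤ ‖a‖)
    (q : Joint E F × F) :
    ∫⁻ ζ, ‖p.noiseζ L₂ L₃ q ζ‖ₑ ^ 2 ∂p.lawζ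
      ≤ ENNReal.ofReal (2 * σg₁ ^ 2 + 2 * (‖q.2‖ ^ 2 * σg₂ ^ 2)) := by
  refine lintegral_add_sq_le ?_ (by positivity) (by positivity) ?_ ?_
  · exact L₂.measurable.comp ((h.wp.measurable_gradG.comp measurable_prodMk_left).sub_const _)
  · simpa [-map_sub] using lintegral_sq_le_of_norm_le (C := 1) zero_le_one
      (fun ζ => by rw [one_mul]; exact h₂ (p.gradG q.1 ζ - ∇ p.g q.1)) (h.var.gradG q.1)
  · simpa [norm_pt_zero, -map_sub] using lintegral_sq_le_of_norm_le (C := 1) zero_le_one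
      (fun ζ => by rw [one_mul]; exact h₃ (p.hessG q.1 ζ (pt 0 q.2) - hess p.g q.1 (pt 0 q.2)))
      (lintegral_hessG_sub_apply_le h.var q.1 (pt 0 q.2))

lemma lintegral_const_sq_le {S W : Type*} [MeasurableSpace S] {ν : Measure S}
    [IsProbabilityMeasure ν] [NormedAddCommGroup W] {a : W} {c : ℝ} (hc : ‖a‖ ^ 2 ≤ c) :
    ∫⁻ _ : S, ‖a‖ₑ ^ 2 ∂ν ≤ ENNReal.ofReal c := by
  rw [lintegral_const, measure_univ, mul_one, ← ofReal_norm, ← ENNReal.ofReal_pow (norm_nonneg _)]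
  exact ENNReal.ofReal_le_ofReal hc

/-- The sampled difference is controlled by mean-squared smoothness and its centring by the
Lipschitz bound for ∇f; adding the two squares costs the factor 4. -/
lemma lintegral_noiseξ_sub_sq_le (h₁ : ∀ a, ‖L₁ a‖ ≤ ‖a‖) (u u' : Joint E F) :
    ∫⁻ ξ, ‖p.noiseξ L₁ u ξ - p.noiseξ L₁ u' ξ‖ₑ ^ 2 ∂p.lawξ
      ≤ ENNReal.ofReal (4 * (Lf * ‖u - u'‖) ^ 2) := by
  have := h.wp.probξ
  have hms : ∀ v, Measurable (p.gradF v) := fun v =>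
    h.wp.measurable_gradF.comp measurable_prodMk_left
  have h4 := lintegral_add_sq_le (X := fun ξ => p.gradF u ξ - p.gradF u' ξ)
    (Y := fun _ => ∇ p.f u' - ∇ p.f u) ((hms u).sub (hms u')) (by positivity) (by positivity)
    (h.mss.gradF u u') (lintegral_const_sq_le h (c := (Lf * ‖u - u'‖) ^ 2)
      (pow_le_pow_left₀ (norm_nonneg _) (by
        rw [norm_sub_rev u]; exact h.up.lipGrad u' u) 2))
  refine (lintegral_sq_le_of_norm_le (C := 1) zero_le_one (fun ξ => ?_) h4).trans (le_of_eq ?_)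
  · rw [one_mul, noiseξ, noiseξ, ← map_sub]
    refine (h₁ _).trans (le_of_eq ?_)
    congr 1; abel
  · congr 1; ring

/-- The Hessian part is split as (∇²G(u) - ∇²G(u')) z + ∇²G(u')(z - z'). The first term uses
mean-squared smoothness and ‖z‖ ≤ R, the second `lintegral_hessG_apply_le`. Only the current z must
lie in the ball, so the arbitrary initial z is allowed as the previous one. -/
lemma lintegral_noiseζ_sub_sq_le (h₂ : ∀ a, ‖L₂ a‖ ≤ ‖a‖) (h₃ : ∀ a, ‖L₃ a‖ ≤ ‖a‖)
    (q q' : Joint E F × F) (hq : ‖q.2‖ ≤ R) :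
    ∫⁻ ζ, ‖p.noiseζ L₂ L₃ q ζ - p.noiseζ L₂ L₃ q' ζ‖ₑ ^ 2 ∂p.lawζ
      ≤ ENNReal.ofReal (16 * (Lg₁ ^ 2 + Lg₂ ^ 2 * R ^ 2) *
        (‖q.1 - q'.1‖ ^ 2 + ‖q.2 - q'.2‖ ^ 2)) := by
  have := h.wp.probζ
  have hms : ∀ v, Measurable (p.gradG v) := fun v =>
    h.wp.measurable_gradG.comp measurable_prodMk_left
  have hmh : ∀ v b, Measurable (fun ζ => p.hessG v ζ b) := fun v b =>
    h.wp.measurable_hessG.comp (measurable_const.prodMk (measurable_const.prodMk measurable_id))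
  set a := (Lg₁ * ‖q.1 - q'.1‖) ^ 2 with ha
  set b := ‖pt (0 : E) q.2‖ ^ 2 * (Lg₂ * ‖q.1 - q'.1‖) ^ 2 with hb
  set c := (Lg₁ * ‖pt (0 : E) (q.2 - q'.2)‖) ^ 2 with hc
  have hG := lintegral_add_sq_le (X := fun ζ => p.gradG q.1 ζ - p.gradG q'.1 ζ)
    (Y := fun _ => ∇ p.g q'.1 - ∇ p.g q.1) ((hms _).sub (hms _)) (by positivity) (by positivity)
    (h.mss.gradG q.1 q'.1) (lintegral_const_sq_le h (c := a)
      (pow_le_pow_left₀ (norm_nonneg _) (by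
        rw [norm_sub_rev q.1]; exact h.low.lipGrad q'.1 q.1) 2))
  have hX : ∫⁻ ζ, ‖p.hessG q.1 ζ (pt 0 q.2) - p.hessG q'.1 ζ (pt 0 q.2)‖ₑ ^ 2 ∂p.lawζ
      ≤ ENNReal.ofReal b :=
    lintegral_sq_le_of_norm_le (X := fun ζ => p.hessG q.1 ζ - p.hessG q'.1 ζ) (norm_nonneg _)
      (fun ζ => (ContinuousLinearMap.le_opNorm (p.hessG q.1 ζ - p.hessG q'.1 ζ) _).trans_eq
        (mul_comm _ _)) (h.mss.hessG q.1 q'.1)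
  have hH := lintegral_add_sq_le (((hmh q.1 (pt 0 q.2))).sub (hmh q'.1 (pt 0 q.2)))
    (by positivity) (by positivity) hX
    (lintegral_hessG_apply_le h.wp h.mss q'.1 (pt 0 (q.2 - q'.2)))
  have hdet : ‖hess p.g q'.1 (pt 0 q'.2) - hess p.g q.1 (pt 0 q.2)‖ ^ 2 ≤ 2 * b + 2 * c := by
    have h5 := norm_hess_sub_le h.Lg₁_nonneg h.low.lipGrad h.low.lipHess q.1 q'.1 q.2 q'.2
    rw [norm_sub_rev]
    refine (pow_le_pow_left₀ (norm_nonneg _) h5 2).trans ?_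
    rw [hb, hc, norm_pt_zero, norm_pt_zero]
    nlinarith [sq_nonneg (Lg₂ * ‖q.1 - q'.1‖ * ‖q.2‖ - Lg₁ * ‖q.2 - q'.2‖)]
  have hH2 := lintegral_add_sq_le
    (X := fun ζ => (p.hessG q.1 ζ (pt 0 q.2) - p.hessG q'.1 ζ (pt 0 q.2))
      + p.hessG q'.1 ζ (pt 0 (q.2 - q'.2)))
    (Y := fun _ => hess p.g q'.1 (pt 0 q'.2) - hess p.g q.1 (pt 0 q.2))
    ((((hmh q.1 (pt 0 q.2))).sub (hmh q'.1 (pt 0 q.2))).add (hmh _ _))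
    (by positivity) (by positivity) hH (lintegral_const_sq_le h hdet)
  have hG' := lintegral_sq_le_of_norm_le (C := 1) zero_le_one
    (fun ζ => (h₂ (p.gradG q.1 ζ - p.gradG q'.1 ζ
      + (∇ p.g q'.1 - ∇ p.g q.1))).trans_eq (one_mul _).symm) hG
  have hH' := lintegral_sq_le_of_norm_le (C := 1) zero_le_one
    (fun ζ => (h₃ (p.hessG q.1 ζ (pt 0 q.2) - p.hessG q'.1 ζ (pt 0 q.2)
          + p.hessG q'.1 ζ (pt 0 (q.2 - q'.2))
          + (hess p.g q'.1 (pt 0 q'.2) - hess p.g q.1 (pt 0 q.2)))).trans_eq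
            (one_mul _).symm) hH2
  have hall := lintegral_add_sq_le (L₂.measurable.comp
    (((hms q.1).sub (hms q'.1)).add measurable_const)) (by positivity) (by positivity) hG' hH'
  have e : ∀ ζ, p.noiseζ L₂ L₃ q ζ - p.noiseζ L₂ L₃ q' ζ
      = L₂ (p.gradG q.1 ζ - p.gradG q'.1 ζ + (∇ p.g q'.1 - ∇ p.g q.1))
        + L₃ (p.hessG q.1 ζ (pt 0 q.2) - p.hessG q'.1 ζ (pt 0 q.2)
          + p.hessG q'.1 ζ (pt 0 (q.2 - q'.2))
          + (hess p.g q'.1 (pt 0 q'.2) - hess p.g q.1 (pt 0 q.2))) := fun ζ => by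
    simp only [noiseζ, pt_zero_sub, map_sub, map_add]; abel
  simp_rw [e]
  refine hall.trans (ENNReal.ofReal_le_ofReal ?_)
  have hb' : b ≤ Lg₂ ^ 2 * R ^ 2 * ‖q.1 - q'.1‖ ^ 2 := by
    rw [hb, norm_pt_zero]
    have : ‖q.2‖ ^ 2 ≤ R ^ 2 := pow_le_pow_left₀ (norm_nonneg _) hq 2
    nlinarith [mul_le_mul_of_nonneg_right this (sq_nonneg (Lg₂ * ‖q.1 - q'.1‖))]
  have ha' : a = Lg₁ ^ 2 * ‖q.1 - q'.1‖ ^ 2 := by rw [ha]; ring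
  have hc' : c = Lg₁ ^ 2 * ‖q.2 - q'.2‖ ^ 2 := by rw [hc, norm_pt_zero]; ring
  have h6 : 0 ≤ Lg₂ ^ 2 * R ^ 2 * ‖q.2 - q'.2‖ ^ 2 := by positivity
  have h7 : 0 ≤ Lg₁ ^ 2 * ‖q.1 - q'.1‖ ^ 2 := by positivity
  nlinarith

end Regular

end StochasticBilevel

/-! ### The noise at random points known before the sample is drawn. -/

namespace StochasticBilevel

variable {E F : Type*} [NormedAddCommGroup E] [InnerProductSpace ℝ E] [FiniteDimensional ℝ E]
  [NormedAddCommGroup F] [InnerProductSpace ℝ F] [FiniteDimensional ℝ F]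
  [MeasurableSpace E] [BorelSpace E] [MeasurableSpace F] [BorelSpace F]
  {V : Type*} [NormedAddCommGroup V] [InnerProductSpace ℝ V] [FiniteDimensional ℝ V]
  [MeasurableSpace V] [BorelSpace V]
  {Ξ Z : Type*} [MeasurableSpace Ξ] [MeasurableSpace Z]
  {p : StochasticBilevel E F Ξ Z} {Lf Lg₁ Lg₂ μ Cf σf σg₁ σg₂ R : ℝ}

/-- The samples `X`, `Y` have the prescribed distributions and are independent of the past `m`. -/
structure Fresh (p : StochasticBilevel E F Ξ Z) {Ω : Type*} (m : MeasurableSpace Ω)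
    [mΩ : MeasurableSpace Ω] (P : Measure Ω) (X : Ω → Ξ) (Y : Ω → Z) : Prop where
  le : m ≤ mΩ
  measX : Measurable X
  measY : Measurable Y
  lawX : P.map X = p.lawξ
  lawY : P.map Y = p.lawζ
  indX : Indep m (MeasurableSpace.comap X inferInstance) P
  indY : Indep m (MeasurableSpace.comap Y inferInstance) P

/-- The noise of an estimator at the point `q`. -/
def noise (p : StochasticBilevel E F Ξ Z) (L₁ L₂ L₃ : Joint E F →L[ℝ] V) (q : Joint E F × F)
    (ξ : Ξ) (ζ : Z) : V :=
  p.noiseξ L₁ q.1 ξ + p.noiseζ L₂ L₃ q ζ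

variable {Ω : Type*} {m mΩ : MeasurableSpace Ω} {P : Measure Ω} [IsProbabilityMeasure P]
  {X : Ω → Ξ} {Y : Ω → Z} {L₁ L₂ L₃ : Joint E F →L[ℝ] V}

namespace Regular

variable (h : p.Regular Lf Lg₁ Lg₂ μ Cf σf σg₁ σg₂)
include h

/-- The contributions of the two samples are handled separately because the dependence between X and
Y is arbitrary; only the independence of each from the past is available. -/
lemma memLp_noise_parts (hF : p.Fresh m P X Y) (h₁ : ∀ a, ‖L₁ a‖ ≤ ‖a‖) (h₂ : ∀ a, ‖L₂ a‖ ≤ ‖a‖)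
    (h₃ : ∀ a, ‖L₃ a‖ ≤ ‖a‖) {q : Ω → Joint E F × F} (hq : Measurable[m] q)
    (hz : MemLp (fun ω => (q ω).2) 2 P) :
    MemLp (fun ω => p.noiseξ L₁ (q ω).1 (X ω)) 2 P ∧
      MemLp (fun ω => p.noiseζ L₂ L₃ (q ω) (Y ω)) 2 P :=
  ⟨(memLp_and_integral_sq_le_of_indep hF.le hF.measX hF.lawX hF.indX hq.fst
      (h.measurable_noiseξ L₁) (integrable_const (σf ^ 2)) (fun _ => by positivity)
      fun ω => h.lintegral_noiseξ_sq_le h₁ _).1,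
    (memLp_and_integral_sq_le_of_indep hF.le hF.measY hF.lawY hF.indY hq
      (h.measurable_noiseζ L₂ L₃)
      (b := fun ω => 2 * σg₁ ^ 2 + 2 * (‖(q ω).2‖ ^ 2 * σg₂ ^ 2))
      ((integrable_const _).add (((hz.integrable_norm_pow two_ne_zero).mul_const _).const_mul _))
      (fun _ => by positivity) fun ω => h.lintegral_noiseζ_sq_le h₂ h₃ _).1⟩

lemma memLp_noise (hF : p.Fresh m P X Y) (h₁ : ∀ a, ‖L₁ a‖ ≤ ‖a‖) (h₂ : ∀ a, ‖L₂ a‖ ≤ ‖a‖)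
    (h₃ : ∀ a, ‖L₃ a‖ ≤ ‖a‖) {q : Ω → Joint E F × F} (hq : Measurable[m] q)
    (hz : MemLp (fun ω => (q ω).2) 2 P) :
    MemLp (fun ω => p.noise L₁ L₂ L₃ (q ω) (X ω) (Y ω)) 2 P :=
  (h.memLp_noise_parts hF h₁ h₂ h₃ hq hz).1.add (h.memLp_noise_parts hF h₁ h₂ h₃ hq hz).2

lemma integral_inner_noise (hF : p.Fresh m P X Y) (h₁ : ∀ a, ‖L₁ a‖ ≤ ‖a‖)
    (h₂ : ∀ a, ‖L₂ a‖ ≤ ‖a‖) (h₃ : ∀ a, ‖L₃ a‖ ≤ ‖a‖) {q : Ω → Joint E F × F}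
    (hq : Measurable[m] q) (hz : MemLp (fun ω => (q ω).2) 2 P) {w : Ω → V} (hw : Measurable[m] w)
    (hw2 : MemLp w 2 P) :
    ∫ ω, inner ℝ (w ω) (p.noise L₁ L₂ L₃ (q ω) (X ω) (Y ω)) ∂P = 0 := by
  obtain ⟨ha, hb⟩ := h.memLp_noise_parts hF h₁ h₂ h₃ hq hz
  simp_rw [noise, inner_add_right]
  rw [integral_add (integrable_inner_of_memLp hw2 ha) (integrable_inner_of_memLp hw2 hb),
    integral_inner_eq_zero_of_indep hF.le hF.measX hF.lawX hF.indX hq.fst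
      (h.measurable_noiseξ L₁) (h.integrable_noiseξ L₁) (h.integral_noiseξ L₁) hw hw2 ha,
    integral_inner_eq_zero_of_indep hF.le hF.measY hF.lawY hF.indY hq
      (h.measurable_noiseζ L₂ L₃) (h.integrable_noiseζ L₂ L₃) (h.integral_noiseζ L₂ L₃) hw hw2 hb,
    add_zero]

lemma integral_noise_sq_le (hF : p.Fresh m P X Y) (h₁ : ∀ a, ‖L₁ a‖ ≤ ‖a‖)
    (h₂ : ∀ a, ‖L₂ a‖ ≤ ‖a‖) (h₃ : ∀ a, ‖L₃ a‖ ≤ ‖a‖) {q : Ω → Joint E F × F}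
    (hq : Measurable[m] q) (hR : ∀ ω, ‖(q ω).2‖ ≤ R) :
    ∫ ω, ‖p.noise L₁ L₂ L₃ (q ω) (X ω) (Y ω)‖ ^ 2 ∂P
      ≤ 2 * σf ^ 2 + 4 * σg₁ ^ 2 + 4 * R ^ 2 * σg₂ ^ 2 := by
  obtain ⟨ha, ha'⟩ := memLp_and_integral_sq_le_of_indep hF.le hF.measX hF.lawX hF.indX hq.fst
    (h.measurable_noiseξ L₁) (integrable_const (σf ^ 2)) (fun _ => by positivity)
    fun ω => h.lintegral_noiseξ_sq_le h₁ _
  obtain ⟨hb, hb'⟩ := memLp_and_integral_sq_le_of_indep hF.le hF.measY hF.lawY hF.indY hq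
    (h.measurable_noiseζ L₂ L₃)
    (integrable_const (2 * σg₁ ^ 2 + 2 * (R ^ 2 * σg₂ ^ 2))) (fun _ => by positivity)
    fun ω => (h.lintegral_noiseζ_sq_le h₂ h₃ _).trans (ENNReal.ofReal_le_ofReal (by
      gcongr; exact hR ω))
  have := integral_norm_add_sq_le ha hb
  simp only [integral_const, probReal_univ, one_smul] at ha' hb'
  simp only [noise]
  linarith

lemma integral_noiseξ_sub_sq_le (hF : p.Fresh m P X Y) (h₁ : ∀ a, ‖L₁ a‖ ≤ ‖a‖)
    {u u' : Ω → Joint E F} (hu : Measurable[m] u) (hu' : Measurable[m] u')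
    (hΔ : Integrable (fun ω => ‖u ω - u' ω‖ ^ 2) P) :
    MemLp (fun ω => p.noiseξ L₁ (u ω) (X ω) - p.noiseξ L₁ (u' ω) (X ω)) 2 P ∧
      ∫ ω, ‖p.noiseξ L₁ (u ω) (X ω) - p.noiseξ L₁ (u' ω) (X ω)‖ ^ 2 ∂P
        ≤ 4 * Lf ^ 2 * ∫ ω, ‖u ω - u' ω‖ ^ 2 ∂P := by
  have hm₁ : Measurable fun c : (Joint E F × Joint E F) × Ξ => p.noiseξ L₁ c.1.1 c.2 :=
    (h.measurable_noiseξ L₁).comp (f := fun c : (Joint E F × Joint E F) × Ξ => (c.1.1, c.2))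
      (measurable_fst.fst.prodMk measurable_snd)
  have hm₂ : Measurable fun c : (Joint E F × Joint E F) × Ξ => p.noiseξ L₁ c.1.2 c.2 :=
    (h.measurable_noiseξ L₁).comp (f := fun c : (Joint E F × Joint E F) × Ξ => (c.1.2, c.2))
      (measurable_fst.snd.prodMk measurable_snd)
  rw [← integral_const_mul]
  exact memLp_and_integral_sq_le_of_indep (a := fun ω => (u ω, u' ω))
    (ψ := fun c ξ => p.noiseξ L₁ c.1 ξ - p.noiseξ L₁ c.2 ξ) hF.le hF.measX hF.lawX hF.indX
    (hu.prodMk hu') (hm₁.sub hm₂) (hΔ.const_mul (4 * Lf ^ 2)) (fun ω => by positivity)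
    fun ω => (h.lintegral_noiseξ_sub_sq_le h₁ _ _).trans_eq (by congr 1; ring)

lemma integral_noiseζ_sub_sq_le (hF : p.Fresh m P X Y)
    (h₂ : ∀ a, ‖L₂ a‖ ≤ ‖a‖) (h₃ : ∀ a, ‖L₃ a‖ ≤ ‖a‖) {q q' : Ω → Joint E F × F}
    (hq : Measurable[m] q) (hq' : Measurable[m] q') (hR : ∀ ω, ‖(q ω).2‖ ≤ R)
    (hΔ : Integrable (fun ω => ‖(q ω).1 - (q' ω).1‖ ^ 2 + ‖(q ω).2 - (q' ω).2‖ ^ 2) P) :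
    MemLp (fun ω => p.noiseζ L₂ L₃ (q ω) (Y ω) - p.noiseζ L₂ L₃ (q' ω) (Y ω)) 2 P ∧
      ∫ ω, ‖p.noiseζ L₂ L₃ (q ω) (Y ω) - p.noiseζ L₂ L₃ (q' ω) (Y ω)‖ ^ 2 ∂P
        ≤ 16 * (Lg₁ ^ 2 + Lg₂ ^ 2 * R ^ 2)
          * ∫ ω, (‖(q ω).1 - (q' ω).1‖ ^ 2 + ‖(q ω).2 - (q' ω).2‖ ^ 2) ∂P := by
  have hm₁ : Measurable fun c : ((Joint E F × F) × (Joint E F × F)) × Z => p.noiseζ L₂ L₃ c.1.1 c.2 :=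
    (h.measurable_noiseζ L₂ L₃).comp (f := fun c : ((Joint E F × F) × (Joint E F × F)) × Z => (c.1.1, c.2))
      (measurable_fst.fst.prodMk measurable_snd)
  have hm₂ : Measurable fun c : ((Joint E F × F) × (Joint E F × F)) × Z => p.noiseζ L₂ L₃ c.1.2 c.2 :=
    (h.measurable_noiseζ L₂ L₃).comp (f := fun c : ((Joint E F × F) × (Joint E F × F)) × Z => (c.1.2, c.2))
      (measurable_fst.snd.prodMk measurable_snd)
  rw [← integral_const_mul]
  exact memLp_and_integral_sq_le_of_indep (a := fun ω => (q ω, q' ω))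
    (ψ := fun c ζ => p.noiseζ L₂ L₃ c.1 ζ - p.noiseζ L₂ L₃ c.2 ζ) hF.le hF.measY hF.lawY hF.indY
    (hq.prodMk hq') (hm₁.sub hm₂) (hΔ.const_mul (16 * (Lg₁ ^ 2 + Lg₂ ^ 2 * R ^ 2)))
    (fun ω => by positivity) fun ω => h.lintegral_noiseζ_sub_sq_le h₂ h₃ _ _ (hR ω)

lemma integral_noise_sub_sq_le (hF : p.Fresh m P X Y) (h₁ : ∀ a, ‖L₁ a‖ ≤ ‖a‖)
    (h₂ : ∀ a, ‖L₂ a‖ ≤ ‖a‖) (h₃ : ∀ a, ‖L₃ a‖ ≤ ‖a‖) {q q' : Ω → Joint E F × F}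
    (hq : Measurable[m] q) (hq' : Measurable[m] q') (hR : ∀ ω, ‖(q ω).2‖ ≤ R)
    (hΔu : Integrable (fun ω => ‖(q ω).1 - (q' ω).1‖ ^ 2) P)
    (hΔz : Integrable (fun ω => ‖(q ω).2 - (q' ω).2‖ ^ 2) P) :
    ∫ ω, ‖p.noise L₁ L₂ L₃ (q ω) (X ω) (Y ω) - p.noise L₁ L₂ L₃ (q' ω) (X ω) (Y ω)‖ ^ 2 ∂P
      ≤ 32 * (Lf ^ 2 + Lg₁ ^ 2 + Lg₂ ^ 2 * R ^ 2)
        * ∫ ω, (‖(q ω).1 - (q' ω).1‖ ^ 2 + ‖(q ω).2 - (q' ω).2‖ ^ 2) ∂P := by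
  obtain ⟨ha, ha'⟩ := h.integral_noiseξ_sub_sq_le hF h₁ hq.fst hq'.fst hΔu
  obtain ⟨hb, hb'⟩ := h.integral_noiseζ_sub_sq_le hF h₂ h₃ hq hq' hR (hΔu.add hΔz)
  have h5 := integral_norm_add_sq_le ha hb
  have e : ∀ ω, p.noise L₁ L₂ L₃ (q ω) (X ω) (Y ω) - p.noise L₁ L₂ L₃ (q' ω) (X ω) (Y ω)
      = p.noiseξ L₁ (q ω).1 (X ω) - p.noiseξ L₁ (q' ω).1 (X ω)
        + (p.noiseζ L₂ L₃ (q ω) (Y ω) - p.noiseζ L₂ L₃ (q' ω) (Y ω)) := fun ω => by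
    simp only [noise]; abel
  simp_rw [e]
  rw [integral_add hΔu hΔz] at hb' ⊢
  have h6 : 0 ≤ ∫ ω, ‖(q ω).1 - (q' ω).1‖ ^ 2 ∂P := integral_nonneg fun _ => by positivity
  have h7 : 0 ≤ ∫ ω, ‖(q ω).2 - (q' ω).2‖ ^ 2 ∂P := integral_nonneg fun _ => by positivity
  linarith [mul_nonneg (sq_nonneg Lf) h6, mul_nonneg (sq_nonneg Lf) h7]

/-- One step of recursive momentum: the error of the estimator contracts up to the noise level and
the distance moved. -/
lemma integral_error_le (hF : p.Fresh m P X Y) (h₁ : ∀ a, ‖L₁ a‖ ≤ ‖a‖)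
    (h₂ : ∀ a, ‖L₂ a‖ ≤ ‖a‖) (h₃ : ∀ a, ‖L₃ a‖ ≤ ‖a‖) {q q' : Ω → Joint E F × F}
    (hq : Measurable[m] q) (hq' : Measurable[m] q') (hR : ∀ ω, ‖(q ω).2‖ ≤ R)
    (hz : MemLp (fun ω => (q ω).2) 2 P) (hz' : MemLp (fun ω => (q' ω).2) 2 P)
    (hΔu : Integrable (fun ω => ‖(q ω).1 - (q' ω).1‖ ^ 2) P)
    (hΔz : Integrable (fun ω => ‖(q ω).2 - (q' ω).2‖ ^ 2) P) {w : Ω → V} (hw : Measurable[m] w) (hw2 : MemLp w 2 P) {ρ : ℝ} (hρ0 : 0 ≤ ρ) (hρ1 : ρ ≤ 1) :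
    ∫ ω, ‖(1 - ρ) • w ω + (p.noise L₁ L₂ L₃ (q ω) (X ω) (Y ω)
        - (1 - ρ) • p.noise L₁ L₂ L₃ (q' ω) (X ω) (Y ω))‖ ^ 2 ∂P
      ≤ (1 - ρ) * ∫ ω, ‖w ω‖ ^ 2 ∂P + (4 * σf ^ 2 + 8 * σg₁ ^ 2 + 8 * R ^ 2 * σg₂ ^ 2) * ρ ^ 2
        + 64 * (Lf ^ 2 + Lg₁ ^ 2 + Lg₂ ^ 2 * R ^ 2)
          * ∫ ω, (‖(q ω).1 - (q' ω).1‖ ^ 2 + ‖(q ω).2 - (q' ω).2‖ ^ 2) ∂P := by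
  have a := integral_momentum_error_le hw2 (h.memLp_noise hF h₁ h₂ h₃ hq hz)
    (h.memLp_noise hF h₁ h₂ h₃ hq' hz') (h.integral_inner_noise hF h₁ h₂ h₃ hq hz hw hw2)
    (h.integral_inner_noise hF h₁ h₂ h₃ hq' hz' hw hw2) hρ0 hρ1
  have b := mul_le_mul_of_nonneg_left (h.integral_noise_sq_le hF h₁ h₂ h₃ hq hR)
    (by positivity : 0 ≤ 2 * ρ ^ 2)
  have c := h.integral_noise_sub_sq_le hF h₁ h₂ h₃ hq hq' hR hΔu hΔz
  refine a.trans ?_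
  linarith

end Regular

end StochasticBilevel

/-! ### Descent, tracking and movement at deterministic points. -/

namespace StochasticBilevel

variable {E F : Type*} [NormedAddCommGroup E] [InnerProductSpace ℝ E] [FiniteDimensional ℝ E]
  [NormedAddCommGroup F] [InnerProductSpace ℝ F] [FiniteDimensional ℝ F]
  {Ξ Z : Type*} [MeasurableSpace Ξ] [MeasurableSpace Z]
  {p : StochasticBilevel E F Ξ Z} {Lf Lg₁ Lg₂ μ Cf σf σg₁ σg₂ : ℝ}

local notation "⟪" x ", " y "⟫" => inner ℝ x y

/-- The Lipschitz constant of `∇²g z` and `∇f` in `(x, y)`, for `‖z‖ ≤ C^f / μ`. -/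
def lipDir (Lf Lg₂ μ Cf : ℝ) : ℝ := Lf + Lg₂ * (Cf / μ)

/-- The Lipschitz constant of the estimators in mean square. -/
def lipEst (Lf Lg₁ Lg₂ μ Cf : ℝ) : ℝ := 64 * (Lf ^ 2 + Lg₁ ^ 2 + Lg₂ ^ 2 * (Cf / μ) ^ 2)

/-- A constant that dominates those in all the one-step inequalities. -/
def stepConst (Lf Lg₁ Lg₂ μ Cf : ℝ) : ℝ :=
  1 + 12 / μ + 12 / μ * lipDir Lf Lg₂ μ Cf ^ 2 + 6 / μ * (Lg₁ / μ) ^ 2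
    + 6 / μ * (lipDir Lf Lg₂ μ Cf * (1 + Lg₁ / μ) / μ) ^ 2
    + 2 * lipDir Lf Lg₂ μ Cf ^ 2 + 2 * Lg₁ ^ 2
    + 3 * lipEst Lf Lg₁ Lg₂ μ Cf * (2 + 4 * lipDir Lf Lg₂ μ Cf ^ 2 + 4 * Lg₁ ^ 2)

lemma norm_pt_sub_same (x : E) (y y' : F) : ‖pt x y - pt x y'‖ = ‖y - y'‖ := by
  rw [pt_sub, sub_self, norm_pt_zero]

namespace Regular

variable (h : p.Regular Lf Lg₁ Lg₂ μ Cf σf σg₁ σg₂)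
include h

lemma hasGradientAt (x : E) :
    HasGradientAt p.H (dirX p.f p.g x (p.yStar x) (p.zStar x)) x :=
  hasGradientAt_H h.low h.up h.Lf_nonneg h.Lg₂_nonneg h.μ_pos x

/-- ∇H(x) is the same direction evaluated at (y*, z*). The Lipschitz bound is used with z* as its
first vector, so that ‖z*‖ ≤ Cf / μ enters and no bound on z is needed. -/
lemma norm_dirX_sub_gradient_le (x : E) (y z : F) :
    ‖dirX p.f p.g x y z - ∇ p.H x‖ ^ 2 ≤ 2 * lipDir Lf Lg₂ μ Cf ^ 2 * ‖y - p.yStar x‖ ^ 2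
      + 2 * Lg₁ ^ 2 * ‖z - p.zStar x‖ ^ 2 := by
  rw [(h.hasGradientAt x).gradient, norm_sub_rev]
  have h1 := norm_dirX_sub_le h.Lg₁_nonneg h.up.lipGrad h.low.lipGrad h.low.lipHess x x
    (p.yStar x) y (p.zStar x) z
  rw [norm_pt_sub_same, norm_sub_rev _ y, norm_sub_rev _ z] at h1
  have h2 : (Lf + Lg₂ * ‖p.zStar x‖) * ‖y - p.yStar x‖
      ≤ lipDir Lf Lg₂ μ Cf * ‖y - p.yStar x‖ :=
    mul_le_mul_of_nonneg_right (add_le_add_right (mul_le_mul_of_nonneg_left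
      (h.low.norm_zStar_le h.up h.μ_pos x) h.Lg₂_nonneg) _) (norm_nonneg _)
  refine (pow_le_pow_left₀ (norm_nonneg _) (h1.trans (add_le_add_left h2 _)) 2).trans ?_
  nlinarith [sq_nonneg (lipDir Lf Lg₂ μ Cf * ‖y - p.yStar x‖ - Lg₁ * ‖z - p.zStar x‖)]

lemma norm_dirZ_sq_le (x : E) (y z : F) :
    ‖dirZ p.f p.g x y z‖ ^ 2 ≤ 2 * lipDir Lf Lg₂ μ Cf ^ 2 * ‖y - p.yStar x‖ ^ 2
      + 2 * Lg₁ ^ 2 * ‖z - p.zStar x‖ ^ 2 := by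
  have h1 := norm_dirZ_sub_le h.Lg₁_nonneg h.up.lipGrad h.low.lipGrad h.low.lipHess x x
    (p.yStar x) y (p.zStar x) z
  rw [norm_pt_sub_same, norm_sub_rev _ y, norm_sub_rev _ z, h.low.dirZ_star h.μ_pos, zero_sub,
    norm_neg] at h1
  have h2 : (Lf + Lg₂ * ‖p.zStar x‖) * ‖y - p.yStar x‖
      ≤ lipDir Lf Lg₂ μ Cf * ‖y - p.yStar x‖ :=
    mul_le_mul_of_nonneg_right (add_le_add_right (mul_le_mul_of_nonneg_left
      (h.low.norm_zStar_le h.up h.μ_pos x) h.Lg₂_nonneg) _) (norm_nonneg _)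
  refine (pow_le_pow_left₀ (norm_nonneg _) (h1.trans (add_le_add_left h2 _)) 2).trans ?_
  nlinarith [sq_nonneg (lipDir Lf Lg₂ μ Cf * ‖y - p.yStar x‖ - Lg₁ * ‖z - p.zStar x‖)]

lemma norm_dirZ_zStar_sq_le (x : E) (y : F) :
    ‖dirZ p.f p.g x y (p.zStar x)‖ ^ 2 ≤ lipDir Lf Lg₂ μ Cf ^ 2 * ‖y - p.yStar x‖ ^ 2 := by
  have h1 := norm_dirZ_sub_le h.Lg₁_nonneg h.up.lipGrad h.low.lipGrad h.low.lipHess x x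
    (p.yStar x) y (p.zStar x) (p.zStar x)
  rw [norm_pt_sub_same, norm_sub_rev _ y, h.low.dirZ_star h.μ_pos, zero_sub,
    norm_neg, sub_self, norm_zero, mul_zero, add_zero] at h1
  rw [← mul_pow]
  refine pow_le_pow_left₀ (norm_nonneg _) (h1.trans ?_) 2
  exact mul_le_mul_of_nonneg_right (add_le_add_right (mul_le_mul_of_nonneg_left
      (h.low.norm_zStar_le h.up h.μ_pos x) h.Lg₂_nonneg) _) (norm_nonneg _)

lemma norm_dirY_sq_le (x : E) (y : F) :
    ‖dirY p.g x y‖ ^ 2 ≤ Lg₁ ^ 2 * ‖y - p.yStar x‖ ^ 2 := by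
  have h1 := norm_grad₂_sub_le h.low.lipGrad x x y (p.yStar x)
  rw [h.low.grad₂_yStar h.μ_pos, sub_zero, norm_pt_sub_same] at h1
  rw [← mul_pow]
  exact pow_le_pow_left₀ (norm_nonneg _) h1 2

/-- Polarization turns the inner product of ∇H and v into the two negative squares plus ‖v - ∇H‖² /
2, and the quadratic remainder takes half of the ‖v‖² term. The remaining a ‖v‖² / 4 later pays for
the drift of y* and z* and for the distance moved. -/
lemma descent (x : E) (y z : F) (v : E) {a : ℝ} (ha : 0 ≤ a)
    (haL : lipDir Lf Lg₂ μ Cf * (1 + Lg₁ / μ) ^ 2 * a ≤ 1 / 4) :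
    p.H (x - a • v) ≤ p.H x - a / 2 * ‖∇ p.H x‖ ^ 2 - a / 4 * ‖v‖ ^ 2
      + a * (‖v - dirX p.f p.g x y z‖ ^ 2 + 2 * lipDir Lf Lg₂ μ Cf ^ 2 * ‖y - p.yStar x‖ ^ 2
        + 2 * Lg₁ ^ 2 * ‖z - p.zStar x‖ ^ 2) := by
  have h1 := abs_H_sub_le h.low h.up h.Lf_nonneg h.Lg₂_nonneg h.μ_pos x (x - a • v)
  rw [← (h.hasGradientAt x).gradient] at h1
  have e : x - a • v - x = -(a • v) := by abel
  rw [e, inner_neg_right, inner_smul_right, norm_neg, norm_smul, Real.norm_of_nonneg ha] at h1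
  have h2 := (le_abs_self _).trans h1
  have h3 : Lf + Lg₂ * (Cf / μ) = lipDir Lf Lg₂ μ Cf := rfl
  rw [h3] at h2
  have h4 : lipDir Lf Lg₂ μ Cf * (1 + Lg₁ / μ) ^ 2 * (a * ‖v‖) ^ 2 ≤ a / 4 * ‖v‖ ^ 2 := by
    have := mul_le_mul_of_nonneg_right haL (by positivity : 0 ≤ a * ‖v‖ ^ 2)
    nlinarith
  have h5 : ‖v - ∇ p.H x‖ ^ 2 = ‖v‖ ^ 2 - 2 * ⟪∇ p.H x, v⟫ + ‖∇ p.H x‖ ^ 2 := by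
    rw [norm_sub_sq_real, real_inner_comm]
  have h6 := norm_add_sq_le_two (v - dirX p.f p.g x y z) (dirX p.f p.g x y z - ∇ p.H x)
  rw [sub_add_sub_cancel, h5] at h6
  have h7 := h.norm_dirX_sub_gradient_le x y z
  have h8 := mul_le_mul_of_nonneg_left (h6.trans (add_le_add_right
    (mul_le_mul_of_nonneg_left h7 two_pos.le) _)) ha
  nlinarith

lemma tracking_y (x : E) (y v : F) (x' : E) {b : ℝ} (hb : 0 < b) (hbL : b * Lg₁ ^ 2 ≤ μ)
    (hbμ : b * μ ≤ 1) :
    ‖y - b • v - p.yStar x'‖ ^ 2 ≤ (1 - b * μ / 2) * ‖y - p.yStar x‖ ^ 2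
      + 6 * b / μ * ‖v - dirY p.g x y‖ ^ 2
      + 6 / (b * μ) * ((Lg₁ / μ) ^ 2 * ‖x' - x‖ ^ 2) := by
  have h1 := h.low.strong_mono x (p.yStar x) y
  rw [h.low.grad₂_yStar h.μ_pos, sub_zero] at h1
  have h2 : ‖grad₂ p.g x y‖ ≤ Lg₁ * ‖y - p.yStar x‖ := by
    have := norm_grad₂_sub_le h.low.lipGrad x x y (p.yStar x)
    rwa [h.low.grad₂_yStar h.μ_pos, sub_zero, norm_pt_sub_same] at this
  have h3 := tracking_step (s := p.yStar x - p.yStar x') (r := v - dirY p.g x y) h.μ_pos hb hbL hbμ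
    h1 h2
  have e : y - p.yStar x - b • grad₂ p.g x y - b • (v - dirY p.g x y) + (p.yStar x - p.yStar x')
      = y - b • v - p.yStar x' := by
    rw [dirY, smul_sub]; abel
  rw [e] at h3
  have h4 := pow_le_pow_left₀ (norm_nonneg _) (h.low.norm_yStar_sub_le h.μ_pos x x') 2
  rw [norm_sub_rev, mul_pow] at h4
  have hμ := h.μ_pos
  have h5 := mul_le_mul_of_nonneg_left h4 (by positivity : 0 ≤ 6 / (b * μ))
  linarith

/-- The projection cannot increase the distance to z*(x'), which lies in the ball. Before it,
`tracking_step` applies to the linear map ∇²₂₂g(x, y). Its perturbation has two sources: the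
estimation error, and the residual of z*(x) in a system formed at y instead of y*(x). -/
lemma tracking_z (x : E) (y z v : F) (x' : E) {b : ℝ} (hb : 0 < b) (hbL : b * Lg₁ ^ 2 ≤ μ)
    (hbμ : b * μ ≤ 1) :
    ‖projBall (Cf / μ) (z - b • v) - p.zStar x'‖ ^ 2 ≤ (1 - b * μ / 2) * ‖z - p.zStar x‖ ^ 2
      + 6 * b / μ * (2 * ‖v - dirZ p.f p.g x y z‖ ^ 2
        + 2 * (lipDir Lf Lg₂ μ Cf ^ 2 * ‖y - p.yStar x‖ ^ 2))
      + 6 / (b * μ) * ((lipDir Lf Lg₂ μ Cf * (1 + Lg₁ / μ) / μ) ^ 2 * ‖x' - x‖ ^ 2) := by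
  have hμ := h.μ_pos
  have hR : 0 ≤ Cf / μ := (div_pos h.Cf_pos hμ).le
  have h0 := pow_le_pow_left₀ (norm_nonneg _) (norm_projBall_sub_le hR (z - b • v)
    (h.low.norm_zStar_le h.up hμ x')) 2
  refine h0.trans ?_
  have h1 := h.low.coercive x y (z - p.zStar x)
  have h2 : ‖hess₂₂ p.g x y (z - p.zStar x)‖ ≤ Lg₁ * ‖z - p.zStar x‖ := by
    refine (norm_snd_le_joint _).trans ((ContinuousLinearMap.le_opNorm _ _).trans ?_)
    rw [norm_pt_zero]
    exact mul_le_mul_of_nonneg_right (opNorm_fderiv_le h.Lg₁_nonneg h.low.lipGrad _)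
      (norm_nonneg _)
  have h3 := tracking_step (s := p.zStar x - p.zStar x')
    (r := (v - dirZ p.f p.g x y z) + dirZ p.f p.g x y (p.zStar x)) hμ hb hbL hbμ h1 h2
  have e : z - p.zStar x - b • hess₂₂ p.g x y (z - p.zStar x)
      - b • ((v - dirZ p.f p.g x y z) + dirZ p.f p.g x y (p.zStar x)) + (p.zStar x - p.zStar x')
      = z - b • v - p.zStar x' := by
    rw [dirZ, dirZ, hess₂₂_sub]; module
  rw [e] at h3
  have h4 := pow_le_pow_left₀ (norm_nonneg _) (h.low.norm_zStar_sub_le h.up h.Lf_nonneg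
    h.Lg₁_nonneg h.Lg₂_nonneg hμ x x') 2
  rw [norm_sub_rev, mul_pow] at h4
  have h5 := mul_le_mul_of_nonneg_left h4 (by positivity : 0 ≤ 6 / (b * μ))
  have h6 := (norm_add_sq_le_two (v - dirZ p.f p.g x y z) (dirZ p.f p.g x y (p.zStar x))).trans
    (add_le_add_right (mul_le_mul_of_nonneg_left (h.norm_dirZ_zStar_sq_le x y) two_pos.le) _)
  have h7 := mul_le_mul_of_nonneg_left h6 (by positivity : 0 ≤ 6 * b / μ)
  have h8 : lipDir Lf Lg₂ μ Cf = Lf + Lg₂ * (Cf / μ) := rfl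
  rw [← h8] at h5
  linarith

/-- The exact y and z directions vanish at (y*, z*), so their lengths are bounded by the tracking
errors. Only the x step keeps its own ‖vx‖², which descent absorbs. -/
lemma movement (x : E) (y z vy vz : F) (vx : E) {a b : ℝ}
    (hz : ‖z‖ ≤ Cf / μ) :
    ‖pt (x - a • vx) (y - b • vy) - pt x y‖ ^ 2 + ‖projBall (Cf / μ) (z - b • vz) - z‖ ^ 2
      ≤ a ^ 2 * ‖vx‖ ^ 2 + b ^ 2 * (2 * ‖vy - dirY p.g x y‖ ^ 2 + 2 * ‖vz - dirZ p.f p.g x y z‖ ^ 2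
        + (4 * lipDir Lf Lg₂ μ Cf ^ 2 + 2 * Lg₁ ^ 2) * ‖y - p.yStar x‖ ^ 2
        + 4 * Lg₁ ^ 2 * ‖z - p.zStar x‖ ^ 2) := by
  have hR : 0 ≤ Cf / μ := (div_pos h.Cf_pos h.μ_pos).le
  have h0 := pow_le_pow_left₀ (norm_nonneg _) (norm_projBall_sub_le hR (z - b • vz) hz) 2
  have e1 : z - b • vz - z = -(b • vz) := by abel
  have e2 : x - a • vx - x = -(a • vx) := by abel
  have e3 : y - b • vy - y = -(b • vy) := by abel
  rw [e1, norm_neg, norm_smul, mul_pow, Real.norm_eq_abs, sq_abs] at h0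
  rw [pt_sub, norm_pt_sq, e2, e3, norm_neg, norm_neg, norm_smul, norm_smul, mul_pow, mul_pow,
    Real.norm_eq_abs, Real.norm_eq_abs, sq_abs, sq_abs]
  have h1 := norm_add_sq_le_two (vy - dirY p.g x y) (dirY p.g x y)
  have h2 := norm_add_sq_le_two (vz - dirZ p.f p.g x y z) (dirZ p.f p.g x y z)
  rw [sub_add_cancel] at h1 h2
  have h3 := h.norm_dirY_sq_le x y
  have h4 := h.norm_dirZ_sq_le x y z
  have h5 : ‖vy‖ ^ 2 + ‖vz‖ ^ 2 ≤ 2 * ‖vy - dirY p.g x y‖ ^ 2 + 2 * ‖vz - dirZ p.f p.g x y z‖ ^ 2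
        + (4 * lipDir Lf Lg₂ μ Cf ^ 2 + 2 * Lg₁ ^ 2) * ‖y - p.yStar x‖ ^ 2
        + 4 * Lg₁ ^ 2 * ‖z - p.zStar x‖ ^ 2 := by linarith
  have h6 := mul_le_mul_of_nonneg_left h5 (sq_nonneg b)
  linarith

end Regular

end StochasticBilevel

/-! ### Adapted square-integrable processes, and the state of the algorithm. -/

section InL2

variable {Ω : Type*} {V W : Type*} [NormedAddCommGroup V] [InnerProductSpace ℝ V]
  [FiniteDimensional ℝ V] [MeasurableSpace V] [BorelSpace V]
  [NormedAddCommGroup W] [InnerProductSpace ℝ W]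
  [FiniteDimensional ℝ W] [MeasurableSpace W] [BorelSpace W]
  {m m' mΩ : MeasurableSpace Ω} {P : Measure Ω} [IsProbabilityMeasure P]

/-- `X` is known at time `m` and square integrable. -/
structure InL2 (m : MeasurableSpace Ω) {mΩ : MeasurableSpace Ω} (P : Measure Ω) (X : Ω → V) :
    Prop where
  meas : Measurable[m] X
  mem : MemLp X 2 P

namespace InL2

lemma mono {X : Ω → V} (hX : InL2 m P X) (hm : m ≤ m') : InL2 m' P X :=
  ⟨hX.meas.mono hm le_rfl, hX.mem⟩

lemma add {X Y : Ω → V} (hX : InL2 m P X) (hY : InL2 m P Y) : InL2 m P fun ω => X ω + Y ω :=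
  ⟨hX.meas.add hY.meas, hX.mem.add hY.mem⟩

lemma sub {X Y : Ω → V} (hX : InL2 m P X) (hY : InL2 m P Y) : InL2 m P fun ω => X ω - Y ω :=
  ⟨hX.meas.sub hY.meas, hX.mem.sub hY.mem⟩

lemma smul {X : Ω → V} (hX : InL2 m P X) (c : ℝ) : InL2 m P fun ω => c • X ω :=
  ⟨hX.meas.const_smul c, hX.mem.const_smul c⟩

lemma const (v : V) : InL2 m P fun _ : Ω => v :=
  ⟨measurable_const, memLp_const v⟩

lemma of_le {X : Ω → V} {Y : Ω → W} (hX : InL2 m P X) (hm : m ≤ mΩ) (hY : Measurable[m] Y) {c : ℝ}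
    (h : ∀ ω, ‖Y ω‖ ≤ c * ‖X ω‖) : InL2 m P Y :=
  ⟨hY, hX.mem.of_le_mul (hY.mono hm le_rfl).aestronglyMeasurable (Filter.Eventually.of_forall h)⟩

lemma comp_lipschitz {X : Ω → V} (hX : InL2 m P X) (hm : m ≤ mΩ) {φ : V → W} {L : ℝ}
    (hφ : ∀ u v, ‖φ u - φ v‖ ≤ L * ‖u - v‖) : InL2 m P fun ω => φ (X ω) := by
  have hc : Continuous φ := StochasticBilevel.continuous_of_norm_sub_le hφ
  have h1 : InL2 m P fun ω => φ (X ω) - φ 0 :=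
    hX.of_le hm ((hc.measurable.comp hX.meas).sub measurable_const) (c := L) fun ω => by
      simpa using hφ (X ω) 0
  simpa using h1.add (const (φ 0))

lemma clm {X : Ω → V} (hX : InL2 m P X) (hm : m ≤ mΩ) (L : V →L[ℝ] W) :
    InL2 m P fun ω => L (X ω) :=
  hX.of_le hm (L.measurable.comp hX.meas) fun ω => L.le_opNorm (X ω)

end InL2

end InL2

namespace StochasticBilevel

variable {E F : Type*} [NormedAddCommGroup E] [InnerProductSpace ℝ E] [FiniteDimensional ℝ E]
  [NormedAddCommGroup F] [InnerProductSpace ℝ F] [FiniteDimensional ℝ F]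
  [MeasurableSpace E] [BorelSpace E] [MeasurableSpace F] [BorelSpace F]
  {V : Type*} [NormedAddCommGroup V] [InnerProductSpace ℝ V] [FiniteDimensional ℝ V]
  [MeasurableSpace V] [BorelSpace V]
  {Ξ Z : Type*} [MeasurableSpace Ξ] [MeasurableSpace Z]
  {p : StochasticBilevel E F Ξ Z} {Lf Lg₁ Lg₂ μ Cf σf σg₁ σg₂ : ℝ}

/-- A linear combination of `∇f`, `∇g` and `∇²g z`. -/
def dir (p : StochasticBilevel E F Ξ Z) (L₁ L₂ L₃ : Joint E F →L[ℝ] V) (q : Joint E F × F) : V :=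
  L₁ (∇ p.f q.1) + (L₂ (∇ p.g q.1) + L₃ (hess p.g q.1 (pt 0 q.2)))

/-- The sampled version of `dir`. -/
def dirSample (p : StochasticBilevel E F Ξ Z) (L₁ L₂ L₃ : Joint E F →L[ℝ] V) (q : Joint E F × F)
    (ξ : Ξ) (ζ : Z) : V :=
  L₁ (p.gradF q.1 ξ) + (L₂ (p.gradG q.1 ζ) + L₃ (p.hessG q.1 ζ (pt 0 q.2)))

lemma dirSample_eq (L₁ L₂ L₃ : Joint E F →L[ℝ] V) (q : Joint E F × F) (ξ : Ξ) (ζ : Z) :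
    p.dirSample L₁ L₂ L₃ q ξ ζ = p.dir L₁ L₂ L₃ q + p.noise L₁ L₂ L₃ q ξ ζ := by
  simp only [dirSample, dir, noise, noiseξ, noiseζ, map_sub]; abel

/-- The projection to `x`. -/
def projX : Joint E F →L[ℝ] E := WithLp.fstL 2 ℝ E F

/-- The projection to `y`. -/
def projY : Joint E F →L[ℝ] F := WithLp.sndL 2 ℝ E F

lemma projX_apply (u : Joint E F) : projX u = u.fst := rfl

lemma projY_apply (u : Joint E F) : projY u = u.snd := rfl

lemma norm_projX_le (u : Joint E F) : ‖projX u‖ ≤ ‖u‖ := norm_fst_le_joint u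

lemma norm_projY_le (u : Joint E F) : ‖projY u‖ ≤ ‖u‖ := norm_snd_le_joint u

lemma norm_neg_projX_le (u : Joint E F) : ‖(-projX) u‖ ≤ ‖u‖ := by
  rw [neg_apply, norm_neg]; exact norm_fst_le_joint u

lemma norm_neg_projY_le (u : Joint E F) : ‖(-projY) u‖ ≤ ‖u‖ := by
  rw [neg_apply, norm_neg]; exact norm_snd_le_joint u

lemma norm_zero_clm_le (u : Joint E F) : ‖(0 : Joint E F →L[ℝ] V) u‖ ≤ ‖u‖ := by
  simp

lemma dirX_eq_dir (x : E) (y z : F) :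
    dirX p.f p.g x y z = p.dir projX 0 (-projX) (pt x y, z) := by
  simp [dirX, dir, grad₁, hess₁₂, projX_apply, sub_eq_add_neg]

lemma dirY_eq_dir (x : E) (y z : F) :
    dirY p.g x y = p.dir 0 projY 0 (pt x y, z) := by
  simp [dirY, dir, grad₂, projY_apply]

lemma dirZ_eq_dir (x : E) (y z : F) :
    dirZ p.f p.g x y z = p.dir (-projY) 0 projY (pt x y, z) := by
  simp [dirZ, dir, grad₂, hess₂₂, projY_apply, sub_eq_neg_add]

lemma dirX_eq_dirSample (ξ : Ξ) (ζ : Z) (x : E) (y z : F) :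
    dirX (fun u => p.upper u ξ) (fun u => p.lower u ζ) x y z
      = p.dirSample projX 0 (-projX) (pt x y, z) ξ ζ := by
  simp [dirX, dirSample, grad₁, hess₁₂, projX_apply, sub_eq_add_neg, gradF, hessG]

lemma dirY_eq_dirSample (ξ : Ξ) (ζ : Z) (x : E) (y z : F) :
    dirY (fun u => p.lower u ζ) x y = p.dirSample 0 projY 0 (pt x y, z) ξ ζ := by
  simp [dirY, dirSample, grad₂, projY_apply, gradG]

lemma dirZ_eq_dirSample (ξ : Ξ) (ζ : Z) (x : E) (y z : F) :
    dirZ (fun u => p.upper u ξ) (fun u => p.lower u ζ) x y z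
      = p.dirSample (-projY) 0 projY (pt x y, z) ξ ζ := by
  simp [dirZ, dirSample, grad₂, hess₂₂, projY_apply, sub_eq_neg_add, gradF, hessG]

/-- The deterministic directions cancel, because one sample serves both points and the correction
added to v is unbiased for the change of direction. -/
lemma momentum_sub_dir (ρ : ℝ) (L₁ L₂ L₃ : Joint E F →L[ℝ] V) (q q' : Joint E F × F) (v : V)
    (ξ : Ξ) (ζ : Z) :
    momentum ρ (p.dirSample L₁ L₂ L₃ q ξ ζ) (p.dirSample L₁ L₂ L₃ q' ξ ζ) v - p.dir L₁ L₂ L₃ q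
      = (1 - ρ) • (v - p.dir L₁ L₂ L₃ q')
        + (p.noise L₁ L₂ L₃ q ξ ζ - (1 - ρ) • p.noise L₁ L₂ L₃ q' ξ ζ) := by
  rw [momentum, dirSample_eq, dirSample_eq]; module

variable {Ω : Type*} {m m' mΩ : MeasurableSpace Ω} {P : Measure Ω} [IsProbabilityMeasure P]
  {X : Ω → Ξ} {Y : Ω → Z} {L₁ L₂ L₃ : Joint E F →L[ℝ] V}

namespace Regular

variable (h : p.Regular Lf Lg₁ Lg₂ μ Cf σf σg₁ σg₂)
include h

/-- The Hessian of g is bounded by Lg₁ everywhere, so its product with a square-integrable z remains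
square integrable. -/
lemma inL2_dir (hm : m ≤ mΩ) {u : Ω → Joint E F} {z : Ω → F} (hu : InL2 m P u)
    (hz : InL2 m P z) : InL2 m P fun ω => p.dir L₁ L₂ L₃ (u ω, z ω) := by
  have h1 : InL2 m P fun ω => hess p.g (u ω) (pt 0 (z ω)) :=
    hz.of_le hm (h.continuous_hessg.measurable.comp (hu.meas.prodMk hz.meas)) (c := Lg₁)
      fun ω => by
        refine (ContinuousLinearMap.le_opNorm _ _).trans ?_
        rw [norm_pt_zero]
        exact mul_le_mul_of_nonneg_right (opNorm_fderiv_le h.Lg₁_nonneg h.low.lipGrad _)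
          (norm_nonneg _)
  exact ((hu.comp_lipschitz hm h.up.lipGrad).clm hm L₁).add
    (((hu.comp_lipschitz hm h.low.lipGrad).clm hm L₂).add (h1.clm hm L₃))

lemma inL2_noise (hF : p.Fresh m P X Y) (hmm' : m ≤ m') (hX : Measurable[m'] X)
    (hY : Measurable[m'] Y) (h₁ : ∀ a, ‖L₁ a‖ ≤ ‖a‖) (h₂ : ∀ a, ‖L₂ a‖ ≤ ‖a‖)
    (h₃ : ∀ a, ‖L₃ a‖ ≤ ‖a‖) {u : Ω → Joint E F} {z : Ω → F} (hu : InL2 m P u)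
    (hz : InL2 m P z) : InL2 m' P fun ω => p.noise L₁ L₂ L₃ (u ω, z ω) (X ω) (Y ω) := by
  have hu' := hu.meas.mono hmm' le_rfl
  have hz' := hz.meas.mono hmm' le_rfl
  refine ⟨?_, h.memLp_noise hF h₁ h₂ h₃ (hu.meas.prodMk hz.meas) hz.mem⟩
  have a : Measurable[m'] fun ω => p.noiseξ L₁ (u ω) (X ω) :=
    (h.measurable_noiseξ L₁).comp (f := fun ω => (u ω, X ω)) (hu'.prodMk hX)
  have b : Measurable[m'] fun ω => p.noiseζ L₂ L₃ (u ω, z ω) (Y ω) :=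
    (h.measurable_noiseζ L₂ L₃).comp (f := fun ω => ((u ω, z ω), Y ω)) ((hu'.prodMk hz').prodMk hY)
  exact a.add b

lemma inL2_momentum (hF : p.Fresh m P X Y) (hmm' : m ≤ m') (hX : Measurable[m'] X)
    (hY : Measurable[m'] Y) (h₁ : ∀ a, ‖L₁ a‖ ≤ ‖a‖) (h₂ : ∀ a, ‖L₂ a‖ ≤ ‖a‖)
    (h₃ : ∀ a, ‖L₃ a‖ ≤ ‖a‖) {u u' : Ω → Joint E F} {z z' : Ω → F} (hu : InL2 m P u)
    (hz : InL2 m P z) (hu' : InL2 m P u') (hz' : InL2 m P z') {v : Ω → V} (hv : InL2 m P v)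
    (ρ : ℝ) : InL2 m' P fun ω => momentum ρ (p.dirSample L₁ L₂ L₃ (u ω, z ω) (X ω) (Y ω))
      (p.dirSample L₁ L₂ L₃ (u' ω, z' ω) (X ω) (Y ω)) (v ω) := by
  have a := (h.inL2_dir (L₁ := L₁) (L₂ := L₂) (L₃ := L₃) hF.le hu hz).mono hmm'
  have a' := (h.inL2_dir (L₁ := L₁) (L₂ := L₂) (L₃ := L₃) hF.le hu' hz').mono hmm'
  have b := h.inL2_noise hF hmm' hX hY h₁ h₂ h₃ hu hz
  have b' := h.inL2_noise hF hmm' hX hY h₁ h₂ h₃ hu' hz'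
  have e : (fun ω => momentum ρ (p.dirSample L₁ L₂ L₃ (u ω, z ω) (X ω) (Y ω))
      (p.dirSample L₁ L₂ L₃ (u' ω, z' ω) (X ω) (Y ω)) (v ω))
      = fun ω => p.dir L₁ L₂ L₃ (u ω, z ω) + ((1 - ρ) • (v ω - p.dir L₁ L₂ L₃ (u' ω, z' ω))
        + (p.noise L₁ L₂ L₃ (u ω, z ω) (X ω) (Y ω)
          - (1 - ρ) • p.noise L₁ L₂ L₃ (u' ω, z' ω) (X ω) (Y ω))) := by
    funext ω
    rw [← momentum_sub_dir]; abel
  rw [e]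
  exact a.add ((((hv.mono hmm').sub a').smul (1 - ρ)).add (b.sub (b'.smul (1 - ρ))))

lemma integral_momentum_sub_dir_sq_le (hF : p.Fresh m P X Y) (h₁ : ∀ a, ‖L₁ a‖ ≤ ‖a‖)
    (h₂ : ∀ a, ‖L₂ a‖ ≤ ‖a‖) (h₃ : ∀ a, ‖L₃ a‖ ≤ ‖a‖) {u u' : Ω → Joint E F} {z z' : Ω → F}
    (hu : InL2 m P u) (hz : InL2 m P z) (hu' : InL2 m P u') (hz' : InL2 m P z') {v : Ω → V}
    (hv : InL2 m P v) (hR : ∀ ω, ‖z ω‖ ≤ Cf / μ) {ρ : ℝ} (hρ0 : 0 ≤ ρ) (hρ1 : ρ ≤ 1) :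
    ∫ ω, ‖momentum ρ (p.dirSample L₁ L₂ L₃ (u ω, z ω) (X ω) (Y ω))
        (p.dirSample L₁ L₂ L₃ (u' ω, z' ω) (X ω) (Y ω)) (v ω) - p.dir L₁ L₂ L₃ (u ω, z ω)‖ ^ 2 ∂P
      ≤ (1 - ρ) * ∫ ω, ‖v ω - p.dir L₁ L₂ L₃ (u' ω, z' ω)‖ ^ 2 ∂P
        + (4 * σf ^ 2 + 8 * σg₁ ^ 2 + 8 * (Cf / μ) ^ 2 * σg₂ ^ 2) * ρ ^ 2
        + lipEst Lf Lg₁ Lg₂ μ Cf * ∫ ω, (‖u ω - u' ω‖ ^ 2 + ‖z ω - z' ω‖ ^ 2) ∂P := by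
  have a' := h.inL2_dir (L₁ := L₁) (L₂ := L₂) (L₃ := L₃) hF.le hu' hz'
  simp_rw [momentum_sub_dir]
  exact h.integral_error_le hF h₁ h₂ h₃ (q := fun ω => (u ω, z ω)) (q' := fun ω => (u' ω, z' ω))
    (hu.meas.prodMk hz.meas) (hu'.meas.prodMk hz'.meas) hR hz.mem hz'.mem
    ((hu.sub hu').mem.integrable_norm_pow two_ne_zero)
    ((hz.sub hz').mem.integrable_norm_pow two_ne_zero) (hv.sub a').meas (hv.sub a').mem hρ0 hρ1

end Regular

lemma inL2_pt (hm : m ≤ mΩ) {x : Ω → E} {y : Ω → F} (hx : InL2 m P x) (hy : InL2 m P y) :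
    InL2 m P fun ω => pt (x ω) (y ω) := by
  have h1 : InL2 m P fun ω => pt (x ω) (0 : F) :=
    hx.of_le hm (measurable_pt.comp (hx.meas.prodMk measurable_const)) (c := 1) fun ω => by
      simpa using norm_pt_le (x ω) (0 : F)
  have h2 : InL2 m P fun ω => pt (0 : E) (y ω) :=
    hy.of_le hm (measurable_pt.comp (measurable_const.prodMk hy.meas)) (c := 1) fun ω => by
      simpa using norm_pt_le (0 : E) (y ω)
  have e : (fun ω => pt (x ω) (y ω)) = fun ω => pt (x ω) (0 : F) + pt (0 : E) (y ω) := by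
    funext ω; rw [pt_add, add_zero, zero_add]
  rw [e]
  exact h1.add h2

/-- The vectors in the memory of the algorithm are known at time `m` and square integrable. -/
structure GoodState (m : MeasurableSpace Ω) {mΩ : MeasurableSpace Ω} (P : Measure Ω)
    (s : Ω → State E F) : Prop where
  xPrev : InL2 m P fun ω => (s ω).xPrev
  yPrev : InL2 m P fun ω => (s ω).yPrev
  zPrev : InL2 m P fun ω => (s ω).zPrev
  x : InL2 m P fun ω => (s ω).x
  y : InL2 m P fun ω => (s ω).y
  z : InL2 m P fun ω => (s ω).z
  vx : InL2 m P fun ω => (s ω).vx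
  vy : InL2 m P fun ω => (s ω).vy
  vz : InL2 m P fun ω => (s ω).vz

lemma goodState_const (s₀ : State E F) : GoodState m P fun _ : Ω => s₀ where
  xPrev := .const _
  yPrev := .const _
  zPrev := .const _
  x := .const _
  y := .const _
  z := .const _
  vx := .const _
  vy := .const _
  vz := .const _

variable {R : ℝ} {c : Schedule} {k : ℕ} {s : Ω → State E F}

/-- One iteration, on random states. -/
def stepState (p : StochasticBilevel E F Ξ Z) (R : ℝ) (c : Schedule) (k : ℕ) (X : Ω → Ξ) (Y : Ω → Z)
    (s : Ω → State E F) (ω : Ω) : State E F :=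
  srmbaStep R c k (fun u => p.upper u (X ω)) (fun u => p.lower u (Y ω)) (s ω)

lemma stepState_vx (ω : Ω) : (p.stepState R c k X Y s ω).vx = momentum (c.ρx k)
    (p.dirSample projX 0 (-projX) (pt (s ω).x (s ω).y, (s ω).z) (X ω) (Y ω))
    (p.dirSample projX 0 (-projX) (pt (s ω).xPrev (s ω).yPrev, (s ω).zPrev) (X ω) (Y ω))
    (s ω).vx := by
  rw [← dirX_eq_dirSample, ← dirX_eq_dirSample]; rfl

lemma stepState_vy (ω : Ω) : (p.stepState R c k X Y s ω).vy = momentum (c.ρy k)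
    (p.dirSample 0 projY 0 (pt (s ω).x (s ω).y, (s ω).z) (X ω) (Y ω))
    (p.dirSample 0 projY 0 (pt (s ω).xPrev (s ω).yPrev, (s ω).zPrev) (X ω) (Y ω))
    (s ω).vy := by
  rw [← dirY_eq_dirSample, ← dirY_eq_dirSample]; rfl

lemma stepState_vz (ω : Ω) : (p.stepState R c k X Y s ω).vz = momentum (c.ρz k)
    (p.dirSample (-projY) 0 projY (pt (s ω).x (s ω).y, (s ω).z) (X ω) (Y ω))
    (p.dirSample (-projY) 0 projY (pt (s ω).xPrev (s ω).yPrev, (s ω).zPrev) (X ω) (Y ω))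
    (s ω).vz := by
  rw [← dirZ_eq_dirSample, ← dirZ_eq_dirSample]; rfl

namespace Regular

variable (h : p.Regular Lf Lg₁ Lg₂ μ Cf σf σg₁ σg₂)
include h

lemma goodState_step (hF : p.Fresh m P X Y) (hmm' : m ≤ m') (hm' : m' ≤ mΩ)
    (hX : Measurable[m'] X) (hY : Measurable[m'] Y) (hR : 0 ≤ R) (hs : GoodState m P s) :
    GoodState m' P (p.stepState R c k X Y s) := by
  have hu := inL2_pt hF.le hs.x hs.y
  have hu' := inL2_pt hF.le hs.xPrev hs.yPrev
  have hvx : InL2 m' P fun ω => (p.stepState R c k X Y s ω).vx := by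
    simp_rw [stepState_vx]
    exact h.inL2_momentum hF hmm' hX hY norm_projX_le norm_zero_clm_le norm_neg_projX_le hu hs.z
      hu' hs.zPrev hs.vx _
  have hvy : InL2 m' P fun ω => (p.stepState R c k X Y s ω).vy := by
    simp_rw [stepState_vy]
    exact h.inL2_momentum hF hmm' hX hY norm_zero_clm_le norm_projY_le norm_zero_clm_le hu hs.z
      hu' hs.zPrev hs.vy _
  have hvz : InL2 m' P fun ω => (p.stepState R c k X Y s ω).vz := by
    simp_rw [stepState_vz]
    exact h.inL2_momentum hF hmm' hX hY norm_neg_projY_le norm_zero_clm_le norm_projY_le hu hs.z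
      hu' hs.zPrev hs.vz _
  have hz := (hs.z.mono hmm').sub (hvz.smul (c.γ k))
  exact
    { xPrev := hs.x.mono hmm'
      yPrev := hs.y.mono hmm'
      zPrev := hs.z.mono hmm'
      x := (hs.x.mono hmm').sub (hvx.smul (c.α k))
      y := (hs.y.mono hmm').sub (hvy.smul (c.β k))
      z := hz.of_le hm' ((measurable_projBall R).comp hz.meas) (c := 1) fun ω => by
        rw [one_mul]; exact norm_projBall_le_self hR _
      vx := hvx
      vy := hvy
      vz := hvz }

end Regular

end StochasticBilevel

/-- A common shape for integrating the pathwise one-step inequalities; shorter ones are padded with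
zero coefficients. -/
lemma integral_le_linear_comb {Ω : Type*} {mΩ : MeasurableSpace Ω} {P : Measure Ω}
    {A f₁ f₂ f₃ f₄ f₅ f₆ : Ω → ℝ} (c₁ c₂ c₃ c₄ c₅ c₆ : ℝ) (hA : Integrable A P)
    (h₁ : Integrable f₁ P) (h₂ : Integrable f₂ P) (h₃ : Integrable f₃ P) (h₄ : Integrable f₄ P)
    (h₅ : Integrable f₅ P) (h₆ : Integrable f₆ P)
    (h : ∀ ω, A ω ≤ c₁ * f₁ ω + (c₂ * f₂ ω + (c₃ * f₃ ω + (c₄ * f₄ ω + (c₅ * f₅ ω + c₆ * f₆ ω))))) :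
    ∫ ω, A ω ∂P ≤ c₁ * ∫ ω, f₁ ω ∂P + (c₂ * ∫ ω, f₂ ω ∂P + (c₃ * ∫ ω, f₃ ω ∂P
      + (c₄ * ∫ ω, f₄ ω ∂P + (c₅ * ∫ ω, f₅ ω ∂P + c₆ * ∫ ω, f₆ ω ∂P)))) := by
  have g₁ := h₁.const_mul c₁
  have g₂ := h₂.const_mul c₂
  have g₃ := h₃.const_mul c₃
  have g₄ := h₄.const_mul c₄
  have g₅ := h₅.const_mul c₅
  have g₆ := h₆.const_mul c₆
  have s₅ : Integrable (fun ω => c₅ * f₅ ω + c₆ * f₆ ω) P := g₅.add g₆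
  have s₄ : Integrable (fun ω => c₄ * f₄ ω + (c₅ * f₅ ω + c₆ * f₆ ω)) P := g₄.add s₅
  have s₃ : Integrable (fun ω => c₃ * f₃ ω + (c₄ * f₄ ω + (c₅ * f₅ ω + c₆ * f₆ ω))) P := g₃.add s₄
  have s₂ : Integrable (fun ω => c₂ * f₂ ω
      + (c₃ * f₃ ω + (c₄ * f₄ ω + (c₅ * f₅ ω + c₆ * f₆ ω)))) P := g₂.add s₃
  have s₁ : Integrable (fun ω => c₁ * f₁ ω + (c₂ * f₂ ω
      + (c₃ * f₃ ω + (c₄ * f₄ ω + (c₅ * f₅ ω + c₆ * f₆ ω))))) P := g₁.add s₂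
  have := integral_mono hA s₁ h
  rwa [integral_add g₁ s₂, integral_add g₂ s₃, integral_add g₃ s₄, integral_add g₄ s₅,
    integral_add g₅ g₆, integral_const_mul, integral_const_mul, integral_const_mul,
    integral_const_mul, integral_const_mul, integral_const_mul] at this

/-! ### Pathwise one-step inequalities with a single constant. -/

namespace StochasticBilevel

variable {E F : Type*} [NormedAddCommGroup E] [InnerProductSpace ℝ E] [FiniteDimensional ℝ E]
  [NormedAddCommGroup F] [InnerProductSpace ℝ F] [FiniteDimensional ℝ F]
  [MeasurableSpace E] [BorelSpace E] [MeasurableSpace F] [BorelSpace F]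
  {Ξ Z : Type*} [MeasurableSpace Ξ] [MeasurableSpace Z]
  {p : StochasticBilevel E F Ξ Z} {Lf Lg₁ Lg₂ μ Cf σf σg₁ σg₂ : ℝ}

/-- The squared error of the three estimators at the previous point. -/
def errSq (p : StochasticBilevel E F Ξ Z) (t : State E F) : ℝ :=
  ‖t.vx - dirX p.f p.g t.xPrev t.yPrev t.zPrev‖ ^ 2 + ‖t.vy - dirY p.g t.xPrev t.yPrev‖ ^ 2
    + ‖t.vz - dirZ p.f p.g t.xPrev t.yPrev t.zPrev‖ ^ 2

/-- The squared distance to the lower-level solution. -/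
def gapY (p : StochasticBilevel E F Ξ Z) (s : State E F) : ℝ := ‖s.y - p.yStar s.x‖ ^ 2

/-- The squared distance to the solution of the linear system. -/
def gapZ (p : StochasticBilevel E F Ξ Z) (s : State E F) : ℝ := ‖s.z - p.zStar s.x‖ ^ 2

/-- The squared distance moved in the last iteration. -/
def moveSq (t : State E F) : ℝ :=
  ‖pt t.x t.y - pt t.xPrev t.yPrev‖ ^ 2 + ‖t.z - t.zPrev‖ ^ 2

section Pathwise

variable {R : ℝ} {c : Schedule} {k : ℕ} {φ ψ : Joint E F → ℝ}

lemma errSq_nonneg (t : State E F) : 0 ≤ p.errSq t := by unfold errSq; positivity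

lemma gapY_nonneg (t : State E F) : 0 ≤ p.gapY t := by unfold gapY; positivity

lemma gapZ_nonneg (t : State E F) : 0 ≤ p.gapZ t := by unfold gapZ; positivity

namespace Regular

variable (h : p.Regular Lf Lg₁ Lg₂ μ Cf σf σg₁ σg₂)
include h

lemma stepConst_bounds :
    1 ≤ stepConst Lf Lg₁ Lg₂ μ Cf ∧ 12 / μ ≤ stepConst Lf Lg₁ Lg₂ μ Cf ∧
    12 / μ * lipDir Lf Lg₂ μ Cf ^ 2 ≤ stepConst Lf Lg₁ Lg₂ μ Cf ∧
    6 / μ * (Lg₁ / μ) ^ 2 ≤ stepConst Lf Lg₁ Lg₂ μ Cf ∧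
    6 / μ * (lipDir Lf Lg₂ μ Cf * (1 + Lg₁ / μ) / μ) ^ 2 ≤ stepConst Lf Lg₁ Lg₂ μ Cf ∧
    2 * lipDir Lf Lg₂ μ Cf ^ 2 ≤ stepConst Lf Lg₁ Lg₂ μ Cf ∧
    2 * Lg₁ ^ 2 ≤ stepConst Lf Lg₁ Lg₂ μ Cf ∧
    3 * lipEst Lf Lg₁ Lg₂ μ Cf * (2 + 4 * lipDir Lf Lg₂ μ Cf ^ 2 + 4 * Lg₁ ^ 2)
      ≤ stepConst Lf Lg₁ Lg₂ μ Cf ∧ 0 ≤ lipEst Lf Lg₁ Lg₂ μ Cf := by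
  have hμ := h.μ_pos
  have e0 : 0 ≤ lipEst Lf Lg₁ Lg₂ μ Cf := by unfold lipEst; positivity
  have e1 : 0 ≤ 12 / μ := by positivity
  have e2 : 0 ≤ 12 / μ * lipDir Lf Lg₂ μ Cf ^ 2 := by positivity
  have e3 : 0 ≤ 6 / μ * (Lg₁ / μ) ^ 2 := by positivity
  have e4 : 0 ≤ 6 / μ * (lipDir Lf Lg₂ μ Cf * (1 + Lg₁ / μ) / μ) ^ 2 := by positivity
  have e5 : 0 ≤ 2 * lipDir Lf Lg₂ μ Cf ^ 2 := by positivity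
  have e6 : 0 ≤ 2 * Lg₁ ^ 2 := by positivity
  have e7 : 0 ≤ 3 * lipEst Lf Lg₁ Lg₂ μ Cf * (2 + 4 * lipDir Lf Lg₂ μ Cf ^ 2 + 4 * Lg₁ ^ 2) := by
    positivity
  unfold stepConst
  refine ⟨?_, ?_, ?_, ?_, ?_, ?_, ?_, ?_, e0⟩ <;> linarith

/-- The estimation error is read off the new state: its directions were formed at the point that it
stores as the previous one, namely the current point of s. -/
lemma step_H_le (s : State E F) (ha : 0 ≤ c.α k)
    (haL : lipDir Lf Lg₂ μ Cf * (1 + Lg₁ / μ) ^ 2 * c.α k ≤ 1 / 4) :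
    p.H (srmbaStep R c k φ ψ s).x ≤ p.H s.x - c.α k / 2 * ‖∇ p.H s.x‖ ^ 2
      - c.α k / 4 * ‖(srmbaStep R c k φ ψ s).vx‖ ^ 2
      + stepConst Lf Lg₁ Lg₂ μ Cf * c.α k
        * (p.errSq (srmbaStep R c k φ ψ s) + p.gapY s + p.gapZ s) := by
  obtain ⟨b1, -, -, -, -, b2, b3, -⟩ := h.stepConst_bounds
  set C := stepConst Lf Lg₁ Lg₂ μ Cf
  set t := srmbaStep R c k φ ψ s with ht
  have h1 := h.descent s.x s.y s.z t.vx ha haL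
  have e : t.x = s.x - c.α k • t.vx := rfl
  rw [e]
  refine h1.trans ?_
  have h2 : ‖t.vx - dirX p.f p.g s.x s.y s.z‖ ^ 2 ≤ p.errSq t := by
    have : p.errSq t = ‖t.vx - dirX p.f p.g s.x s.y s.z‖ ^ 2 + ‖t.vy - dirY p.g s.x s.y‖ ^ 2
      + ‖t.vz - dirZ p.f p.g s.x s.y s.z‖ ^ 2 := rfl
    rw [this]
    have := sq_nonneg ‖t.vy - dirY p.g s.x s.y‖
    have := sq_nonneg ‖t.vz - dirZ p.f p.g s.x s.y s.z‖
    linarith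
  have h3 := mul_le_mul_of_nonneg_right b1 (errSq_nonneg (p := p) t)
  have h4 := mul_le_mul_of_nonneg_right b2 (gapY_nonneg (p := p) s)
  have h5 := mul_le_mul_of_nonneg_right b3 (gapZ_nonneg (p := p) s)
  have h6 : ‖t.vx - dirX p.f p.g s.x s.y s.z‖ ^ 2
      + 2 * lipDir Lf Lg₂ μ Cf ^ 2 * ‖s.y - p.yStar s.x‖ ^ 2
      + 2 * Lg₁ ^ 2 * ‖s.z - p.zStar s.x‖ ^ 2 ≤ C * (p.errSq t + p.gapY s + p.gapZ s) := by
    unfold gapY gapZ at *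
    linarith
  have h7 := mul_le_mul_of_nonneg_left h6 ha
  linarith

lemma step_gapY_le (s : State E F) (hb : 0 < c.β k)
    (hbL : c.β k * Lg₁ ^ 2 ≤ μ) (hbμ : c.β k * μ ≤ 1) :
    p.gapY (srmbaStep R c k φ ψ s) ≤ (1 - c.β k * μ / 2) * p.gapY s
      + stepConst Lf Lg₁ Lg₂ μ Cf * c.β k * p.errSq (srmbaStep R c k φ ψ s)
      + stepConst Lf Lg₁ Lg₂ μ Cf * (c.α k ^ 2 / c.β k)
        * ‖(srmbaStep R c k φ ψ s).vx‖ ^ 2 := by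
  obtain ⟨-, b1, -, b2, -⟩ := h.stepConst_bounds
  set C := stepConst Lf Lg₁ Lg₂ μ Cf
  set t := srmbaStep R c k φ ψ s with ht
  have h1 := h.tracking_y s.x s.y t.vy t.x hb hbL hbμ
  have e : t.x - s.x = -(c.α k • t.vx) := by
    have : t.x = s.x - c.α k • t.vx := rfl
    rw [this]; abel
  rw [e, norm_neg, norm_smul, mul_pow, Real.norm_eq_abs, sq_abs] at h1
  refine (h1 : p.gapY t ≤ _).trans ?_
  have h2 : ‖t.vy - dirY p.g s.x s.y‖ ^ 2 ≤ p.errSq t := by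
    have : p.errSq t = ‖t.vx - dirX p.f p.g s.x s.y s.z‖ ^ 2 + ‖t.vy - dirY p.g s.x s.y‖ ^ 2
      + ‖t.vz - dirZ p.f p.g s.x s.y s.z‖ ^ 2 := rfl
    rw [this]
    have := sq_nonneg ‖t.vx - dirX p.f p.g s.x s.y s.z‖
    have := sq_nonneg ‖t.vz - dirZ p.f p.g s.x s.y s.z‖
    linarith
  have hμ := h.μ_pos
  have h3 : 6 * c.β k / μ * ‖t.vy - dirY p.g s.x s.y‖ ^ 2 ≤ C * c.β k * p.errSq t := by
    refine mul_le_mul ?_ h2 (sq_nonneg _) ?_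
    · have h0 : 0 ≤ 6 / μ := by positivity
      have : 6 * c.β k / μ = 6 / μ * c.β k := by ring
      rw [this]
      refine mul_le_mul_of_nonneg_right ?_ hb.le
      have : 12 / μ = 6 / μ + 6 / μ := by ring
      linarith
    · have : 0 ≤ 12 / μ := by positivity
      exact mul_nonneg (this.trans b1) hb.le
  have h4 : 6 / (c.β k * μ) * ((Lg₁ / μ) ^ 2 * (c.α k ^ 2 * ‖t.vx‖ ^ 2))
      ≤ C * (c.α k ^ 2 / c.β k) * ‖t.vx‖ ^ 2 := by
    have e : 6 / (c.β k * μ) * ((Lg₁ / μ) ^ 2 * (c.α k ^ 2 * ‖t.vx‖ ^ 2))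
        = 6 / μ * (Lg₁ / μ) ^ 2 * (c.α k ^ 2 / c.β k * ‖t.vx‖ ^ 2) := by
      field_simp
    rw [e, mul_assoc C]
    exact mul_le_mul_of_nonneg_right b2 (by positivity)
  unfold gapY at *
  linarith

lemma step_gapZ_le (s : State E F) (hb : 0 < c.γ k)
    (hbL : c.γ k * Lg₁ ^ 2 ≤ μ) (hbμ : c.γ k * μ ≤ 1) :
    p.gapZ (srmbaStep (Cf / μ) c k φ ψ s) ≤ (1 - c.γ k * μ / 2) * p.gapZ s
      + stepConst Lf Lg₁ Lg₂ μ Cf * c.γ k * (p.errSq (srmbaStep (Cf / μ) c k φ ψ s) + p.gapY s)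
      + stepConst Lf Lg₁ Lg₂ μ Cf * (c.α k ^ 2 / c.γ k)
        * ‖(srmbaStep (Cf / μ) c k φ ψ s).vx‖ ^ 2 := by
  obtain ⟨-, b1, b3, -, b2, -⟩ := h.stepConst_bounds
  set C := stepConst Lf Lg₁ Lg₂ μ Cf
  set t := srmbaStep (Cf / μ) c k φ ψ s with ht
  have h1 := h.tracking_z s.x s.y s.z t.vz t.x hb hbL hbμ
  have e : t.x - s.x = -(c.α k • t.vx) := by
    have : t.x = s.x - c.α k • t.vx := rfl
    rw [this]; abel
  rw [e, norm_neg, norm_smul, mul_pow, Real.norm_eq_abs, sq_abs] at h1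
  refine (h1 : p.gapZ t ≤ _).trans ?_
  have h2 : ‖t.vz - dirZ p.f p.g s.x s.y s.z‖ ^ 2 ≤ p.errSq t := by
    have : p.errSq t = ‖t.vx - dirX p.f p.g s.x s.y s.z‖ ^ 2 + ‖t.vy - dirY p.g s.x s.y‖ ^ 2
      + ‖t.vz - dirZ p.f p.g s.x s.y s.z‖ ^ 2 := rfl
    rw [this]
    have := sq_nonneg ‖t.vx - dirX p.f p.g s.x s.y s.z‖
    have := sq_nonneg ‖t.vy - dirY p.g s.x s.y‖
    linarith
  have hμ := h.μ_pos
  have h3 : 6 * c.γ k / μ * (2 * ‖t.vz - dirZ p.f p.g s.x s.y s.z‖ ^ 2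
        + 2 * (lipDir Lf Lg₂ μ Cf ^ 2 * ‖s.y - p.yStar s.x‖ ^ 2))
      ≤ C * c.γ k * (p.errSq t + p.gapY s) := by
    have e : 6 * c.γ k / μ * (2 * ‖t.vz - dirZ p.f p.g s.x s.y s.z‖ ^ 2
        + 2 * (lipDir Lf Lg₂ μ Cf ^ 2 * ‖s.y - p.yStar s.x‖ ^ 2))
        = c.γ k * (12 / μ * ‖t.vz - dirZ p.f p.g s.x s.y s.z‖ ^ 2
          + 12 / μ * lipDir Lf Lg₂ μ Cf ^ 2 * p.gapY s) := by
      unfold gapY; ring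
    rw [e, mul_comm C, mul_assoc (c.γ k)]
    refine mul_le_mul_of_nonneg_left ?_ hb.le
    rw [mul_add]
    have : 0 ≤ 12 / μ := by positivity
    exact add_le_add (mul_le_mul b1 h2 (sq_nonneg _) (this.trans b1))
      (mul_le_mul_of_nonneg_right b3 (gapY_nonneg s))
  have h4 : 6 / (c.γ k * μ) * ((lipDir Lf Lg₂ μ Cf * (1 + Lg₁ / μ) / μ) ^ 2
        * (c.α k ^ 2 * ‖t.vx‖ ^ 2)) ≤ C * (c.α k ^ 2 / c.γ k) * ‖t.vx‖ ^ 2 := by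
    have e : 6 / (c.γ k * μ) * ((lipDir Lf Lg₂ μ Cf * (1 + Lg₁ / μ) / μ) ^ 2
        * (c.α k ^ 2 * ‖t.vx‖ ^ 2)) = 6 / μ * (lipDir Lf Lg₂ μ Cf * (1 + Lg₁ / μ) / μ) ^ 2
          * (c.α k ^ 2 / c.γ k * ‖t.vx‖ ^ 2) := by
      field_simp
    rw [e, mul_assoc C]
    exact mul_le_mul_of_nonneg_right b2 (by positivity)
  unfold gapZ at *
  linarith

/-- The factor 3 `lipEst` is what the distance moved carries in the summed error recursion of the
three estimators. The bound on z makes the projection a contraction towards the current point. -/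
lemma step_moveSq_le (s : State E F) (hβγ : c.γ k = c.β k) (hz : ‖s.z‖ ≤ Cf / μ) :
    3 * lipEst Lf Lg₁ Lg₂ μ Cf * moveSq (srmbaStep (Cf / μ) c k φ ψ s)
      ≤ stepConst Lf Lg₁ Lg₂ μ Cf * (c.α k ^ 2 * ‖(srmbaStep (Cf / μ) c k φ ψ s).vx‖ ^ 2
        + c.β k ^ 2 * (p.errSq (srmbaStep (Cf / μ) c k φ ψ s) + p.gapY s + p.gapZ s)) := by
  obtain ⟨-, -, -, -, -, -, -, b1, b0⟩ := h.stepConst_bounds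
  set C := stepConst Lf Lg₁ Lg₂ μ Cf
  set t := srmbaStep (Cf / μ) c k φ ψ s with ht
  set K := lipEst Lf Lg₁ Lg₂ μ Cf
  set D := 2 + 4 * lipDir Lf Lg₂ μ Cf ^ 2 + 4 * Lg₁ ^ 2 with hD
  have h1 := h.movement s.x s.y s.z t.vy t.vz t.vx (a := c.α k) (b := c.β k) hz
  have h2 : moveSq t ≤ D * (c.α k ^ 2 * ‖t.vx‖ ^ 2
      + c.β k ^ 2 * (p.errSq t + p.gapY s + p.gapZ s)) := by
    have e : moveSq t = ‖pt (s.x - c.α k • t.vx) (s.y - c.β k • t.vy) - pt s.x s.y‖ ^ 2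
        + ‖projBall (Cf / μ) (s.z - c.β k • t.vz) - s.z‖ ^ 2 := by
      nth_rw 2 [← hβγ]
      rfl
    rw [e]
    refine h1.trans ?_
    rw [mul_add D]
    refine add_le_add ?_ ?_
    · have : 0 ≤ c.α k ^ 2 * ‖t.vx‖ ^ 2 := by positivity
      nlinarith [sq_nonneg (lipDir Lf Lg₂ μ Cf), sq_nonneg Lg₁]
    · rw [mul_left_comm D]
      refine mul_le_mul_of_nonneg_left ?_ (sq_nonneg _)
      have e2 : p.errSq t = ‖t.vx - dirX p.f p.g s.x s.y s.z‖ ^ 2 + ‖t.vy - dirY p.g s.x s.y‖ ^ 2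
        + ‖t.vz - dirZ p.f p.g s.x s.y s.z‖ ^ 2 := rfl
      have n1 := sq_nonneg ‖t.vx - dirX p.f p.g s.x s.y s.z‖
      have n2 := errSq_nonneg (p := p) t
      have n3 := gapY_nonneg (p := p) s
      have n4 := gapZ_nonneg (p := p) s
      have n5 : 0 ≤ lipDir Lf Lg₂ μ Cf ^ 2 := sq_nonneg _
      have n6 : 0 ≤ Lg₁ ^ 2 := sq_nonneg _
      have a1 : 2 * p.errSq t ≤ D * p.errSq t := mul_le_mul_of_nonneg_right (by linarith) n2
      have a2 : (4 * lipDir Lf Lg₂ μ Cf ^ 2 + 2 * Lg₁ ^ 2) * p.gapY s ≤ D * p.gapY s :=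
        mul_le_mul_of_nonneg_right (by linarith) n3
      have a3 : 4 * Lg₁ ^ 2 * p.gapZ s ≤ D * p.gapZ s :=
        mul_le_mul_of_nonneg_right (by linarith) n4
      unfold gapY gapZ at *
      linarith
  have h3 := mul_le_mul_of_nonneg_left h2 (by positivity : 0 ≤ 3 * K)
  refine h3.trans ?_
  rw [← mul_assoc]
  refine mul_le_mul_of_nonneg_right b1 ?_
  have n2 := errSq_nonneg (p := p) t
  have n3 := gapY_nonneg (p := p) s
  have n4 := gapZ_nonneg (p := p) s
  positivity

end Regular

end Pathwise

end StochasticBilevel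

/-! ### Integrability, the filtration, and the recursion in expectation. -/

namespace StochasticBilevel

variable {E F : Type*} [NormedAddCommGroup E] [InnerProductSpace ℝ E] [FiniteDimensional ℝ E]
  [NormedAddCommGroup F] [InnerProductSpace ℝ F] [FiniteDimensional ℝ F]
  [MeasurableSpace E] [BorelSpace E] [MeasurableSpace F] [BorelSpace F]
  {Ξ Z : Type*} [MeasurableSpace Ξ] [MeasurableSpace Z]
  {p : StochasticBilevel E F Ξ Z} {Lf Lg₁ Lg₂ μ Cf σf σg₁ σg₂ : ℝ}
  {Ω : Type*} {m m' mΩ : MeasurableSpace Ω} {P : Measure Ω} [IsProbabilityMeasure P]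
  {s t : Ω → State E F}

namespace Regular

variable (h : p.Regular Lf Lg₁ Lg₂ μ Cf σf σg₁ σg₂)
include h

lemma inL2_yStar (hm : m ≤ mΩ) {x : Ω → E} (hx : InL2 m P x) :
    InL2 m P fun ω => p.yStar (x ω) :=
  hx.comp_lipschitz hm fun u v => h.low.norm_yStar_sub_le h.μ_pos v u

lemma inL2_zStar (hm : m ≤ mΩ) {x : Ω → E} (hx : InL2 m P x) :
    InL2 m P fun ω => p.zStar (x ω) :=
  hx.comp_lipschitz hm fun u v => h.low.norm_zStar_sub_le h.up h.Lf_nonneg h.Lg₁_nonneg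
    h.Lg₂_nonneg h.μ_pos v u

lemma inL2_gradient (hm : m ≤ mΩ) {x : Ω → E} (hx : InL2 m P x) :
    InL2 m P fun ω => ∇ p.H (x ω) := by
  simp_rw [fun x => (h.hasGradientAt x).gradient, dirX_eq_dir]
  exact h.inL2_dir hm (inL2_pt hm hx (h.inL2_yStar hm hx)) (h.inL2_zStar hm hx)

lemma differentiable_H : Differentiable ℝ p.H := fun x => (h.hasGradientAt x).differentiableAt

/-- The expansion of H at 0 gives at most quadratic growth. -/
lemma integrable_H (hm : m ≤ mΩ) {x : Ω → E} (hx : InL2 m P x) :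
    Integrable (fun ω => p.H (x ω)) P := by
  set q := dirX p.f p.g 0 (p.yStar 0) (p.zStar 0)
  set K := (Lf + Lg₂ * (Cf / μ)) * (1 + Lg₁ / μ) ^ 2
  have hb : Integrable (fun ω => |p.H 0| + ‖q‖ * ‖x ω‖ + K * ‖x ω‖ ^ 2) P :=
    ((integrable_const _).add ((hx.mem.integrable one_le_two).norm.const_mul _)).add
      ((hx.mem.integrable_norm_pow two_ne_zero).const_mul _)
  refine hb.mono' (h.differentiable_H.continuous.measurable.comp
    (hx.meas.mono hm le_rfl)).aestronglyMeasurable (Filter.Eventually.of_forall fun ω => ?_)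
  have h1 := abs_H_sub_le h.low h.up h.Lf_nonneg h.Lg₂_nonneg h.μ_pos 0 (x ω)
  rw [sub_zero] at h1
  have h2 := abs_real_inner_le_norm q (x ω)
  have e : p.H (x ω) = p.H 0 + inner ℝ q (x ω) + (p.H (x ω) - p.H 0 - inner ℝ q (x ω)) := by ring
  rw [Real.norm_eq_abs, e]
  exact (abs_add_le _ _).trans (add_le_add ((abs_add_le _ _).trans (add_le_add_right h2 _)) h1)

lemma integrable_gapY (hm : m ≤ mΩ) (hs : GoodState m P s) :
    Integrable (fun ω => p.gapY (s ω)) P :=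
  (hs.y.sub (h.inL2_yStar hm hs.x)).mem.integrable_norm_pow two_ne_zero

lemma integrable_gapZ (hm : m ≤ mΩ) (hs : GoodState m P s) :
    Integrable (fun ω => p.gapZ (s ω)) P :=
  (hs.z.sub (h.inL2_zStar hm hs.x)).mem.integrable_norm_pow two_ne_zero

lemma inL2_errors (hm : m ≤ mΩ) (hs : GoodState m P s) :
    InL2 m P (fun ω => (s ω).vx - dirX p.f p.g (s ω).xPrev (s ω).yPrev (s ω).zPrev) ∧
    InL2 m P (fun ω => (s ω).vy - dirY p.g (s ω).xPrev (s ω).yPrev) ∧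
    InL2 m P (fun ω => (s ω).vz - dirZ p.f p.g (s ω).xPrev (s ω).yPrev (s ω).zPrev) := by
  have hu := inL2_pt hm hs.xPrev hs.yPrev
  refine ⟨?_, ?_, ?_⟩
  · simp_rw [dirX_eq_dir]
    exact hs.vx.sub (h.inL2_dir hm hu hs.zPrev)
  · simp_rw [fun ω => dirY_eq_dir (p := p) (s ω).xPrev (s ω).yPrev (s ω).zPrev]
    exact hs.vy.sub (h.inL2_dir hm hu hs.zPrev)
  · simp_rw [dirZ_eq_dir]
    exact hs.vz.sub (h.inL2_dir hm hu hs.zPrev)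

lemma integrable_errSq (hm : m ≤ mΩ) (hs : GoodState m P s) :
    Integrable (fun ω => p.errSq (s ω)) P := by
  obtain ⟨a, b, c⟩ := h.inL2_errors hm hs
  exact ((a.mem.integrable_norm_pow two_ne_zero).add (b.mem.integrable_norm_pow two_ne_zero)).add
    (c.mem.integrable_norm_pow two_ne_zero)

lemma integral_errSq (hm : m ≤ mΩ) (hs : GoodState m P s) :
    ∫ ω, p.errSq (s ω) ∂P
      = ∫ ω, ‖(s ω).vx - dirX p.f p.g (s ω).xPrev (s ω).yPrev (s ω).zPrev‖ ^ 2 ∂P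
        + ∫ ω, ‖(s ω).vy - dirY p.g (s ω).xPrev (s ω).yPrev‖ ^ 2 ∂P
        + ∫ ω, ‖(s ω).vz - dirZ p.f p.g (s ω).xPrev (s ω).yPrev (s ω).zPrev‖ ^ 2 ∂P := by
  obtain ⟨a, b, c⟩ := h.inL2_errors hm hs
  have a' := a.mem.integrable_norm_pow two_ne_zero
  have b' := b.mem.integrable_norm_pow two_ne_zero
  have c' := c.mem.integrable_norm_pow two_ne_zero
  simp only [errSq]
  rw [integral_add (f := fun ω => ‖(s ω).vx - dirX p.f p.g (s ω).xPrev (s ω).yPrev (s ω).zPrev‖ ^ 2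
    + ‖(s ω).vy - dirY p.g (s ω).xPrev (s ω).yPrev‖ ^ 2) (a'.add b') c', integral_add a' b']

lemma integrable_moveSq (hm : m ≤ mΩ) (hs : GoodState m P s) :
    Integrable (fun ω => moveSq (s ω)) P :=
  (((inL2_pt hm hs.x hs.y).sub (inL2_pt hm hs.xPrev hs.yPrev)).mem.integrable_norm_pow
    two_ne_zero).add ((hs.z.sub hs.zPrev).mem.integrable_norm_pow two_ne_zero)

variable {c : Schedule} {k : ℕ} {X : Ω → Ξ} {Y : Ω → Z} {ρ : ℝ}

lemma integral_errSq_step_le (hF : p.Fresh m P X Y) (hs : GoodState m P s)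
    (ht : GoodState m' P (p.stepState (Cf / μ) c k X Y s)) (hm' : m' ≤ mΩ)
    (hR : ∀ ω, ‖(s ω).z‖ ≤ Cf / μ) (hx : c.ρx k = ρ) (hy : c.ρy k = ρ) (hz : c.ρz k = ρ)
    (hρ0 : 0 ≤ ρ) (hρ1 : ρ ≤ 1) :
    ∫ ω, p.errSq (p.stepState (Cf / μ) c k X Y s ω) ∂P ≤ (1 - ρ) * ∫ ω, p.errSq (s ω) ∂P
      + 3 * (4 * σf ^ 2 + 8 * σg₁ ^ 2 + 8 * (Cf / μ) ^ 2 * σg₂ ^ 2) * ρ ^ 2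
      + 3 * lipEst Lf Lg₁ Lg₂ μ Cf * ∫ ω, moveSq (s ω) ∂P := by
  have hu := inL2_pt hF.le hs.x hs.y
  have hu' := inL2_pt hF.le hs.xPrev hs.yPrev
  have ex := h.integral_momentum_sub_dir_sq_le hF norm_projX_le norm_zero_clm_le norm_neg_projX_le
    hu hs.z hu' hs.zPrev hs.vx hR hρ0 hρ1
  have ey := h.integral_momentum_sub_dir_sq_le hF norm_zero_clm_le norm_projY_le norm_zero_clm_le
    hu hs.z hu' hs.zPrev hs.vy hR hρ0 hρ1
  have ez := h.integral_momentum_sub_dir_sq_le hF norm_neg_projY_le norm_zero_clm_le norm_projY_le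
    hu hs.z hu' hs.zPrev hs.vz hR hρ0 hρ1
  rw [h.integral_errSq hF.le hs, h.integral_errSq hm' ht]
  have fx : ∀ ω, (p.stepState (Cf / μ) c k X Y s ω).vx
      - dirX p.f p.g (p.stepState (Cf / μ) c k X Y s ω).xPrev
        (p.stepState (Cf / μ) c k X Y s ω).yPrev (p.stepState (Cf / μ) c k X Y s ω).zPrev
      = momentum ρ (p.dirSample projX 0 (-projX) (pt (s ω).x (s ω).y, (s ω).z) (X ω) (Y ω))
    (p.dirSample projX 0 (-projX) (pt (s ω).xPrev (s ω).yPrev, (s ω).zPrev) (X ω) (Y ω))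
    (s ω).vx - p.dir projX 0 (-projX) (pt (s ω).x (s ω).y, (s ω).z) := fun ω => by
    rw [stepState_vx, ← dirX_eq_dir, hx]; rfl
  have fy : ∀ ω, (p.stepState (Cf / μ) c k X Y s ω).vy
      - dirY p.g (p.stepState (Cf / μ) c k X Y s ω).xPrev
        (p.stepState (Cf / μ) c k X Y s ω).yPrev
      = momentum ρ (p.dirSample 0 projY 0 (pt (s ω).x (s ω).y, (s ω).z) (X ω) (Y ω))
    (p.dirSample 0 projY 0 (pt (s ω).xPrev (s ω).yPrev, (s ω).zPrev) (X ω) (Y ω))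
    (s ω).vy - p.dir 0 projY 0 (pt (s ω).x (s ω).y, (s ω).z) := fun ω => by
    rw [stepState_vy, ← dirY_eq_dir, hy]; rfl
  have fz : ∀ ω, (p.stepState (Cf / μ) c k X Y s ω).vz
      - dirZ p.f p.g (p.stepState (Cf / μ) c k X Y s ω).xPrev
        (p.stepState (Cf / μ) c k X Y s ω).yPrev (p.stepState (Cf / μ) c k X Y s ω).zPrev
      = momentum ρ (p.dirSample (-projY) 0 projY (pt (s ω).x (s ω).y, (s ω).z) (X ω) (Y ω))
    (p.dirSample (-projY) 0 projY (pt (s ω).xPrev (s ω).yPrev, (s ω).zPrev) (X ω) (Y ω))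
    (s ω).vz - p.dir (-projY) 0 projY (pt (s ω).x (s ω).y, (s ω).z) := fun ω => by
    rw [stepState_vz, ← dirZ_eq_dir, hz]; rfl
  simp_rw [fx, fy, fz]
  simp_rw [dirX_eq_dir, dirZ_eq_dir, fun ω => dirY_eq_dir (p := p) (s ω).xPrev (s ω).yPrev
    (s ω).zPrev]
  simp only [moveSq]
  linarith

end Regular

section Sampling

/-- What is known after `k` iterations. -/
@[reducible] def past (ξ : ℕ → Ω → Ξ) (ζ : ℕ → Ω → Z) (k : ℕ) : MeasurableSpace Ω :=
  ⨆ i ∈ Set.Iio k, MeasurableSpace.comap (fun ω => (ξ i ω, ζ i ω)) inferInstance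

variable {ξ : ℕ → Ω → Ξ} {ζ : ℕ → Ω → Z}

lemma past_le_succ (k : ℕ) : past ξ ζ k ≤ past ξ ζ (k + 1) :=
  biSup_mono fun _ hi => Set.mem_Iio.2 ((Set.mem_Iio.1 hi).trans (Nat.lt_succ_self k))

lemma measurable_pair_past (k : ℕ) : Measurable[past ξ ζ (k + 1)] fun ω => (ξ k ω, ζ k ω) := by
  have h1 : MeasurableSpace.comap (fun ω => (ξ k ω, ζ k ω)) inferInstance ≤ past ξ ζ (k + 1) :=
    le_biSup (fun i => MeasurableSpace.comap (fun ω => (ξ i ω, ζ i ω)) inferInstance)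
      (Set.mem_Iio.2 (Nat.lt_succ_self k))
  exact (comap_measurable _).mono h1 le_rfl

variable (hS : p.Sampling P ξ ζ)
include hS

lemma Sampling.comap_pair_le (k : ℕ) :
    MeasurableSpace.comap (fun ω => (ξ k ω, ζ k ω)) inferInstance ≤ mΩ :=
  ((hS.measξ k).prodMk (hS.measζ k)).comap_le

lemma Sampling.past_le (k : ℕ) : past ξ ζ k ≤ mΩ :=
  iSup₂_le fun i _ => hS.comap_pair_le i

lemma Sampling.fresh (k : ℕ) : p.Fresh (past ξ ζ k) P (ξ k) (ζ k) := by
  have h1 : Indep (past ξ ζ k)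
      (MeasurableSpace.comap (fun ω => (ξ k ω, ζ k ω)) inferInstance) P := by
    have := indep_iSup_of_disjoint (S := Set.Iio k) (T := {k}) hS.comap_pair_le hS.indep.iIndep
      (by simp)
    simpa [past] using this
  have h2 : Measurable[MeasurableSpace.comap (fun ω => (ξ k ω, ζ k ω)) inferInstance]
      fun ω => (ξ k ω, ζ k ω) := comap_measurable _
  exact
    { le := hS.past_le k
      measX := hS.measξ k
      measY := hS.measζ k
      lawX := hS.lawξ k
      lawY := hS.lawζ k
      indX := indep_of_indep_of_le_right h1 h2.fst.comap_le
      indY := indep_of_indep_of_le_right h1 h2.snd.comap_le }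

variable (h : p.Regular Lf Lg₁ Lg₂ μ Cf σf σg₁ σg₂)
include h

lemma Sampling.goodState_srmba {R : ℝ} (hR : 0 ≤ R) (c : Schedule) (s₀ : State E F) (k : ℕ) :
    GoodState (past ξ ζ k) P (srmba p R c ξ ζ s₀ k) := by
  induction k with
  | zero => exact goodState_const s₀
  | succ k ih =>
    exact h.goodState_step (hS.fresh k) (past_le_succ k) (hS.past_le _)
      (measurable_pair_past k).fst (measurable_pair_past k).snd hR ih

end Sampling

lemma srmba_calls (p : StochasticBilevel E F Ξ Z) (R : ℝ) (c : Schedule) (ξ : ℕ → Ω → Ξ)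
    (ζ : ℕ → Ω → Z) (s₀ : State E F) (k : ℕ) (ω : Ω) :
    (srmba p R c ξ ζ s₀ k ω).calls = s₀.calls + 10 * k := by
  induction k with
  | zero => rfl
  | succ k ih =>
    have : (srmba p R c ξ ζ s₀ (k + 1) ω).calls = (srmba p R c ξ ζ s₀ k ω).calls + 10 := rfl
    rw [this, ih]; ring

/-- The initial z₀ is arbitrary and may lie outside the ball, which is why the recursion below is
stated from k = 1 on. -/
lemma norm_srmba_z_le {R : ℝ} (hR : 0 ≤ R) (c : Schedule) (ξ : ℕ → Ω → Ξ)
    (ζ : ℕ → Ω → Z) (s₀ : State E F) {k : ℕ} (hk : 1 ≤ k) (ω : Ω) :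
    ‖(srmba p R c ξ ζ s₀ k ω).z‖ ≤ R := by
  obtain ⟨j, rfl⟩ := Nat.exists_eq_add_of_le' hk
  exact norm_projBall_le hR _

/-- The one-step inequalities, in expectation, for the averaged quantities `h` (objective),
`n` (squared gradient), `v` (squared step), `y`, `z` (tracking errors), `w` (estimation error). -/
structure Recursion (α : ℕ → ℝ) (b c C S μ : ℝ) (h n v y z w : ℕ → ℝ) : Prop where
  n_nonneg : ∀ k, 0 ≤ n k
  v_nonneg : ∀ k, 0 ≤ v k
  y_nonneg : ∀ k, 0 ≤ y k
  z_nonneg : ∀ k, 0 ≤ z k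
  w_nonneg : ∀ k, 0 ≤ w k
  h_le : ∀ k, 1 ≤ k → h (k + 1) ≤ h k - α k / 2 * n k - α k / 4 * v k
    + C * α k * (w k + y k + z k)
  y_le : ∀ k, 1 ≤ k → y (k + 1) ≤ (1 - b * α k * μ / 2) * y k + C * (b * α k) * w k
    + C * (α k ^ 2 / (b * α k)) * v k
  z_le : ∀ k, 1 ≤ k → z (k + 1) ≤ (1 - b * α k * μ / 2) * z k + C * (b * α k) * (w k + y k)
    + C * (α k ^ 2 / (b * α k)) * v k
  w_le : ∀ k, 1 ≤ k → w (k + 1) ≤ (1 - c * α (k + 1) ^ 2) * w k + S * (c * α (k + 1) ^ 2) ^ 2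
    + C * (α k ^ 2 * v k + (b * α k) ^ 2 * (w k + y k + z k))

/-- Step length and estimation error with index k are taken from the state k + 1, since the
direction used in iteration k is stored there. -/
lemma recursion_srmba {ξ : ℕ → Ω → Ξ} {ζ : ℕ → Ω → Z} (hS : p.Sampling P ξ ζ)
    (h : p.Regular Lf Lg₁ Lg₂ μ Cf σf σg₁ σg₂) {α : ℕ → ℝ} {b c : ℝ} (hb : 0 < b) (hc : 0 ≤ c)
    (hα : ∀ k, 0 < α k) (hαc : ∀ k, c * α k ^ 2 ≤ 1)
    (hαL : ∀ k, lipDir Lf Lg₂ μ Cf * (1 + Lg₁ / μ) ^ 2 * α k ≤ 1 / 4)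
    (hbL : ∀ k, b * α k * Lg₁ ^ 2 ≤ μ) (hbμ : ∀ k, b * α k * μ ≤ 1) (s₀ : State E F)
    {s : ℕ → Ω → State E F} {sch : Schedule} (hs : s = srmba p (Cf / μ) sch ξ ζ s₀)
    (eα : ∀ k, sch.α k = α k) (eβ : ∀ k, sch.β k = b * α k) (eγ : ∀ k, sch.γ k = b * α k)
    (ex : ∀ k, sch.ρx k = c * α k ^ 2) (ey : ∀ k, sch.ρy k = c * α k ^ 2)
    (ez : ∀ k, sch.ρz k = c * α k ^ 2) :
    Recursion α b c (stepConst Lf Lg₁ Lg₂ μ Cf)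
      (3 * (4 * σf ^ 2 + 8 * σg₁ ^ 2 + 8 * (Cf / μ) ^ 2 * σg₂ ^ 2)) μ
      (fun k => ∫ ω, p.H (s k ω).x ∂P) (fun k => p.expSqGrad P fun ω => (s k ω).x)
      (fun k => ∫ ω, ‖(s (k + 1) ω).vx‖ ^ 2 ∂P) (fun k => ∫ ω, p.gapY (s k ω) ∂P)
      (fun k => ∫ ω, p.gapZ (s k ω) ∂P) (fun k => ∫ ω, p.errSq (s (k + 1) ω) ∂P) := by
  have hR : 0 ≤ Cf / μ := (div_pos h.Cf_pos h.μ_pos).le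
  have hG : ∀ k, GoodState (past ξ ζ k) P (s k) := fun k => by
    rw [hs]; exact hS.goodState_srmba h hR sch s₀ k
  have hm := hS.past_le
  have hz : ∀ k, 1 ≤ k → ∀ ω, ‖(s k ω).z‖ ≤ Cf / μ := fun k hk ω => by
    rw [hs]; exact norm_srmba_z_le hR sch ξ ζ s₀ hk ω
  have hst : ∀ k, s (k + 1) = p.stepState (Cf / μ) sch k (ξ k) (ζ k) (s k) := fun k => by
    rw [hs]; rfl
  have iH : ∀ k, Integrable (fun ω => p.H (s k ω).x) P := fun k => h.integrable_H (hm k) (hG k).x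
  have iN : ∀ k, Integrable (fun ω => ‖∇ p.H (s k ω).x‖ ^ 2) P := fun k =>
    (h.inL2_gradient (hm k) (hG k).x).mem.integrable_norm_pow two_ne_zero
  have iV : ∀ k, Integrable (fun ω => ‖(s k ω).vx‖ ^ 2) P := fun k =>
    (hG k).vx.mem.integrable_norm_pow two_ne_zero
  have iY : ∀ k, Integrable (fun ω => p.gapY (s k ω)) P := fun k =>
    h.integrable_gapY (hm k) (hG k)
  have iZ : ∀ k, Integrable (fun ω => p.gapZ (s k ω)) P := fun k =>
    h.integrable_gapZ (hm k) (hG k)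
  have iW : ∀ k, Integrable (fun ω => p.errSq (s k ω)) P := fun k =>
    h.integrable_errSq (hm k) (hG k)
  have iM : ∀ k, Integrable (fun ω => moveSq (s k ω)) P := fun k =>
    h.integrable_moveSq (hm k) (hG k)
  have hstep : ∀ k ω, srmbaStep (Cf / μ) sch k (fun u => p.upper u (ξ k ω))
      (fun u => p.lower u (ζ k ω)) (s k ω) = s (k + 1) ω := fun k ω => by rw [hst k]; rfl
  refine ⟨fun k => integral_nonneg fun _ => by positivity,
    fun k => integral_nonneg fun _ => by positivity, fun k => integral_nonneg fun _ => gapY_nonneg _,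
    fun k => integral_nonneg fun _ => gapZ_nonneg _,
    fun k => integral_nonneg fun _ => errSq_nonneg _, fun k _ => ?_, fun k _ => ?_, fun k _ => ?_,
    fun k hk => ?_⟩
  · have := integral_le_linear_comb 1 (-(α k / 2)) (-(α k / 4)) (stepConst Lf Lg₁ Lg₂ μ Cf * α k) (stepConst Lf Lg₁ Lg₂ μ Cf * α k) (stepConst Lf Lg₁ Lg₂ μ Cf * α k)
      (iH (k + 1)) (iH k) (iN k) (iV (k + 1)) (iW (k + 1)) (iY k) (iZ k) fun ω => by
        have := h.step_H_le (R := Cf / μ) (c := sch) (k := k) (φ := fun u => p.upper u (ξ k ω))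
          (ψ := fun u => p.lower u (ζ k ω)) (s k ω) (by rw [eα]; exact (hα k).le)
          (by rw [eα]; exact hαL k)
        rw [eα] at this
        rw [hstep] at this
        linarith
    simp only [expSqGrad]
    linarith
  · have := integral_le_linear_comb (1 - b * α k * μ / 2) (stepConst Lf Lg₁ Lg₂ μ Cf * (b * α k))
      (stepConst Lf Lg₁ Lg₂ μ Cf * (α k ^ 2 / (b * α k))) 0 0 0
      (iY (k + 1)) (iY k) (iW (k + 1)) (iV (k + 1)) (iY k) (iY k) (iZ k) fun ω => by
        have := h.step_gapY_le (R := Cf / μ) (c := sch) (k := k) (φ := fun u => p.upper u (ξ k ω))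
          (ψ := fun u => p.lower u (ζ k ω)) (s k ω) (by rw [eβ]; exact mul_pos hb (hα k))
          (by rw [eβ]; exact hbL k) (by rw [eβ]; exact hbμ k)
        rw [eα, eβ] at this
        rw [hstep] at this
        linarith
    linarith
  · have := integral_le_linear_comb (1 - b * α k * μ / 2) (stepConst Lf Lg₁ Lg₂ μ Cf * (b * α k)) (stepConst Lf Lg₁ Lg₂ μ Cf * (b * α k))
      (stepConst Lf Lg₁ Lg₂ μ Cf * (α k ^ 2 / (b * α k))) 0 0
      (iZ (k + 1)) (iZ k) (iW (k + 1)) (iY k) (iV (k + 1)) (iY k) (iZ k) fun ω => by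
        have := h.step_gapZ_le (c := sch) (k := k) (φ := fun u => p.upper u (ξ k ω))
          (ψ := fun u => p.lower u (ζ k ω)) (s k ω) (by rw [eγ]; exact mul_pos hb (hα k))
          (by rw [eγ]; exact hbL k) (by rw [eγ]; exact hbμ k)
        rw [eα, eγ] at this
        rw [hstep] at this
        linarith
    linarith
  -- The error of iteration k + 1 is driven by the move from point k to point k + 1. That move is
  -- then bounded by quantities of iteration k, which needs z_k in the ball.
  · have h1 := h.integral_errSq_step_le (hS.fresh (k + 1)) (hG (k + 1))
      (m' := past ξ ζ (k + 2)) (by rw [← hst (k + 1)]; exact hG (k + 2)) (hm _)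
      (hz (k + 1) (Nat.le_add_left 1 k)) (ex (k + 1)) (ey (k + 1)) (ez (k + 1))
      (mul_nonneg hc (sq_nonneg _)) (hαc (k + 1))
    rw [← hst (k + 1)] at h1
    have h2 := integral_le_linear_comb (stepConst Lf Lg₁ Lg₂ μ Cf * α k ^ 2) (stepConst Lf Lg₁ Lg₂ μ Cf * (b * α k) ^ 2) (stepConst Lf Lg₁ Lg₂ μ Cf * (b * α k) ^ 2)
      (stepConst Lf Lg₁ Lg₂ μ Cf * (b * α k) ^ 2) 0 0 ((iM (k + 1)).const_mul (3 * lipEst Lf Lg₁ Lg₂ μ Cf))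
      (iV (k + 1)) (iW (k + 1)) (iY k) (iZ k) (iY k) (iZ k) fun ω => by
        have := h.step_moveSq_le (c := sch) (k := k) (φ := fun u => p.upper u (ξ k ω))
          (ψ := fun u => p.lower u (ζ k ω)) (s k ω) (by rw [eγ, eβ]) (hz k hk ω)
        rw [eα, eβ] at this
        rw [hstep] at this
        linarith
    rw [integral_const_mul] at h2
    linarith

end StochasticBilevel

/-! ### The potential function and the summed inequality. -/

namespace StochasticBilevel

/-- Weights of a potential function which decreases along a `Recursion`. -/
structure PotentialWeights (C μ b c Ay Az Aw : ℝ) : Prop where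
  b_pos : 0 < b
  c_pos : 0 < c
  Ay_pos : 0 < Ay
  Az_pos : 0 < Az
  Aw_pos : 0 < Aw
  w_le : Aw * (1 - c / 2) + C + (Ay + Az) * C * b + 2 * Aw * C * b ^ 2 ≤ 0
  y_le : C - Ay * b * μ / 2 + Az * C * b + 2 * Aw * C * b ^ 2 ≤ 0
  z_le : C - Az * b * μ / 2 + 2 * Aw * C * b ^ 2 ≤ 0
  v_le : -(1 / 4) + (Ay + Az) * C / b + 2 * Aw * C ≤ 0

/-- With A_z = q / b, A_y = r / b and A_w = 1 / b², the conditions on z and y no longer involve b.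
Hence q and then r are chosen to make them equalities, b is taken large for the condition on v, and
c finally makes the condition on w an equality. -/
lemma exists_potentialWeights {C μ : ℝ} (hC : 0 < C) (hμ : 0 < μ) :
    ∃ b c Ay Az Aw : ℝ, PotentialWeights C μ b c Ay Az Aw := by
  obtain ⟨q, hq⟩ : ∃ q, q = 6 * C / μ := ⟨_, rfl⟩
  obtain ⟨r, hr⟩ : ∃ r, r = (6 * C + 2 * q * C) / μ := ⟨_, rfl⟩
  have hq0 : 0 < q := by rw [hq]; positivity
  have hr0 : 0 < r := by rw [hr]; positivity
  have eq : q * μ = 6 * C := by rw [hq]; field_simp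
  have er : r * μ = 6 * C + 2 * q * C := by rw [hr]; field_simp
  obtain ⟨b, hb⟩ : ∃ b, b = 1 + 4 * C * (q + r + 2) := ⟨_, rfl⟩
  have hX : 0 < 4 * C * (q + r + 2) := by positivity
  have hb1 : 1 < b := by linarith
  have hb0 : 0 < b := by linarith
  refine ⟨b, 2 + 2 * b ^ 2 * C * (3 + q + r), r / b, q / b, 1 / b ^ 2, hb0, by positivity,
    by positivity, by positivity, by positivity, ?_, ?_, ?_, ?_⟩
  · refine le_of_eq ?_
    field_simp
    ring
  · have : C - r / b * b * μ / 2 + q / b * C * b + 2 * (1 / b ^ 2) * C * b ^ 2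
        = C - r * μ / 2 + q * C + 2 * C := by field_simp
    rw [this]; linarith
  · have : C - q / b * b * μ / 2 + 2 * (1 / b ^ 2) * C * b ^ 2 = C - q * μ / 2 + 2 * C := by
      field_simp
    rw [this]; linarith
  · have : (r / b + q / b) * C / b + 2 * (1 / b ^ 2) * C = C * (q + r + 2) / b ^ 2 := by
      field_simp; ring
    rw [add_assoc, this]
    have : C * (q + r + 2) / b ^ 2 ≤ 1 / 4 := by
      rw [div_le_iff₀ (by positivity)]
      nlinarith
    linarith

/-- The potential `h + A_y y + A_z z + (A_w / α) w`. -/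
def potential (Ay Az Aw : ℝ) (α h y z w : ℕ → ℝ) (k : ℕ) : ℝ :=
  h k + Ay * y k + Az * z k + Aw * (w k / α k)

namespace Recursion

variable {α h n v y z w : ℕ → ℝ} {b c C S μ Ay Az Aw : ℝ}

lemma potential_succ_le (hr : Recursion α b c C S μ h n v y z w)
    (hA : PotentialWeights C μ b c Ay Az Aw) (hC : 0 < C) (hα : ∀ k, 0 < α k)
    (hhalf : ∀ k, α k ≤ 2 * α (k + 1)) (hinv : ∀ k, 1 / α (k + 1) ≤ 1 / α k + α k)
    {k : ℕ} (hk : 1 ≤ k) :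
    potential Ay Az Aw α h y z w (k + 1) + α k / 2 * n k
      ≤ potential Ay Az Aw α h y z w k + Aw * S * c ^ 2 * α (k + 1) ^ 3 := by
  have hb := hA.b_pos
  have hc := hA.c_pos
  have ha := hα k
  have ha' := hα (k + 1)
  have y1 := mul_le_mul_of_nonneg_left (hr.y_le k hk) hA.Ay_pos.le
  have z1 := mul_le_mul_of_nonneg_left (hr.z_le k hk) hA.Az_pos.le
  have h1 := hr.h_le k hk
  have e1 : α k ^ 2 / (b * α k) = α k / b := by field_simp
  rw [e1] at y1 z1
  have hB : 0 ≤ C * (v k + b ^ 2 * (w k + y k + z k)) := by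
    have := hr.v_nonneg k; have := hr.w_nonneg k; have := hr.y_nonneg k; have := hr.z_nonneg k
    positivity
  have w1 : w (k + 1) / α (k + 1) ≤ w k / α k + (1 - c / 2) * α k * w k
      + S * c ^ 2 * α (k + 1) ^ 3 + 2 * α k * (C * (v k + b ^ 2 * (w k + y k + z k))) := by
    have g1 : w (k + 1) / α (k + 1) ≤ (1 / α (k + 1) - c * α (k + 1)) * w k
        + S * c ^ 2 * α (k + 1) ^ 3
        + (α k ^ 2 / α (k + 1)) * (C * (v k + b ^ 2 * (w k + y k + z k))) := by
      rw [div_le_iff₀ ha']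
      refine (hr.w_le k hk).trans_eq ?_
      field_simp
    have g2 : α k ^ 2 / α (k + 1) ≤ 2 * α k := by
      rw [div_le_iff₀ ha']; nlinarith [hhalf k]
    have g3 := mul_le_mul_of_nonneg_right g2 hB
    -- The growth of 1 / α costs α_k, while α_{k+1} ≥ α_k / 2 makes the momentum gain at least c α_k
    -- / 2.
    have g4 : 1 / α (k + 1) - c * α (k + 1) ≤ 1 / α k + (1 - c / 2) * α k := by
      nlinarith [hhalf k, hinv k]
    have g5 := mul_le_mul_of_nonneg_right g4 (hr.w_nonneg k)
    have g6 : (1 / α k + (1 - c / 2) * α k) * w k = w k / α k + (1 - c / 2) * α k * w k := by ring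
    linarith
  have w2 := mul_le_mul_of_nonneg_left w1 hA.Aw_pos.le
  -- Each weight condition is the total coefficient of w, y, z or v in the potential difference,
  -- divided by α_k.
  have cw := mul_nonneg (mul_nonneg ha.le (hr.w_nonneg k)) (neg_nonneg.2 hA.w_le)
  have cy := mul_nonneg (mul_nonneg ha.le (hr.y_nonneg k)) (neg_nonneg.2 hA.y_le)
  have cz := mul_nonneg (mul_nonneg ha.le (hr.z_nonneg k)) (neg_nonneg.2 hA.z_le)
  have cv := mul_nonneg (mul_nonneg ha.le (hr.v_nonneg k)) (neg_nonneg.2 hA.v_le)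
  have ev : (Ay + Az) * C / b = Ay * (C / b) + Az * (C / b) := by ring
  have ey : Ay * (C * (α k / b) * v k) = Ay * (C / b) * (α k * v k) := by ring
  have ez : Az * (C * (α k / b) * v k) = Az * (C / b) * (α k * v k) := by ring
  rw [ev] at cv
  unfold potential
  linarith

/-- Telescoping from index 1, with the final potential bounded below by m; the cubes of the step
sizes sum to a harmonic number. -/
lemma sum_mul_le (hr : Recursion α b c C S μ h n v y z w)
    (hA : PotentialWeights C μ b c Ay Az Aw) (hC : 0 < C) (hS : 0 ≤ S) (hα : ∀ k, 0 < α k)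
    (hhalf : ∀ k, α k ≤ 2 * α (k + 1)) (hinv : ∀ k, 1 / α (k + 1) ≤ 1 / α k + α k)
    (hcube : ∀ k : ℕ, α (k + 1) ^ 3 ≤ 1 / (k + 1)) {m : ℝ} (hm : ∀ k, m ≤ h k) (K : ℕ) :
    ∑ k ∈ Finset.range K, α (k + 1) / 2 * n (k + 1)
      ≤ potential Ay Az Aw α h y z w 1 - m + Aw * S * c ^ 2 * harmonic (K + 1) := by
  have key : ∀ K, (∑ k ∈ Finset.range K, α (k + 1) / 2 * n (k + 1))
      + potential Ay Az Aw α h y z w (K + 1)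
      ≤ potential Ay Az Aw α h y z w 1 + Aw * S * c ^ 2 * harmonic (K + 1) := by
    intro K
    have hAw := hA.Aw_pos
    induction K with
    | zero => simp; positivity
    | succ K ih =>
      rw [Finset.sum_range_succ, harmonic_succ (K + 1)]
      have h1 := hr.potential_succ_le hA hC hα hhalf hinv (Nat.le_add_left 1 K)
      have h2 := mul_le_mul_of_nonneg_left (hcube (K + 1))
        (by positivity : 0 ≤ Aw * S * c ^ 2)
      push_cast at h2 ⊢
      rw [one_div] at h2
      linarith
  have hpot : m ≤ potential Ay Az Aw α h y z w (K + 1) := by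
    have := hA.Ay_pos; have := hA.Az_pos; have := hA.Aw_pos; have := hα (K + 1)
    have := hr.w_nonneg (K + 1); have := hr.y_nonneg (K + 1); have := hr.z_nonneg (K + 1)
    have h1 : 0 ≤ Ay * y (K + 1) + Az * z (K + 1) + Aw * (w (K + 1) / α (K + 1)) := by positivity
    have := hm (K + 1)
    unfold potential
    linarith
  linarith [key K]

end Recursion

/-- `(η + k)^{-1/3}`. -/
def cubeRootStep (η : ℝ) (k : ℕ) : ℝ := 1 / (η + k) ^ (1 / 3 : ℝ)

/-! ### The step sizes (η + k)^{-1/3}. -/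

section CubeRoot

variable {η : ℝ}

lemma rpow_third_pow {t : ℝ} (ht : 0 ≤ t) : (t ^ (1 / 3 : ℝ)) ^ 3 = t := by
  rw [← Real.rpow_natCast, ← Real.rpow_mul ht]; norm_num

lemma cubeRootStep_pos (hη : 1 ≤ η) (k : ℕ) : 0 < cubeRootStep η k := by
  unfold cubeRootStep; positivity

lemma cubeRootStep_antitone (hη : 1 ≤ η) : Antitone (cubeRootStep η) := fun i j hij => by
  unfold cubeRootStep
  have : (i : ℝ) ≤ j := by exact_mod_cast hij
  gcongr

lemma cubeRootStep_cube (hη : 1 ≤ η) (k : ℕ) : cubeRootStep η k ^ 3 = 1 / (η + k) := by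
  unfold cubeRootStep
  rw [div_pow, rpow_third_pow (by positivity), one_pow]

/-- With η = M³ the largest step is 1 / M, so every smallness condition on the steps becomes a lower
bound on M. -/
lemma mul_cubeRootStep_le_one {M : ℝ} (hM : 1 ≤ M) (k : ℕ) : M * cubeRootStep (M ^ 3) k ≤ 1 := by
  have h := cubeRootStep_antitone (one_le_pow₀ hM : 1 ≤ M ^ 3) (Nat.zero_le k)
  have h0 : cubeRootStep (M ^ 3) 0 = 1 / M := by
    unfold cubeRootStep
    rw [Nat.cast_zero, add_zero, ← Real.rpow_natCast, ← Real.rpow_mul (by linarith)]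
    norm_num
  rw [h0, le_div_iff₀ (by linarith)] at h
  linarith

lemma cubeRootStep_le_two_mul (hη : 1 ≤ η) (k : ℕ) :
    cubeRootStep η k ≤ 2 * cubeRootStep η (k + 1) := by
  have h1 := cubeRootStep_pos hη k
  have h2 := cubeRootStep_pos hη (k + 1)
  refine le_of_pow_le_pow_left₀ three_ne_zero (by positivity) ?_
  rw [mul_pow, cubeRootStep_cube hη, cubeRootStep_cube hη, mul_one_div,
    div_le_div_iff₀ (by positivity) (by positivity)]
  push_cast
  have : (0 : ℝ) ≤ k := k.cast_nonneg
  linarith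

/-- Put t = 1 / α_k ≥ 1 and a = α_k. Since t a = 1, (t + a)³ ≥ t³ + 3 t ≥ t³ + 1, and t³ + 1 is the
cube of the left-hand side. -/
lemma one_div_cubeRootStep_succ_le (hη : 1 ≤ η) (k : ℕ) :
    1 / cubeRootStep η (k + 1) ≤ 1 / cubeRootStep η k + cubeRootStep η k := by
  have h1 := cubeRootStep_pos hη k
  have h2 := cubeRootStep_pos hη (k + 1)
  refine le_of_pow_le_pow_left₀ three_ne_zero (by positivity) ?_
  have hk : (0 : ℝ) ≤ k := k.cast_nonneg
  have e : (1 / cubeRootStep η k) ^ 3 = η + k := by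
    rw [div_pow, cubeRootStep_cube hη]; simp
  have e' : (1 / cubeRootStep η (k + 1)) ^ 3 = η + k + 1 := by
    rw [div_pow, cubeRootStep_cube hη]; push_cast; simp; ring
  have hle : cubeRootStep η k ≤ 1 := by
    refine le_of_pow_le_pow_left₀ three_ne_zero zero_le_one ?_
    rw [cubeRootStep_cube hη, one_pow, div_le_one (by positivity)]
    linarith
  have hge : 1 ≤ 1 / cubeRootStep η k := by rwa [le_div_iff₀ h1, one_mul]
  have hm : 1 / cubeRootStep η k * cubeRootStep η k = 1 := by field_simp
  rw [e']
  generalize 1 / cubeRootStep η k = t at *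
  generalize cubeRootStep η k = a at *
  have : (t + a) ^ 3 = t ^ 3 + 3 * t * (t * a) + 3 * a * (t * a) + a ^ 3 := by ring
  rw [this, hm, e]
  have : 0 ≤ a ^ 3 := by positivity
  linarith

lemma one_div_cubeRootStep_le (hη : 1 ≤ η) {K : ℕ} (hK : 1 ≤ K) :
    1 / cubeRootStep η K ≤ (η + 1) * (K : ℝ) ^ (1 / 3 : ℝ) := by
  have hK' : (1 : ℝ) ≤ K := by exact_mod_cast hK
  unfold cubeRootStep
  rw [one_div_one_div]
  calc (η + K) ^ (1 / 3 : ℝ) ≤ ((η + 1) * K) ^ (1 / 3 : ℝ) := by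
        gcongr; nlinarith
    _ = (η + 1) ^ (1 / 3 : ℝ) * (K : ℝ) ^ (1 / 3 : ℝ) :=
        Real.mul_rpow (by positivity) (by positivity)
    _ ≤ (η + 1) ^ (1 : ℝ) * (K : ℝ) ^ (1 / 3 : ℝ) := by
        gcongr
        · linarith
        · norm_num
    _ = _ := by rw [Real.rpow_one]

end CubeRoot

/-! ### From the summed inequality to the rate and the iteration count. -/

lemma half_lt_log {K : ℕ} (hK : 2 ≤ K) : 1 / 2 < Real.log K := by
  have h2 : (2 : ℝ) ≤ K := by exact_mod_cast hK
  have := Real.log_le_log two_pos h2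
  linarith [Real.log_two_gt_d9]

lemma log_le_two_mul_log_sub_one {K : ℕ} (hK : 3 ≤ K) :
    Real.log K ≤ 2 * Real.log ((K : ℝ) - 1) := by
  have h3 : (3 : ℝ) ≤ K := by exact_mod_cast hK
  have : Real.log ((K : ℝ) - 1) * 2 = Real.log (((K : ℝ) - 1) ^ 2) := by
    rw [Real.log_pow]; push_cast; ring
  rw [mul_comm, this]
  exact Real.log_le_log (by linarith) (by nlinarith)

/-- A recursion with the step sizes `(η + k)^{-1/3}` makes the averages of `n` decay like
`log K / K^{2/3}`. -/
lemma Recursion.exists_average_le {η b c C S μ Ay Az Aw : ℝ} {h n v y z w : ℕ → ℝ} (hη : 1 ≤ η)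
    (hr : Recursion (cubeRootStep η) b c C S μ h n v y z w)
    (hA : PotentialWeights C μ b c Ay Az Aw) (hC : 0 < C) (hS : 0 ≤ S) {m : ℝ}
    (hm : ∀ k, m ≤ h k) :
    ∃ D : ℝ, 0 < D ∧ ∀ K : ℕ, 2 ≤ K →
      (1 / (K : ℝ)) * ∑ k ∈ Finset.range K, n k
        ≤ D * (Real.log K / (K : ℝ) ^ (2 / 3 : ℝ)) := by
  have hα := cubeRootStep_pos hη
  have hAw := hA.Aw_pos
  have hcube : ∀ k : ℕ, cubeRootStep η (k + 1) ^ 3 ≤ 1 / (k + 1) := fun k => by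
    rw [cubeRootStep_cube hη]
    refine one_div_le_one_div_of_le (by positivity) ?_
    push_cast
    linarith
  have hsum := hr.sum_mul_le hA hC hS hα (cubeRootStep_le_two_mul hη)
    (one_div_cubeRootStep_succ_le hη) hcube hm
  obtain ⟨A, hA'⟩ : ∃ A, A = potential Ay Az Aw (cubeRootStep η) h y z w 1 - m := ⟨_, rfl⟩
  obtain ⟨B, hB⟩ : ∃ B, B = Aw * S * c ^ 2 := ⟨_, rfl⟩
  rw [← hA', ← hB] at hsum
  have hB0 : 0 ≤ B := by rw [hB]; positivity
  have hA0 : 0 ≤ A := by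
    have hy := hr.y_nonneg 1; have hz := hr.z_nonneg 1; have hw := hr.w_nonneg 1
    have := hA.Ay_pos; have := hA.Az_pos; have := hα 1
    have h2 : 0 ≤ Ay * y 1 + Az * z 1 + Aw * (w 1 / cubeRootStep η 1) := by positivity
    have := hm 1
    rw [hA']; unfold potential
    linarith
  have hn0 := hr.n_nonneg 0
  -- Since log K > 1/2, A + B (1 + log K) ≤ (2A + 3B) log K and n 0 ≤ 2 n 0 log K · K^{1/3}. The
  -- summand 1 only ensures positivity.
  refine ⟨1 + 2 * n 0 + 2 * (η + 1) * (2 * A + 3 * B), by positivity, fun K hK => ?_⟩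
  have hK2 : (2 : ℝ) ≤ K := by exact_mod_cast hK
  have hK0 : (0 : ℝ) < K := by linarith
  have hlog := half_lt_log hK
  obtain ⟨L, hL⟩ : ∃ L, L = Real.log K := ⟨_, rfl⟩
  rw [← hL] at hlog ⊢
  -- The term with index 0 is not covered by the recursion and is split off; J terms remain.
  obtain ⟨J, rfl⟩ : ∃ J, K = J + 1 := ⟨K - 1, by omega⟩
  set T : ℝ := ((J + 1 : ℕ) : ℝ) ^ (1 / 3 : ℝ) with hT
  have hT1 : 1 ≤ T := Real.one_le_rpow (by linarith) (by norm_num)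
  have hharm : (harmonic (J + 1) : ℝ) ≤ 1 + L := by rw [hL]; exact harmonic_le_one_add_log _
  have h1 : ∑ k ∈ Finset.range J, n (k + 1) ≤ 2 * ((η + 1) * T) * (A + B * (1 + L)) := by
    have g1 : ∑ k ∈ Finset.range J, cubeRootStep η (J + 1) / 2 * n (k + 1) ≤ A + B * (1 + L) := by
      refine le_trans (Finset.sum_le_sum fun k hk => ?_)
        ((hsum J).trans (by gcongr))
      have := cubeRootStep_antitone hη (show k + 1 ≤ J + 1 by
        have := Finset.mem_range.1 hk; omega)
      have := hr.n_nonneg (k + 1)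
      gcongr
    rw [← Finset.mul_sum] at g1
    have g2 : 0 ≤ A + B * (1 + L) := by positivity
    have g3 := one_div_cubeRootStep_le hη (show 1 ≤ J + 1 by omega)
    have hp := hα (J + 1)
    calc ∑ k ∈ Finset.range J, n (k + 1)
        = 2 * (1 / cubeRootStep η (J + 1))
          * (cubeRootStep η (J + 1) / 2 * ∑ k ∈ Finset.range J, n (k + 1)) := by field_simp
      _ ≤ 2 * (1 / cubeRootStep η (J + 1)) * (A + B * (1 + L)) := by gcongr
      _ ≤ _ := by gcongr
  have h2 : ∑ k ∈ Finset.range (J + 1), n k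
      ≤ (1 + 2 * n 0 + 2 * (η + 1) * (2 * A + 3 * B)) * (L * T) := by
    rw [Finset.sum_range_succ']
    have a1 : A + B * (1 + L) ≤ (2 * A + 3 * B) * L := by nlinarith
    have a2 : 2 * ((η + 1) * T) * (A + B * (1 + L))
        ≤ 2 * ((η + 1) * T) * ((2 * A + 3 * B) * L) := by gcongr
    have a3 : 1 / 2 * 1 ≤ L * T := by gcongr
    have a4 : n 0 ≤ 2 * n 0 * (L * T) := by nlinarith
    have a5 : 0 ≤ L * T := by linarith
    linarith
  have hT3 : ((J + 1 : ℕ) : ℝ) = T * ((J + 1 : ℕ) : ℝ) ^ (2 / 3 : ℝ) := by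
    rw [hT, ← Real.rpow_add hK0]; norm_num
  have hT0 : 0 < T := by linarith
  have hU0 : 0 < ((J + 1 : ℕ) : ℝ) ^ (2 / 3 : ℝ) := by positivity
  have e : 1 / ((J + 1 : ℕ) : ℝ) = 1 / (T * ((J + 1 : ℕ) : ℝ) ^ (2 / 3 : ℝ)) := by rw [← hT3]
  calc (1 / ((J + 1 : ℕ) : ℝ)) * ∑ k ∈ Finset.range (J + 1), n k
      ≤ (1 / ((J + 1 : ℕ) : ℝ))
        * ((1 + 2 * n 0 + 2 * (η + 1) * (2 * A + 3 * B)) * (L * T)) := by gcongr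
    _ = _ := by
      rw [e]
      field_simp

/-- If the averages decay like `D log K / K^{2/3}`, then `O(ε^{-3/2} (log ε⁻¹)^{3/2})` terms make
them at most `ε`. -/
lemma exists_nat_log_div_rpow_le {D : ℝ} (hD : 0 < D) :
    ∃ B : ℝ, 0 < B ∧ ∀ ε : ℝ, 0 < ε → ε ≤ 1 / 2 → ∃ K : ℕ, 2 ≤ K ∧
      (K : ℝ) ≤ B * (ε ^ (-(3 / 2) : ℝ) * Real.log (1 / ε) ^ (3 / 2 : ℝ)) ∧
      D * (Real.log K / (K : ℝ) ^ (2 / 3 : ℝ)) ≤ ε := by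
  -- Chosen so that D (5 + 6M) ≤ M², where (5 + 6M) L will bound log K.
  obtain ⟨M, hM⟩ : ∃ M, M = 11 * D + 2 := ⟨_, rfl⟩
  have hM2 : 2 ≤ M := by linarith
  have hM0 : 0 < M := by linarith
  refine ⟨2 * M ^ 3, by positivity, fun ε hε hε2 => ?_⟩
  obtain ⟨L, hL⟩ : ∃ L, L = Real.log (1 / ε) := ⟨_, rfl⟩
  rw [← hL]
  have h2 : 2 ≤ 1 / ε := by rw [le_div_iff₀ hε]; linarith
  have hL1 : 1 / 2 < L := by
    have := Real.log_le_log two_pos h2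
    rw [hL]
    linarith [Real.log_two_gt_d9]
  have hL0 : 0 < L := by linarith
  obtain ⟨u, hu⟩ : ∃ u, u = L / ε := ⟨_, rfl⟩
  have hu1 : 1 ≤ u := by rw [hu, le_div_iff₀ hε]; linarith
  have hu0 : 0 < u := by linarith
  have eu : ε ^ (-(3 / 2) : ℝ) * L ^ (3 / 2 : ℝ) = u ^ (3 / 2 : ℝ) := by
    rw [hu, Real.div_rpow hL0.le hε.le, Real.rpow_neg hε.le]
    ring
  rw [eu]
  have hu32 : 1 ≤ u ^ (3 / 2 : ℝ) := Real.one_le_rpow hu1 (by norm_num)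
  -- K is q rounded up, so that K^{2/3} ≥ M² L / ε while K ≤ 2q, which keeps log K of order L.
  obtain ⟨q, hq⟩ : ∃ q, q = M ^ 3 * u ^ (3 / 2 : ℝ) := ⟨_, rfl⟩
  have hM8 : (2 : ℝ) ^ 3 ≤ M ^ 3 := by gcongr
  have hq2 : 2 ≤ q := by rw [hq]; nlinarith
  have hq0 : 0 < q := by linarith
  have hKq : q ≤ ⌈q⌉₊ := Nat.le_ceil q
  have hKq' : (⌈q⌉₊ : ℝ) ≤ 2 * q := by
    have := Nat.ceil_lt_add_one hq0.le
    linarith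
  have hK0 : (0 : ℝ) < ⌈q⌉₊ := by linarith
  refine ⟨⌈q⌉₊, by exact_mod_cast hq2.trans hKq, by rw [hq] at hKq' ⊢; linarith, ?_⟩
  have hlow : M ^ 2 * u ≤ (⌈q⌉₊ : ℝ) ^ (2 / 3 : ℝ) := by
    calc M ^ 2 * u = q ^ (2 / 3 : ℝ) := by
          rw [hq, Real.mul_rpow (by positivity) (by positivity), ← Real.rpow_natCast M 3,
            ← Real.rpow_mul hM0.le, ← Real.rpow_mul hu0.le]
          norm_num
      _ ≤ _ := by gcongr
  have hup : Real.log ⌈q⌉₊ ≤ (5 + 6 * M) * L := by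
    have e1 : Real.log (2 * q) = Real.log 2 + (3 * Real.log M + 3 / 2 * Real.log u) := by
      rw [Real.log_mul two_ne_zero hq0.ne', hq, Real.log_mul (by positivity) (by positivity),
        Real.log_pow, Real.log_rpow hu0]
      norm_num
    have e2 : Real.log u = Real.log L + L := by
      rw [hu, div_eq_mul_one_div, Real.log_mul hL0.ne' (by positivity), ← hL]
    have e3 := Real.log_le_log hK0 hKq'
    have e4 := Real.log_le_sub_one_of_pos hL0
    have e5 := Real.log_le_sub_one_of_pos hM0
    have e6 := Real.log_two_lt_d9
    nlinarith
  have hMD : D * (5 + 6 * M) ≤ M ^ 2 := by nlinarith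
  rw [← mul_div_assoc, div_le_iff₀ (by positivity)]
  calc D * Real.log ⌈q⌉₊ ≤ D * ((5 + 6 * M) * L) := by gcongr
    _ = D * (5 + 6 * M) * L := by ring
    _ ≤ M ^ 2 * L := by gcongr
    _ = ε * (M ^ 2 * u) := by rw [hu]; field_simp
    _ ≤ _ := by gcongr

end StochasticBilevel

namespace StochasticBilevel

lemma stepConst_pos (Lf Lg₁ Lg₂ Cf : ℝ) {μ : ℝ} (hμ : 0 < μ) : 0 < stepConst Lf Lg₁ Lg₂ μ Cf := by
  have e0 : 0 ≤ lipEst Lf Lg₁ Lg₂ μ Cf := by unfold lipEst; positivity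
  unfold stepConst
  positivity

lemma exists_lt_expSqGrad_le_of_avgSqGrad_le {E F Ξ Z Ω : Type*} [NormedAddCommGroup E]
    [InnerProductSpace ℝ E] [CompleteSpace E] [NormedAddCommGroup F] [InnerProductSpace ℝ F]
    [CompleteSpace F] [MeasurableSpace Ξ] [MeasurableSpace Z] [MeasurableSpace Ω]
    {p : StochasticBilevel E F Ξ Z} {P : Measure Ω} {X : ℕ → Ω → E} {K : ℕ} (hK : 0 < K) {ε : ℝ}
    (h : p.avgSqGrad P X K ≤ ε) : ∃ k < K, p.expSqGrad P (X k) ≤ ε := by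
  by_contra! hlt
  have hK' : (0 : ℝ) < K := by exact_mod_cast hK
  have h1 : ∑ _k ∈ Finset.range K, ε < ∑ k ∈ Finset.range K, p.expSqGrad P (X k) :=
    Finset.sum_lt_sum_of_nonempty (Finset.nonempty_range_iff.2 hK.ne')
      fun k hk => hlt k (Finset.mem_range.1 hk)
  rw [Finset.sum_const, Finset.card_range, nsmul_eq_mul] at h1
  unfold avgSqGrad at h
  rw [one_div, inv_mul_le_iff₀ hK'] at h
  linarith

end StochasticBilevel

end

/-! ### The main theorem. -/

open StochasticBilevel

theorem mainTheorem4 (Lf Lg₁ Lg₂ μ Cf : ℝ) (hLf : 0 ≤ Lf) (hLg₁ : 0 ≤ Lg₁) (hLg₂ : 0 ≤ Lg₂)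
    (hμ : 0 < μ) (hCf : 0 < Cf) :
    ∃ η cβ cγ cx cy cz : ℝ, 0 < η ∧ 0 < cβ ∧ 0 < cγ ∧ 0 < cx ∧ 0 < cy ∧ 0 < cz ∧
      ∀ (dx dy : ℕ) (Ξ Z Ω : Type*) [MeasurableSpace Ξ] [MeasurableSpace Z] [MeasurableSpace Ω]
        (p : StochasticBilevel (EuclideanSpace ℝ (Fin dx)) (EuclideanSpace ℝ (Fin dy)) Ξ Z)
        (σf σg₁ σg₂ : ℝ),
        p.WellPosed → p.UpperSmooth Lf Cf → p.LowerSmooth Lg₁ Lg₂ μ →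
        p.BoundedVariance σf σg₁ σg₂ → p.MeanSquaredSmooth Lf Lg₁ Lg₂ →
        BddBelow (Set.range p.H) →
        ∀ (P : Measure Ω) [IsProbabilityMeasure P] (ξ : ℕ → Ω → Ξ) (ζ : ℕ → Ω → Z),
        p.Sampling P ξ ζ →
        ∀ (s₀ : State (EuclideanSpace ℝ (Fin dx)) (EuclideanSpace ℝ (Fin dy)))
          (s : ℕ → Ω → State (EuclideanSpace ℝ (Fin dx)) (EuclideanSpace ℝ (Fin dy)))
          (x : ℕ → Ω → EuclideanSpace ℝ (Fin dx)), s₀.calls = 0 →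
        s = srmba p (Cf / μ) (stormSchedule η cβ cγ cx cy cz) ξ ζ s₀ →
        (∀ k ω, x k ω = (s k ω).x) →
          Differentiable ℝ p.H ∧
          (∀ k, Integrable (fun ω => ‖∇ p.H (x k ω)‖ ^ 2) P) ∧
          ∃ C : ℝ, 0 < C ∧
            (∀ K : ℕ, 2 ≤ K →
              p.avgSqGrad P x K ≤ C * (Real.log K / (K : ℝ) ^ (2 / 3 : ℝ))) ∧
            (∀ K : ℕ, 3 ≤ K →
              p.avgSqGrad P x K ≤ C * (Real.log ((K : ℝ) - 1) / (K : ℝ) ^ (2 / 3 : ℝ))) ∧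
            (∀ ε : ℝ, 0 < ε → ε ≤ 1 / 2 → ∃ K : ℕ, 0 < K ∧
              (∀ ω, ((s K ω).calls : ℝ)
                ≤ C * (ε ^ (-(3 / 2) : ℝ) * Real.log (1 / ε) ^ (3 / 2 : ℝ))) ∧
              p.avgSqGrad P x K ≤ ε ∧ ∃ k < K, p.expSqGrad P (x k) ≤ ε) := by
  have hC := stepConst_pos Lf Lg₁ Lg₂ Cf hμ
  obtain ⟨b, c, Ay, Az, Aw, hA⟩ := exists_potentialWeights hC hμ
  have hb := hA.b_pos
  have hc := hA.c_pos
  obtain ⟨l, hl⟩ : ∃ l, l = lipDir Lf Lg₂ μ Cf * (1 + Lg₁ / μ) ^ 2 := ⟨_, rfl⟩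
  -- One summand for each smallness condition: α ≤ 1, ρ ≤ 1, the descent step, and the two
  -- conditions of the tracking steps. The variances do not occur.
  obtain ⟨M, hM⟩ : ∃ M, M = 1 + c + 4 * |l| + b * Lg₁ ^ 2 / μ + b * μ := ⟨_, rfl⟩
  have t1 : 0 ≤ |l| := abs_nonneg l
  have t2 : 0 ≤ b * Lg₁ ^ 2 / μ := by positivity
  have t3 : 0 < b * μ := by positivity
  have hM1 : 1 ≤ M := by linarith
  have hη : 1 ≤ M ^ 3 := one_le_pow₀ hM1
  have hα := cubeRootStep_pos hη
  have hMα := mul_cubeRootStep_le_one hM1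
  have hle : ∀ {a : ℝ}, a ≤ M → ∀ k, a * cubeRootStep (M ^ 3) k ≤ 1 := fun ha k =>
    (mul_le_mul_of_nonneg_right ha (hα k).le).trans (hMα k)
  have hα1 : ∀ k, cubeRootStep (M ^ 3) k ≤ 1 := fun k => by simpa using hle hM1 k
  refine ⟨M ^ 3, b, b, c, c, c, by positivity, hb, hb, hc, hc, hc, ?_⟩
  intro dx dy Ξ Z Ω _ _ _ p σf σg₁ σg₂ wp up low var mss hbdd P _ ξ ζ hS s₀ s x hcalls hs hx
  have h : p.Regular Lf Lg₁ Lg₂ μ Cf σf σg₁ σg₂ :=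
    ⟨hLf, hLg₁, hLg₂, hμ, hCf, wp, up, low, var, mss⟩
  obtain rfl : x = fun k ω => (s k ω).x := funext fun k => funext fun ω => hx k ω
  have hR : 0 ≤ Cf / μ := (div_pos hCf hμ).le
  have hG : ∀ k, GoodState (past ξ ζ k) P (s k) := fun k => by
    rw [hs]; exact hS.goodState_srmba h hR _ s₀ k
  refine ⟨h.differentiable_H, fun k =>
    (h.inL2_gradient (hS.past_le k) (hG k).x).mem.integrable_norm_pow two_ne_zero, ?_⟩
  have hr := recursion_srmba hS h hb hc.le hα
    (fun k => by
      have h1 := hle (a := c) (by linarith) k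
      have h2 := hα1 k
      have h3 := hα k
      nlinarith)
    (fun k => by
      have h1 := hle (a := 4 * |l|) (by linarith) k
      have h2 := mul_le_mul_of_nonneg_right (le_abs_self l) (hα k).le
      rw [← hl]
      linarith)
    (fun k => by
      have h1 := hle (a := b * Lg₁ ^ 2 / μ) (by linarith) k
      rw [div_mul_eq_mul_div, div_le_one hμ] at h1
      linarith)
    (fun k => by
      have h1 := hle (a := b * μ) (by linarith) k
      linarith)
    s₀ hs (fun _ => rfl) (fun _ => rfl) (fun _ => rfl) (fun _ => rfl) (fun _ => rfl)
    fun _ => rfl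
  obtain ⟨m, hm⟩ := hbdd
  have hmH : ∀ k, m ≤ ∫ ω, p.H (s k ω).x ∂P := fun k => by
    have := integral_mono (integrable_const m) (h.integrable_H (hS.past_le k) (hG k).x)
      fun ω => hm ⟨_, rfl⟩
    simpa using this
  obtain ⟨D, hD, hrate⟩ := hr.exists_average_le hη hA hC (by positivity) hmH
  obtain ⟨B, hB, hcomp⟩ := exists_nat_log_div_rpow_le hD
  have hrate' : ∀ K : ℕ, 2 ≤ K → p.avgSqGrad P (fun k ω => (s k ω).x) K
      ≤ D * (Real.log K / (K : ℝ) ^ (2 / 3 : ℝ)) := hrate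
  -- 2D absorbs log K ≤ 2 log (K - 1), valid for K ≥ 3; 10B counts ten oracle calls per iteration.
  refine ⟨2 * D + 10 * B, by positivity, fun K hK => (hrate' K hK).trans ?_,
    fun K hK => (hrate' K (by omega)).trans ?_, fun ε hε hε2 => ?_⟩
  · have := half_lt_log hK
    gcongr
    linarith
  · have h1 := log_le_two_mul_log_sub_one hK
    have h2 := half_lt_log (show 2 ≤ K by omega)
    calc D * (Real.log K / (K : ℝ) ^ (2 / 3 : ℝ))
        ≤ D * (2 * Real.log ((K : ℝ) - 1) / (K : ℝ) ^ (2 / 3 : ℝ)) := by gcongr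
      _ = 2 * D * (Real.log ((K : ℝ) - 1) / (K : ℝ) ^ (2 / 3 : ℝ)) := by ring
      _ ≤ _ := by
        gcongr
        · exact div_nonneg (by linarith) (by positivity)
        · linarith
  · obtain ⟨K, hK2, hKB, hKε⟩ := hcomp ε hε hε2
    have havg := (hrate' K hK2).trans hKε
    refine ⟨K, by omega, fun ω => ?_, havg,
      exists_lt_expSqGrad_le_of_avgSqGrad_le (by omega) havg⟩
    rw [hs, srmba_calls, hcalls]
    have hlog : 0 ≤ Real.log (1 / ε) :=
      Real.log_nonneg (by rw [le_div_iff₀ hε]; linarith)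
    have hX : 0 ≤ ε ^ (-(3 / 2) : ℝ) * Real.log (1 / ε) ^ (3 / 2 : ℝ) := by positivity
    push_cast
    nlinarith
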